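/- **Setting.** Let $E\subseteq\mathbb R$ be measurable and let $\rho\ge 0$ be a weight on $E$, not almost everywhere zero on $E$, with $\int_E|u|^k\rho(u)\,du<\infty$ for all $k\ge 0$. Put $\rho_t(u)=\rho(u)e^{\sum_{i\ge1}t_iu^i}$, $t=(t_1,t_2,\dots)$, $\mu_{ij}(t)=\int_E u^{i+j}\rho_t(u)\,du$, $m_n(t)=(\mu_{ij}(t))_{0\le i,j<n}$, $m_\infty(t)=(\mu_{ij}(t))_{i,j\ge 0}$, $\tau_n(t)=\det m_n(t)$, $h_n=\tau_{n+1}/\tau_n$. A *factorization* of $m_\infty$ is $m_\infty=S^{-1}(S^{\top})^{-1}$ with $S$ lower triangular with non-zero diagonal. Given one, put $L=S\Lambda S^{-1}$ with $\Lambda$ the shift, $(\Lambda v)_n=v_{n+1}$; $p_n(t;z)=(S\chi(z))_n$ with $\chi(z)=(1,z,z^2,\dots)^\top$; and $q_n(t;z)=z\int_E\frac{p_n(t;u)}{z-u}\rho_t(u)\,du$. Write $[w]=(w,w^2/2,w^3/3,\dots)$. Write $M=M_{\mathfrak s}+M_{\mathfrak b}$ for the splitting of a semi-infinite matrix into a skew-symmetric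 and a lower triangular (diagonal included) part. Elementary Schur polynomials: $e^{\sum t_iz^i}=\sum_k\mathbf s_k(t)z^k$. Hirota symbol: $P(\partial_t)f\circ g=P(\partial_y)f(t+y)g(t-y)|_{y=0}$. The assertions below hold in two senses. **(A) Formally, for every such weight:** all quantities are formal power series in $t_1,t_2,\dots$ (moments and other integrals over $E$ are taken coefficient by coefficient), $z^{-1}$ is a formal variable, $1/(z-u)$ is expanded at $z=\infty$, and $\oint_\infty$ is the formal residue, i.e. the coefficient of $z^{-1}$. Here each $\tau_n$ has positive constant coefficient, and a factorization exists, with $S_{nn}$ having positive constant coefficients. **(B) Analytically, if moreover $E\subseteq[-R,R]$:** $t$ (and $t'$) are complex sequences with $\sum_i|t_i|R^i<\infty$, and $z\in\mathbb C$ with $|z|>R$. Here $\tau_n$ is entire in any finite number of the times. A factorization exists whenever $\tau_n(t)\ne0$ for all $n$ (and only then); for real $t$ all $\tau_n(t)$ are positive and there is a real factorization with $S_{nn}>0$. Derivatives of $\log$ are those of a local branch. **Integral.** $\displaystyle\tau_n(t)=\frac1{n!}\int_{E^n}\prod_{i<j}(z_i-z_j)^2\prod_{k=1}^n\rho_t(z_k)\,dz_k$,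 the integrand being integrable. For every factorization, with $h_n^{-1/2}:=S_{nn}$ (which is a square root of $h_n^{-1}$): **(i)** $L$ is tridiagonal and symmetric; $(Lp)_n=zp_n$ for $n\ge0$, $(Lq)_n=zq_n$ for $n\ge1$, and $p=(p_n)$, $q=(q_n)$ are linearly independent. $p_n$ is a polynomial of degree $n$ in $z$, $\int_Ep_mp_n\rho_t\,du=\delta_{mn}$, and $$p_n(t;z)=z^nh_n^{-1/2}\frac{\tau_n(t-[z^{-1}])}{\tau_n(t)},\qquad q_n(t;z)=\left((S^{\top})^{-1}\chi(z^{-1})\right)_n=z^{-n}h_n^{-1/2}\frac{\tau_{n+1}(t+[z^{-1}])}{\tau_n(t)}.$$ **(ii)** $L_{nn}=\frac{\partial}{\partial t_1}\log\frac{\tau_{n+1}}{\tau_n}$ and $L_{n,n+1}=L_{n+1,n}=\left(\frac{\tau_n\tau_{n+2}}{\tau_{n+1}^2}\right)^{1/2}$, the root being $S_{nn}/S_{n+1,n+1}$. For all $k\ge1$ $$\frac{\partial L}{\partial t_k}=\left[\tfrac12(L^k)_{\mathfrak s},L\right]=-\left[\tfrac12(L^k)_{\mathfrak b},L\right],$$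 and these equations commute: $\frac{\partial}{\partial t_l}\left[\tfrac12(L^k)_{\mathfrak s},L\right]=\frac{\partial}{\partial t_k}\left[\tfrac12(L^l)_{\mathfrak s},L\right]$. (In (B) this holds along any set $U$ of times on which a factorization $S(t)$ is given whose diagonal entries are continuous in each $t_k$ along $U$, with derivatives taken along $U$; for instance $U$ may be the set of all real $t$, with $S_{nn}>0$.) **(iii)** For $n\ge m+1$, $m\ge 0$, and all $t,t'$, $$\oint_{z=\infty}\tau_n(t-[z^{-1}])\,\tau_{m+1}(t'+[z^{-1}])\,e^{\sum_i(t_i-t'_i)z^i}z^{n-m-1}\,dz=0;$$ in (B) the integral is over any circle $|z|=r$, $r>R$, with $\sum_i|t_i-t_i'|r^i<\infty$. **(iv)** For $k\ge0$, $n\ge1$, $$\left(\mathbf s_{k+4}\left(\tfrac{\partial}{\partial t_1},\tfrac12\tfrac{\partial}{\partial t_2},\tfrac13\tfrac{\partial}{\partial t_3},\dots\right)-\tfrac12\tfrac{\partial^2}{\partial t_1\partial t_{k+3}}\right)\tau_n\circ\tau_n=0,$$ and (in (B): wherever $\tau_n(t)\neq 0$) $$\left(\left(\tfrac{\partial}{\partial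 t_1}\right)^4+3\left(\tfrac{\partial}{\partial t_2}\right)^2-4\tfrac{\partial^2}{\partial t_1\partial t_3}\right)\log\tau_n+6\left(\tfrac{\partial^2}{\partial t_1^2}\log\tau_n\right)^2=0.$$ -/

import Mathlib

open MeasureTheory

namespace TodaKP

noncomputable section

/-! ### Semi-infinite matrices -/

section InfiniteMatrices

variable {A : Type*} [CommRing A]

/-- Product of semi-infinite matrices. (All products below are of matrices for which each of
these sums has only finitely many non-zero terms.) -/
def imul (M N : Matrix ℕ ℕ A) : Matrix ℕ ℕ A := fun i j => ∑ᶠ k, M i k * N k j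

/-- Powers of a semi-infinite matrix. -/
def ipow (M : Matrix ℕ ℕ A) : ℕ → Matrix ℕ ℕ A
  | 0 => 1
  | k + 1 => imul (ipow M k) M

/-- Commutator of semi-infinite matrices. -/
def ibracket (M N : Matrix ℕ ℕ A) : Matrix ℕ ℕ A := imul M N - imul N M

/-- A semi-infinite matrix applied to a semi-infinite column with entries in an `A`-module. -/
def iact {V : Type*} [AddCommGroup V] [Module A V] (M : Matrix ℕ ℕ A) (v : ℕ → V) : ℕ → V :=
  fun n => ∑ᶠ k, M n k • v k

/-- The shift matrix `Λ`, `(Λ v)_n = v_{n+1}`. -/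
def shiftMat : Matrix ℕ ℕ A := fun i j => if j = i + 1 then 1 else 0

/-- The skew-symmetric component in the splitting of matrices into
skew-symmetric ones and lower triangular (diagonal included) ones. -/
def skewPart (M : Matrix ℕ ℕ A) : Matrix ℕ ℕ A :=
  fun i j => if i < j then M i j else if j < i then - M j i else 0

/-- The lower triangular (Borel) component in the same splitting. -/
def borelPart (M : Matrix ℕ ℕ A) : Matrix ℕ ℕ A := M - skewPart M

theorem skewPart_transpose (M : Matrix ℕ ℕ A) : (skewPart M).transpose = - skewPart M := by
  ext i j
  simp only [Matrix.transpose_apply, Matrix.neg_apply, skewPart]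
  rcases lt_trichotomy i j with h | h | h
  · simp [h, h.not_gt]
  · simp [h]
  · simp [h, h.not_gt]

theorem borelPart_of_lt (M : Matrix ℕ ℕ A) {i j : ℕ} (h : i < j) : borelPart M i j = 0 := by
  simp [borelPart, skewPart, h]

/-- `m = S⁻¹ (Sᵀ)⁻¹` with `S` lower triangular with non-zero diagonal;
`T` is the lower triangular inverse of `S`. -/
structure IsLowerFactorization (m S T : Matrix ℕ ℕ A) : Prop where
  lower : ∀ i j, i < j → S i j = 0
  diag : ∀ n, S n n ≠ 0
  lower_inv : ∀ i j, i < j → T i j = 0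
  mul_inv : imul S T = 1
  inv_mul : imul T S = 1
  factor : m = imul T T.transpose

/-- The top left `n × n` minor. -/
def minorDet (m : Matrix ℕ ℕ A) (n : ℕ) : A :=
  (m.submatrix (fun i : Fin n => (i : ℕ)) (fun j : Fin n => (j : ℕ))).det

/-- `L = S Λ S⁻¹`. -/
def lax (S T : Matrix ℕ ℕ A) : Matrix ℕ ℕ A := imul (imul S shiftMat) T

/-- `p_n(z) = (S χ(z))_n`, `χ(z) = (1, z, z², …)ᵀ`, as a polynomial in `z`. -/
def pPoly (S : Matrix ℕ ℕ A) : ℕ → Polynomial A :=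
  iact S (fun k => (Polynomial.X : Polynomial A) ^ k)

/-- The right-hand side `[½ (L^k)_𝔰, L]` of the `k`-th Toda equation. -/
def todaSkew (K : Type*) [Field K] [Algebra K A] (L : Matrix ℕ ℕ A) (k : ℕ) : Matrix ℕ ℕ A :=
  ibracket ((2⁻¹ : K) • skewPart (ipow L k)) L

/-- The matrix `-[½ (L^k)_𝔟, L]`. -/
def todaBorel (K : Type*) [Field K] [Algebra K A] (L : Matrix ℕ ℕ A) (k : ℕ) : Matrix ℕ ℕ A :=
  - ibracket ((2⁻¹ : K) • borelPart (ipow L k)) L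

end InfiniteMatrices

/-! ### Schur polynomials, polynomials in partial derivatives -/

section Operators

variable (K : Type*) [Field K]

/-- `∑_{i ≥ 1} t_i z^i`, a power series in `z` with polynomial coefficients. -/
def schurExponent : PowerSeries (MvPolynomial ℕ+ K) :=
  PowerSeries.mk fun i => match i with
    | 0 => 0
    | i + 1 => MvPolynomial.X (Nat.succPNat i)

/-- The elementary Schur polynomial `s_k(t)`: the coefficient of `z^k` in `exp (∑_{i ≥ 1} t_i z^i)`.
The exponential series may be cut off after its `k`-th term, since the `j`-th power of
`∑_{i ≥ 1} t_i z^i` is divisible by `z^j`. -/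
def schur (k : ℕ) : MvPolynomial ℕ+ K :=
  ∑ j ∈ Finset.range (k + 1),
    MvPolynomial.C ((j.factorial : K)⁻¹) * PowerSeries.coeff k (schurExponent K ^ j)

/-- The polynomial `s_k(t_1, t_2 / 2, t_3 / 3, …)`. -/
def schurTilde (k : ℕ) : MvPolynomial ℕ+ K :=
  MvPolynomial.bind₁ (fun i : ℕ+ => MvPolynomial.C ((i : K)⁻¹) * MvPolynomial.X i) (schur K k)

/-- The polynomial `s_{k+4}(t_1, t_2 / 2, …) - ½ t_1 t_{k+3}` defining the `k`-th equation of the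
KP hierarchy. -/
def kpPoly (k : ℕ) : MvPolynomial ℕ+ K :=
  schurTilde K (k + 4) - MvPolynomial.C (2⁻¹ : K) * MvPolynomial.X 1 *
    MvPolynomial.X (Nat.succPNat (k + 2))

variable {K} {V : Type*} [AddCommGroup V] [Module K V]

/-- `∏ k, (D k)^(β k)` applied to `v`. -/
def monoOp (D : ℕ+ → V → V) (β : ℕ+ →₀ ℕ) (v : V) : V :=
  β.support.sort.foldr (fun k w => (D k)^[β k] w) v

/-- `p(D_1, D_2, …)` applied to `v`. -/
def polyOp (D : ℕ+ → V → V) (p : MvPolynomial ℕ+ K) (v : V) : V :=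
  ∑ β ∈ p.support, p.coeff β • monoOp D β v

end Operators

/-- A weight `ρ ≥ 0` on `E ⊆ ℝ`: not almost everywhere zero on `E`, with all its moments finite. -/
structure IsWeight (E : Set ℝ) (ρ : ℝ → ℝ) : Prop where
  meas : MeasurableSet E
  nonneg : ∀ u ∈ E, 0 ≤ ρ u
  moments : ∀ k : ℕ, IntegrableOn (fun u => u ^ k * ρ u) E
  pos : 0 < ∫ u in E, ρ u

/-- `Δ_n(x)² = ∏_{i<j} (x_i - x_j)²`. -/
def vandermondeSq {n : ℕ} (x : Fin n → ℝ) : ℝ := (∏ i, ∏ j ∈ Finset.Ioi i, (x i - x j)) ^ 2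

/-! ### The times `t` as formal variables -/

section Formal

/-- Formal power series in the times `t = (t_1, t_2, …)`. -/
abbrev FSeries := MvPowerSeries ℕ+ ℝ

/-- `exp (∑_{i ≥ 1} t_i u^i) = ∑_α ∏_i (t_i u^i)^{α_i} / α_i!` as a formal power series in `t`. -/
def fexp (u : ℝ) : FSeries := fun α => α.prod fun i a => (u ^ (i : ℕ)) ^ a / a.factorial

/-- Coefficientwise integral `∫_E F(u) ρ(u) du` of a family of formal power series in `t`. -/
def fint (E : Set ℝ) (ρ : ℝ → ℝ) (F : ℝ → FSeries) : FSeries :=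
  fun α => ∫ u in E, MvPowerSeries.coeff α (F u) * ρ u

/-- The moment matrix `m_∞(t)`, `μ_{ij}(t) = ∫_E u^i u^j ρ(u) exp (∑ t_k u^k) du`. -/
def fmom (E : Set ℝ) (ρ : ℝ → ℝ) : Matrix ℕ ℕ FSeries :=
  fun i j => fint E ρ fun u => MvPowerSeries.C (u ^ i * u ^ j) * fexp u

/-- `τ_n(t) = det m_n(t)`. -/
def ftau (E : Set ℝ) (ρ : ℝ → ℝ) (n : ℕ) : FSeries := minorDet (fmom E ρ) n

/-- `∂/∂t_k`. -/
def fpd (k : ℕ+) (f : FSeries) : FSeries := MvPowerSeries.pderiv ℝ k f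

/-- `log f` for a formal power series with positive constant coefficient `c`:
`log c + log (1 + (f / c - 1))`. -/
def flog (f : FSeries) : FSeries :=
  MvPowerSeries.C (Real.log (MvPowerSeries.constantCoeff f)) +
    (PowerSeries.log ℝ).subst (MvPowerSeries.C (MvPowerSeries.constantCoeff f)⁻¹ * f - 1)

/-- `t ↦ t + ε [w]`, `[w] = (w, w²/2, w³/3, …)`; the variable `w` is `X none`. -/
def fshiftVars (ε : ℝ) : ℕ+ → MvPowerSeries (Option ℕ+) ℝ := fun i =>
  MvPowerSeries.X (some i) + MvPowerSeries.C (ε / (i : ℝ)) * MvPowerSeries.X none ^ (i : ℕ)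

/-- `f(t + ε [w])` as a power series in `w` whose coefficients are formal power series in `t`.
It is used with `w = z⁻¹`. -/
def fshift (ε : ℝ) (f : FSeries) : PowerSeries FSeries :=
  MvPowerSeries.optionEquivLeft ℕ+ ℝ (f.subst (fshiftVars ε))

/-- The ring of formal Laurent series in `w = z⁻¹` over the formal power series in `t`. -/
abbrev FLaurent := LaurentSeries FSeries

/-- The variable `z = w⁻¹`. -/
def fz : FLaurent := HahnSeries.single (-1) 1

/-- The variable `w = z⁻¹`. -/
def fw : FLaurent := HahnSeries.single 1 1

/-- Power series in `w = z⁻¹` as Laurent series. -/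
def ofW : PowerSeries FSeries →+* FLaurent := HahnSeries.ofPowerSeries ℤ FSeries

/-- `p_n(t; z)` as a Laurent series. -/
def fp (S : Matrix ℕ ℕ FSeries) (n : ℕ) : FLaurent := (pPoly S n).eval₂ HahnSeries.C fz

/-- The Stieltjes transform `q_n(t; z) = z ∫ p_n(t; u) / (z - u) ρ_t(u) du`, expanded at `z = ∞`
through `z / (z - u) = ∑_j u^j z^{-j}`. -/
def fq (E : Set ℝ) (ρ : ℝ → ℝ) (S : Matrix ℕ ℕ FSeries) (n : ℕ) : PowerSeries FSeries :=
  PowerSeries.mk fun j => fint E ρ fun u =>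
    MvPowerSeries.C (u ^ j) * (pPoly S n).eval (MvPowerSeries.C u) * fexp u

/-- Formal power series in two independent sets of times, `(t, t')` or `(t, y)`. -/
abbrev FSeries2 := MvPowerSeries (ℕ+ ⊕ ℕ+) ℝ

/-- A series in `t`, regarded as a series in `(t, t')`. -/
def inFst (f : FSeries) : FSeries2 := f.subst fun i : ℕ+ => (MvPowerSeries.X (Sum.inl i) : FSeries2)

/-- A series in `t`, with `t` renamed `t'`. -/
def inSnd (f : FSeries) : FSeries2 := f.subst fun i : ℕ+ => (MvPowerSeries.X (Sum.inr i) : FSeries2)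

/-- `s_j(t - t')`. -/
def schurDiff (j : ℕ) : FSeries2 :=
  MvPolynomial.aeval
    (fun i : ℕ+ => (MvPowerSeries.X (Sum.inl i) - MvPowerSeries.X (Sum.inr i) : FSeries2))
    (schur ℝ j)

/-- The coefficient of `z^{-k}` in `τ(t - [z⁻¹]) τ'(t' + [z⁻¹])`. -/
def shiftedProductCoeff (τ τ' : FSeries) (k : ℕ) : FSeries2 :=
  ∑ a ∈ Finset.range (k + 1),
    inFst (PowerSeries.coeff a (fshift (-1) τ)) * inSnd (PowerSeries.coeff (k - a) (fshift 1 τ'))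

/-- The coefficient of `z⁻¹` (the residue) in
`τ(t - [z⁻¹]) τ'(t' + [z⁻¹]) exp (∑ (t_i - t'_i) z^i) z^d` is the sum over `j ≥ 0` of `s_j(t - t')`
times the coefficient of `z^{-(j + d + 1)}` in `τ(t - [z⁻¹]) τ'(t' + [z⁻¹])`.
This is the `j`-th term of that sum. -/
def residueTerm (τ τ' : FSeries) (d j : ℕ) : FSeries2 :=
  schurDiff j * shiftedProductCoeff τ τ' (j + d + 1)

/-- `f(t + y) g(t - y)`. -/
def fhirotaProd (f g : FSeries) : FSeries2 :=
  f.subst (fun i : ℕ+ => (MvPowerSeries.X (Sum.inl i) + MvPowerSeries.X (Sum.inr i) : FSeries2)) *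
  g.subst (fun i : ℕ+ => (MvPowerSeries.X (Sum.inl i) - MvPowerSeries.X (Sum.inr i) : FSeries2))

/-- The value at `y = 0` of a series in `(t, y)`. -/
def evalY0 (F : FSeries2) : FSeries := fun α => MvPowerSeries.coeff (α.mapDomain Sum.inl) F

/-- The Hirota symbol `p(∂_t) f ∘ g = p(∂_y) f(t + y) g(t - y)|_{y = 0}`. -/
def fhirota (p : MvPolynomial ℕ+ ℝ) (f g : FSeries) : FSeries :=
  evalY0 (polyOp (fun k F => MvPowerSeries.pderiv ℝ (Sum.inr k) F) p (fhirotaProd f g))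

end Formal

/-! ### The times `t` as complex numbers -/

section Analytic

/-- Sequences of complex times. -/
abbrev Times := ℕ+ → ℂ

/-- `∑ t_i u^i` converges absolutely for `|u| ≤ R`. -/
def ConvergesOn (R : ℝ) (t : Times) : Prop := Summable fun i : ℕ+ => ‖t i‖ * R ^ (i : ℕ)

/-- `∑_{i ≥ 1} t_i z^i`. -/
def timeSum (t : Times) (z : ℂ) : ℂ := ∑' i : ℕ+, t i * z ^ (i : ℕ)

/-- `ρ_t(u) = ρ(u) exp (∑ t_i u^i)`. -/
def weightT (ρ : ℝ → ℝ) (t : Times) (u : ℝ) : ℂ := (ρ u : ℂ) * Complex.exp (timeSum t (u : ℂ))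

/-- The moment matrix `m_∞(t)`. -/
def amom (E : Set ℝ) (ρ : ℝ → ℝ) (t : Times) : Matrix ℕ ℕ ℂ :=
  fun i j => ∫ u in E, (u : ℂ) ^ i * (u : ℂ) ^ j * weightT ρ t u

/-- `τ_n(t) = det m_n(t)`. -/
def atau (E : Set ℝ) (ρ : ℝ → ℝ) (n : ℕ) (t : Times) : ℂ := minorDet (amom E ρ t) n

/-- `[w] = (w, w²/2, w³/3, …)`. -/
def bracketPt (w : ℂ) : Times := fun i => w ^ (i : ℕ) / ((i : ℕ) : ℂ)

/-- `t + s e_k`. -/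
def addAt (t : Times) (k : ℕ+) (s : ℂ) : Times := t + Pi.single k s

/-- `∂f/∂t_k`. -/
def apd (k : ℕ+) (f : Times → ℂ) : Times → ℂ := fun t => deriv (fun s : ℂ => f (addAt t k s)) 0

/-- The Hirota symbol `p(∂_t) f ∘ g = p(∂_y) f(t + y) g(t - y)|_{y = 0}`. -/
def ahirota (p : MvPolynomial ℕ+ ℂ) (f g : Times → ℂ) : Times → ℂ :=
  fun t => polyOp apd p (fun y => f (t + y) * g (t - y)) 0

/-- The Stieltjes transform `q_n(t; z) = z ∫ p_n(t; u) / (z - u) ρ_t(u) du`. -/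
def aq (E : Set ℝ) (ρ : ℝ → ℝ) (t : Times) (S : Matrix ℕ ℕ ℂ) (n : ℕ) (z : ℂ) : ℂ :=
  z * ∫ u in E, (pPoly S n).eval (u : ℂ) / (z - (u : ℂ)) * weightT ρ t u

/-- `log (f / f(t₀))` with the principal logarithm: near a point `t₀` where `f` is continuous and
non-zero, this is a branch of `log f`, up to an additive constant. -/
def logNear (f : Times → ℂ) (t₀ : Times) : Times → ℂ := fun t => Complex.log (f t / f t₀)

end Analytic

end

end TodaKP

/-! Everything rests on two facts about the moments μ_j: the times act by ∂μ_j/∂t_k = μ_{j+k}, and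
m_∞ is a Hankel matrix. Since exp(Σ w^i u^i / i) = 1/(1 - wu), passing to t - [w] replaces μ_j by
μ_j - w μ_{j+1}, and passing to t + [w] gives a sequence ν with ν_j - w ν_{j+1} = μ_j. Column
operations on Hankel determinants then show that z^n τ_n(t - [z⁻¹]) is the determinantal orthogonal
polynomial P_n = `hankelPoly` (`hankel_sub_shift`), and that z^{-n} τ_{n+1}(t + [z⁻¹]) is its
Stieltjes transform (`pow_mul_hankel_of_sub_shift_eq`). For a factorization with T = S⁻¹, the
identity S m_∞ = Tᵀ says that the rows of S are orthonormal polynomials, hence multiples of the P_n.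
L is multiplication by z in this basis, so it is symmetric; having one upper diagonal, it is
tridiagonal.

Toda equations (`deriv_lax_eq_todaSkew`): put Y = S ∂_k T. From m = T Tᵀ and ∂_k m = Λ^k m one gets
Y + Yᵀ = L^k with Y lower triangular, so Y is half the Borel part of L^k, and ∂_k L = -[Y, L].
Formally, the flows commute because partial derivatives do. Along an arbitrary set U of times,
commutation follows instead from an identity in L alone, zero curvature plus the Jacobi identity
(`todaSkewDeriv_comm`).

Bilinear identity (`formal_bilinear`, `IsWeight.circleIntegral_bilinear`): the residue equals ∫
P_n(t;u) P_m(t';u) ρ_t(u) du, which vanishes by orthogonality because m < n.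

KP hierarchy (`hirotaEval_polyOp_kpPoly`): the coefficient of w^{k+1} in τ_n(t+[w]) τ_n(t-[w]) is ∫
u^k P_n P_{n-1} ρ_t. Differentiating the orthogonality of P_n evaluates this as τ ∂_1∂_k τ - ∂_1τ
∂_kτ, half a Hirota derivative. Taylor expansion evaluates the same coefficient as the Hirota
derivative with symbol s_{k+1}(∂_1, ∂_2/2, …). Equating the two, with k+3 for k, gives the
hierarchy; its first member, divided by τ², is the KP equation.

The determinantal algebra is done once. For the KP part the moments are indeterminates and the times
are derivations (`umD`, `hirotaD`); algebra homomorphisms carry the results to formal power series,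
and `hasDerivAt_aeval` carries them to functions of complex times. -/

namespace TodaKP

noncomputable section

/-! ### Hankel determinants and their orthogonal polynomials -/

section Hankel

open Matrix Polynomial

variable {A : Type*} [CommRing A]

/-- The Hankel matrix `(μ_{i+j})_{0 ≤ i, j < n}`. -/
def hankelMat (μ : ℕ → A) (n : ℕ) : Matrix (Fin n) (Fin n) A := Matrix.of fun i j => μ (i + j)

/-- The Hankel determinant of size `n`. -/
def hankel (μ : ℕ → A) (n : ℕ) : A := (hankelMat μ n).det

/-- The `A`-linear map `A[X] → B` with `X ^ k ↦ ν k`. -/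
def momFun {B : Type*} [AddCommGroup B] [Module A B] (ν : ℕ → B) : A[X] →ₗ[A] B :=
  Polynomial.lsum fun k => LinearMap.toSpanSingleton A B (ν k)

/-- The polynomial of degree at most `n` obtained by replacing the last row of the Hankel matrix
of size `n + 1` by `1, X, …, X ^ n`. -/
def hankelPoly (μ : ℕ → A) (n : ℕ) : A[X] :=
  ∑ j : Fin (n + 1), C ((hankelMat μ (n + 1)).adjugate j (Fin.last n)) * X ^ (j : ℕ)

section momFun

variable {B : Type*} [AddCommGroup B] [Module A B]

theorem momFun_apply (ν : ℕ → B) (p : A[X]) : momFun ν p = p.sum fun k a => a • ν k := rfl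

@[simp] theorem momFun_C_mul_X_pow (ν : ℕ → B) (a : A) (k : ℕ) :
    momFun ν (C a * X ^ k) = a • ν k := by
  rw [momFun_apply, C_mul_X_pow_eq_monomial, Polynomial.sum_monomial_index _ _ (by simp)]

@[simp] theorem momFun_X_pow (ν : ℕ → B) (k : ℕ) : momFun ν ((X : A[X]) ^ k) = ν k := by
  simpa using momFun_C_mul_X_pow ν (1 : A) k

theorem momFun_mul_X_pow (ν : ℕ → B) (p : A[X]) (k : ℕ) :
    momFun ν (p * X ^ k) = momFun (fun j => ν (j + k)) p := by
  induction p using Polynomial.induction_on' with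
  | add p q hp hq => rw [add_mul, map_add, map_add, hp, hq]
  | monomial n a =>
    rw [← C_mul_X_pow_eq_monomial, mul_assoc, ← pow_add, momFun_C_mul_X_pow, momFun_C_mul_X_pow]

theorem momFun_eq_sum_range (ν : ℕ → B) (p : A[X]) {n : ℕ} (h : p.natDegree < n) :
    momFun ν p = ∑ k ∈ Finset.range n, p.coeff k • ν k := by
  rw [momFun_apply, Polynomial.sum_over_range' p (by simp) n h]

end momFun

/-- A product is integrated in two stages. This is how orthogonality to powers of `X` is extended to
orthogonality to polynomials. -/
theorem momFun_mul (μ : ℕ → A) (p q : A[X]) :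
    momFun μ (p * q) = momFun (fun k => momFun μ (p * X ^ k)) q := by
  induction q using Polynomial.induction_on' with
  | add q r hq hr => rw [mul_add, map_add, map_add, hq, hr]
  | monomial n a =>
    rw [← C_mul_X_pow_eq_monomial, momFun_C_mul_X_pow, mul_left_comm, C_mul', map_smul]

theorem map_hankel {B : Type*} [CommRing B] (f : A →+* B) (μ : ℕ → A) (n : ℕ) :
    f (hankel μ n) = hankel (fun k => f (μ k)) n := by
  rw [hankel, hankel, RingHom.map_det]; rfl

theorem map_hankelPoly {B : Type*} [CommRing B] (f : A →+* B) (μ : ℕ → A) (n : ℕ) :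
    (hankelPoly μ n).map f = hankelPoly (fun k => f (μ k)) n := by
  have h : hankelMat (fun k => f (μ k)) (n + 1) = f.mapMatrix (hankelMat μ (n + 1)) := rfl
  rw [hankelPoly, hankelPoly, Polynomial.map_sum, h, ← RingHom.map_adjugate]
  simp

@[simp] theorem hankel_zero (μ : ℕ → A) : hankel μ 0 = 1 := by simp [hankel]

theorem minorDet_eq_hankel {m : Matrix ℕ ℕ A} {μ : ℕ → A} (h : ∀ i j, m i j = μ (i + j)) (n : ℕ) :
    minorDet m n = hankel μ n := by
  unfold minorDet hankel
  congr 1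
  ext i j
  simp [hankelMat, h]

/-- Expansion along the last row. It turns values of a functional on `hankelPoly` into determinants,
to which row and column operations apply. -/
theorem det_updateRow_hankelMat (μ : ℕ → A) (n : ℕ) (b : Fin (n + 1) → A) :
    ((hankelMat μ (n + 1)).updateRow (Fin.last n) b).det =
      ∑ j, (hankelMat μ (n + 1)).adjugate j (Fin.last n) * b j := by
  rw [← cramer_transpose_apply, cramer_eq_adjugate_mulVec, ← adjugate_transpose]
  rfl

theorem momFun_hankelPoly {B : Type*} [AddCommGroup B] [Module A B] (μ : ℕ → A) (n : ℕ)
    (ν : ℕ → B) : momFun ν (hankelPoly μ n) =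
      ∑ j : Fin (n + 1), (hankelMat μ (n + 1)).adjugate j (Fin.last n) • ν j := by
  simp [hankelPoly, map_sum]

/-- Pairing with `X ^ k` fills the last row with μ_k, μ_{k+1}, …, which repeats row k. -/
theorem hankelPoly_orthogonal (μ : ℕ → A) {n k : ℕ} (h : k < n) :
    momFun μ (hankelPoly μ n * X ^ k) = 0 := by
  rw [momFun_mul_X_pow, momFun_hankelPoly]
  simp only [smul_eq_mul]
  rw [← det_updateRow_hankelMat μ n fun j => μ (j + k)]
  have hk : k < n + 1 := by lia
  refine det_zero_of_row_eq (i := Fin.last n) (j := ⟨k, hk⟩) (by simp [Fin.ext_iff]; lia) ?_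
  ext j
  rw [updateRow_self, updateRow_ne (by simp [Fin.ext_iff]; lia)]
  simp [hankelMat, add_comm]

theorem momFun_hankelPoly_mul_X_pow_self (μ : ℕ → A) (n : ℕ) :
    momFun μ (hankelPoly μ n * X ^ n) = hankel μ (n + 1) := by
  rw [momFun_mul_X_pow, momFun_hankelPoly]
  simp only [smul_eq_mul]
  rw [← det_updateRow_hankelMat μ n fun j => μ (j + n), hankel]
  congr 1
  ext i j
  refine Fin.lastCases ?_ (fun i => ?_) i
  · rw [updateRow_self]; simp [hankelMat, add_comm]
  · rw [updateRow_ne (Fin.castSucc_lt_last i).ne]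

theorem coeff_hankelPoly (μ : ℕ → A) (n : ℕ) (j : Fin (n + 1)) :
    (hankelPoly μ n).coeff j = (hankelMat μ (n + 1)).adjugate j (Fin.last n) := by
  rw [hankelPoly, finsetSum_coeff]
  simp only [coeff_C_mul_X_pow, Fin.val_inj]
  simp

theorem natDegree_hankelPoly_le (μ : ℕ → A) (n : ℕ) : (hankelPoly μ n).natDegree ≤ n := by
  refine natDegree_sum_le_of_forall_le _ _ fun j _ => ?_
  exact (natDegree_C_mul_X_pow_le _ _).trans (by lia)

theorem coeff_hankelPoly_self (μ : ℕ → A) (n : ℕ) : (hankelPoly μ n).coeff n = hankel μ n := by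
  have := coeff_hankelPoly μ n (Fin.last n)
  rw [Fin.val_last] at this
  rw [this, adjugate_fin_succ_eq_det_submatrix, hankel]
  simp only [Fin.val_last, Even.neg_one_pow ⟨n, rfl⟩, one_mul]
  congr 1
  ext i j
  simp [hankelMat]

/-- The unipotent matrix which subtracts `w` times the next column from each column. -/
def shiftDiffMat (w : A) (n : ℕ) : Matrix (Fin (n + 1)) (Fin (n + 1)) A :=
  Matrix.of fun i j => if i = j then 1 else if (i : ℕ) = j + 1 then -w else 0

theorem det_shiftDiffMat (w : A) (n : ℕ) : (shiftDiffMat w n).det = 1 := by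
  rw [det_of_isLowerTriangular]
  · simp [shiftDiffMat]
  · intro i j hij
    have hij' : i < j := hij
    rw [shiftDiffMat, of_apply, if_neg hij'.ne, if_neg (by have := Fin.lt_def.mp hij'; lia)]

theorem mul_shiftDiffMat_castSucc (M : Matrix (Fin (n + 1)) (Fin (n + 1)) A) (w : A) (i) (j : Fin n) :
    (M * shiftDiffMat w n) i j.castSucc = M i j.castSucc - w * M i j.succ := by
  rw [mul_apply, ← Finset.add_sum_erase _ _ (Finset.mem_univ j.castSucc),
    ← Finset.add_sum_erase _ _ (a := j.succ) (by simp [Fin.ext_iff]), Finset.sum_eq_zero]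
  · simp [shiftDiffMat, Fin.ext_iff]; ring
  · intro k hk
    simp only [Finset.mem_erase, Finset.mem_univ, and_true, ne_eq, Fin.ext_iff, Fin.val_succ,
      Fin.val_castSucc] at hk
    simp [shiftDiffMat, Fin.ext_iff, hk.1, hk.2]

theorem mul_shiftDiffMat_last (M : Matrix (Fin (n + 1)) (Fin (n + 1)) A) (w : A) (i) :
    (M * shiftDiffMat w n) i (Fin.last n) = M i (Fin.last n) := by
  rw [mul_apply, Finset.sum_eq_single (Fin.last n)]
  · simp [shiftDiffMat]
  · intro k _ hk
    have := k.2
    simp [shiftDiffMat, hk, this.ne]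
  · simp

/-- The Hankel determinant of `μ_j - w μ_{j+1}`. -/
theorem hankel_sub_shift (μ : ℕ → A) (w : A) (n : ℕ) :
    hankel (fun j => μ j - w * μ (j + 1)) n =
      ∑ j : Fin (n + 1), (hankelPoly μ n).coeff j * w ^ (n - j) := by
  simp only [coeff_hankelPoly]
  -- The last row w^n, …, w, 1 is chosen so that subtracting w times the next column kills all its
  -- entries but the final 1. The remaining minor has entries μ_{i+j} - w μ_{i+j+1}.
  rw [← det_updateRow_hankelMat μ n fun j => w ^ (n - j),
    ← mul_one (det _), ← det_shiftDiffMat w n, ← det_mul, det_succ_row _ (Fin.last n),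
    Fin.sum_univ_castSucc, Finset.sum_eq_zero, zero_add, mul_shiftDiffMat_last, updateRow_self]
  · simp only [Fin.val_last, Even.neg_one_pow ⟨n, rfl⟩, Nat.sub_self, pow_zero, one_mul]
    rw [hankel]
    congr 1
    ext i j
    rw [submatrix_apply, Fin.succAbove_last, mul_shiftDiffMat_castSucc,
      updateRow_ne (Fin.castSucc_lt_last i).ne]
    simp [hankelMat, add_assoc]
  · intro j _
    rw [mul_shiftDiffMat_castSucc, updateRow_self]
    have : n - (j : ℕ) = n - ((j : ℕ) + 1) + 1 := by have := j.2; lia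
    simp [this, pow_succ']

/-- The Hankel determinant of a sequence `ν` with `ν_j - w ν_{j+1} = μ_j`. -/
theorem hankel_of_sub_shift_eq (μ ν : ℕ → A) (w : A) (h : ∀ j, ν j - w * ν (j + 1) = μ j) (n : ℕ) :
    hankel ν (n + 1) = momFun ν (hankelPoly μ n * X ^ n) := by
  rw [momFun_mul_X_pow, momFun_hankelPoly]
  simp only [smul_eq_mul]
  -- After transposing, the special row is the last column. The column operation applied to the
  -- Hankel matrix of ν leaves that last column of ν's and turns all other columns into columns of
  -- μ's.
  rw [← det_updateRow_hankelMat μ n fun j => ν (j + n), ← det_transpose, hankel,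
    ← mul_one (det _), ← det_shiftDiffMat w n, ← det_mul]
  congr 1
  ext i j
  refine Fin.lastCases ?_ (fun j => ?_) j
  · rw [mul_shiftDiffMat_last, transpose_apply, updateRow_self]
    simp [hankelMat]
  · rw [mul_shiftDiffMat_castSucc, transpose_apply, updateRow_ne (Fin.castSucc_lt_last j).ne]
    simp [hankelMat, ← h, add_comm, add_left_comm, add_assoc]

/-- Iteration of ν_j = μ_j + w ν_{j+1}, the geometric expansion of 1/(1 - wu) with remainder. -/
theorem pow_mul_eq_sub_sum (μ ν : ℕ → A) (w : A) (h : ∀ j, ν j - w * ν (j + 1) = μ j) (n k : ℕ) :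
    w ^ n * ν (k + n) = ν k - ∑ l ∈ Finset.range n, w ^ l * μ (k + l) := by
  induction n with
  | zero => simp
  | succ n ih => rw [Finset.sum_range_succ, ← sub_sub, ← ih, ← h (k + n)]; ring_nf

theorem pow_mul_momFun_mul_X_pow (μ ν : ℕ → A) (w : A) (h : ∀ j, ν j - w * ν (j + 1) = μ j)
    (n : ℕ) (p : A[X]) : w ^ n * momFun ν (p * X ^ n) =
      momFun ν p - ∑ l ∈ Finset.range n, w ^ l * momFun μ (p * X ^ l) := by
  induction p using Polynomial.induction_on' with
  | add p q hp hq =>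
    simp only [add_mul, map_add, mul_add, hp, hq, Finset.sum_add_distrib]
    ring
  | monomial k a =>
    simp only [← C_mul_X_pow_eq_monomial, mul_assoc, ← pow_add, momFun_C_mul_X_pow, smul_eq_mul]
    simp only [mul_left_comm _ a, pow_mul_eq_sub_sum μ ν w h, ← Finset.mul_sum, mul_sub]

/-- The first n terms of the geometric expansion pair `hankelPoly` with 1, …, X^{n-1} and vanish by
orthogonality; only the remainder, of order w^n, is left. -/
theorem pow_mul_hankel_of_sub_shift_eq (μ ν : ℕ → A) (w : A)
    (h : ∀ j, ν j - w * ν (j + 1) = μ j) (n : ℕ) :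
    w ^ n * hankel ν (n + 1) = momFun ν (hankelPoly μ n) := by
  rw [hankel_of_sub_shift_eq μ ν w h, pow_mul_momFun_mul_X_pow μ ν w h, Finset.sum_eq_zero,
    sub_zero]
  intro l hl
  rw [hankelPoly_orthogonal μ (Finset.mem_range.mp hl), mul_zero]

/-- Orthogonality and the leading coefficient determine the orthogonal polynomials. -/
theorem hankel_mul_eq_of_orthogonal [NoZeroDivisors A] (μ : ℕ → A) {n : ℕ} (h0 : hankel μ n ≠ 0)
    {p : A[X]} (hp : p.natDegree ≤ n) (ho : ∀ k < n, momFun μ (p * X ^ k) = 0) :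
    C (hankel μ n) * p = C (p.coeff n) * hankelPoly μ n := by
  set d := C (hankel μ n) * p - C (p.coeff n) * hankelPoly μ n with hd
  have hdn : d.coeff n = 0 := by
    rw [hd, coeff_sub, coeff_C_mul, coeff_C_mul, coeff_hankelPoly_self]; ring
  have hdeg : d.natDegree ≤ n := by
    refine (natDegree_sub_le _ _).trans (max_le ?_ ?_)
    · exact (natDegree_C_mul_le _ _).trans hp
    · exact (natDegree_C_mul_le _ _).trans (natDegree_hankelPoly_le μ n)
  have hdo : ∀ k < n, momFun μ (d * X ^ k) = 0 := fun k hk => by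
    rw [hd, sub_mul, map_sub, mul_assoc, mul_assoc, C_mul', C_mul', map_smul, map_smul, ho k hk,
      hankelPoly_orthogonal μ hk]
    simp
  -- The degree-n coefficient of d cancels, so orthogonality says that its lower coefficients form a
  -- null vector of a Hankel matrix with non-zero determinant.
  have hv := eq_zero_of_vecMul_eq_zero (M := hankelMat μ n) h0 (v := fun i => d.coeff i) (by
    ext j
    have := hdo j j.2
    rw [momFun_mul_X_pow, momFun_eq_sum_range _ _ (Nat.lt_succ_of_le hdeg),
      Finset.sum_range_succ, hdn, zero_smul, add_zero, Finset.sum_range] at this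
    simpa [vecMul, dotProduct, hankelMat] using this)
  have : d = 0 := by
    ext k
    rcases lt_trichotomy k n with hk | hk | hk
    · exact congrFun hv ⟨k, hk⟩
    · rw [hk, hdn, coeff_zero]
    · rw [coeff_eq_zero_of_natDegree_lt (by lia), coeff_zero]
  exact sub_eq_zero.mp this

end Hankel

/-! ### Semi-infinite matrices with finite rows -/

section RowFinite

variable {A : Type*} [CommRing A]

/-- Each row has finitely many non-zero entries. -/
def RowFinite (M : Matrix ℕ ℕ A) : Prop := ∀ i, (Function.support (M i)).Finite

theorem rowFinite_of_forall_lt {M : Matrix ℕ ℕ A} (b : ℕ → ℕ) (h : ∀ i j, b i ≤ j → M i j = 0) :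
    RowFinite M := fun i =>
  (Finset.range (b i)).finite_toSet.subset fun j hj => by
    simpa using not_le.mp fun h' => hj (h i j h')

theorem rowFinite_of_lower {M : Matrix ℕ ℕ A} (h : ∀ i j, i < j → M i j = 0) : RowFinite M :=
  rowFinite_of_forall_lt (fun i => i + 1) fun i j hij => h i j hij

theorem rowFinite_one : RowFinite (1 : Matrix ℕ ℕ A) :=
  rowFinite_of_lower fun _ _ h => Matrix.one_apply_ne h.ne

theorem rowFinite_shiftMat : RowFinite (shiftMat : Matrix ℕ ℕ A) :=
  rowFinite_of_forall_lt (fun i => i + 2) fun i j h => by rw [shiftMat, if_neg (by lia)]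

theorem RowFinite.add {M N : Matrix ℕ ℕ A} (hM : RowFinite M) (hN : RowFinite N) :
    RowFinite (M + N) := fun i =>
  ((hM i).union (hN i)).subset (Function.support_add (M i) (N i))

theorem RowFinite.neg {M : Matrix ℕ ℕ A} (hM : RowFinite M) : RowFinite (-M) := fun i =>
  (hM i).subset (Function.support_neg (M i)).subset

theorem RowFinite.sub {M N : Matrix ℕ ℕ A} (hM : RowFinite M) (hN : RowFinite N) :
    RowFinite (M - N) := sub_eq_add_neg M N ▸ hM.add hN.neg

theorem RowFinite.smul {K : Type*} [Field K] [Algebra K A] {M : Matrix ℕ ℕ A} (c : K)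
    (hM : RowFinite M) : RowFinite (c • M) := fun i =>
  (hM i).subset (Function.support_const_smul_subset c (M i))

section iact

variable {V W : Type*} [AddCommGroup V] [Module A V] [AddCommGroup W] [Module A W]

theorem iact_eq_sum {M : Matrix ℕ ℕ A} {i : ℕ} {s : Finset ℕ} (h : ∀ k ∉ s, M i k = 0)
    (v : ℕ → V) : iact M v i = ∑ k ∈ s, M i k • v k :=
  finsum_eq_sum_of_support_subset _ fun k hk => by
    by_contra h'
    exact hk (by simp only [h k h', zero_smul])

theorem iact_eq_sum_toFinset {M : Matrix ℕ ℕ A} (h : RowFinite M) (v : ℕ → V) (i : ℕ) :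
    iact M v i = ∑ k ∈ (h i).toFinset, M i k • v k :=
  iact_eq_sum (fun k hk => by simpa using hk) v

theorem iact_map {M : Matrix ℕ ℕ A} (h : RowFinite M) (f : V →ₗ[A] W) (v : ℕ → V) (i : ℕ) :
    f (iact M v i) = iact M (fun k => f (v k)) i := by
  simp [iact_eq_sum_toFinset h, map_sum]

theorem iact_add {M : Matrix ℕ ℕ A} (h : RowFinite M) (v w : ℕ → V) :
    iact M (v + w) = iact M v + iact M w := by
  ext i
  simp [iact_eq_sum_toFinset h, smul_add, Finset.sum_add_distrib]

theorem iact_one (v : ℕ → V) : iact (1 : Matrix ℕ ℕ A) v = v := by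
  ext i
  rw [iact_eq_sum (s := {i}) fun k hk => Matrix.one_apply_ne (by simpa [eq_comm] using hk)]
  simp

theorem iact_shiftMat (v : ℕ → V) (n : ℕ) : iact (shiftMat : Matrix ℕ ℕ A) v n = v (n + 1) := by
  rw [iact_eq_sum (s := {n + 1}) fun k hk => by rw [shiftMat, if_neg (by simpa using hk)]]
  simp [shiftMat]

theorem imul_apply_eq_iact (M N : Matrix ℕ ℕ A) (i j : ℕ) :
    imul M N i j = iact M (fun k => N k j) i := rfl

theorem imul_eq_sum {M : Matrix ℕ ℕ A} {i : ℕ} {s : Finset ℕ} (h : ∀ k ∉ s, M i k = 0)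
    (N : Matrix ℕ ℕ A) (j : ℕ) : imul M N i j = ∑ k ∈ s, M i k * N k j :=
  iact_eq_sum h fun k => N k j

theorem imul_eq_sum_of_lower {M : Matrix ℕ ℕ A} (h : ∀ i j, i < j → M i j = 0) (N : Matrix ℕ ℕ A)
    {i n : ℕ} (hn : i < n) (j : ℕ) : imul M N i j = ∑ k ∈ Finset.range n, M i k * N k j :=
  imul_eq_sum (fun k hk => h i k (by simp at hk; lia)) N j

/-- Row i of M meets finitely many rows of N, so both sides are finite sums over one rectangle. The
column v is unrestricted; hence the last factor in an associativity law need not have finite rows,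
which matters for Tᵀ and m. -/
theorem iact_imul {M N : Matrix ℕ ℕ A} (hM : RowFinite M) (hN : RowFinite N) (v : ℕ → V) :
    iact (imul M N) v = iact M (iact N v) := by
  ext i
  set s := (hM i).toFinset
  set t := s.biUnion fun k => (hN k).toFinset
  have ht : ∀ k ∈ s, ∀ l ∉ t, N k l = 0 := fun k hk l hl => by
    by_contra h
    exact hl (Finset.mem_biUnion.mpr ⟨k, hk, by simpa using h⟩)
  have h1 : ∀ l, imul M N i l = ∑ k ∈ s, M i k * N k l := fun l =>
    imul_eq_sum (fun k hk => by simpa [s] using hk) N l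
  rw [iact_eq_sum (s := t), iact_eq_sum_toFinset hM]
  · simp only [h1, Finset.sum_smul]
    rw [Finset.sum_comm]
    refine Finset.sum_congr rfl fun k hk => ?_
    rw [iact_eq_sum (ht k hk), Finset.smul_sum]
    simp only [mul_smul]
  · intro l hl
    rw [h1]
    exact Finset.sum_eq_zero fun k hk => by rw [ht k hk l hl, mul_zero]

theorem RowFinite.imul {M N : Matrix ℕ ℕ A} (hM : RowFinite M) (hN : RowFinite N) :
    RowFinite (imul M N) := fun i => by
  refine ((hM i).toFinset.biUnion fun k => (hN k).toFinset).finite_toSet.subset fun l hl => ?_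
  rw [Function.mem_support, imul_eq_sum (s := (hM i).toFinset) (fun k hk => by simpa using hk)] at hl
  obtain ⟨k, hk, hkl⟩ := Finset.exists_ne_zero_of_sum_ne_zero hl
  simp only [Finset.coe_biUnion, Set.mem_iUnion]
  exact ⟨k, hk, by simpa using right_ne_zero_of_mul hkl⟩

theorem imul_assoc {M N : Matrix ℕ ℕ A} (hM : RowFinite M) (hN : RowFinite N)
    (P : Matrix ℕ ℕ A) : imul (imul M N) P = imul M (imul N P) := by
  ext i j
  exact congrFun (iact_imul hM hN fun k => P k j) i

theorem one_imul (M : Matrix ℕ ℕ A) : imul 1 M = M := by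
  ext i j
  exact congrFun (iact_one (A := A) fun k => M k j) i

theorem transpose_imul (M N : Matrix ℕ ℕ A) :
    (imul M N).transpose = imul N.transpose M.transpose := by
  ext i j
  simp only [Matrix.transpose_apply, imul]
  exact finsum_congr fun k => mul_comm _ _

theorem imul_one (M : Matrix ℕ ℕ A) : imul M 1 = M := by
  rw [← Matrix.transpose_transpose (imul M 1), transpose_imul, Matrix.transpose_one, one_imul,
    Matrix.transpose_transpose]

theorem imul_add {M : Matrix ℕ ℕ A} (hM : RowFinite M) (N P : Matrix ℕ ℕ A) :
    imul M (N + P) = imul M N + imul M P := by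
  ext i j
  exact congrFun (iact_add hM (fun k => N k j) fun k => P k j) i

theorem imul_neg (M N : Matrix ℕ ℕ A) : imul M (-N) = -imul M N := by
  ext i j
  simp [imul, finsum_neg_distrib]

theorem neg_imul (M N : Matrix ℕ ℕ A) : imul (-M) N = -imul M N := by
  ext i j
  simp [imul, finsum_neg_distrib]

theorem add_imul {M N : Matrix ℕ ℕ A} (hM : RowFinite M) (hN : RowFinite N) (P : Matrix ℕ ℕ A) :
    imul (M + N) P = imul M P + imul N P := by
  ext i j
  set s := (hM i).toFinset ∪ (hN i).toFinset with hs
  have h1 : ∀ k ∉ s, M i k = 0 := fun k hk => by simp [hs] at hk; exact hk.1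
  have h2 : ∀ k ∉ s, N i k = 0 := fun k hk => by simp [hs] at hk; exact hk.2
  rw [Matrix.add_apply, imul_eq_sum h1, imul_eq_sum h2,
    imul_eq_sum (s := s) fun k hk => by rw [Matrix.add_apply, h1 k hk, h2 k hk, add_zero]]
  simp only [Matrix.add_apply, add_mul, Finset.sum_add_distrib]

theorem sub_imul {M N : Matrix ℕ ℕ A} (hM : RowFinite M) (hN : RowFinite N) (P : Matrix ℕ ℕ A) :
    imul (M - N) P = imul M P - imul N P := by
  rw [sub_eq_add_neg, add_imul hM hN.neg, neg_imul, sub_eq_add_neg]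

theorem imul_sub {M : Matrix ℕ ℕ A} (hM : RowFinite M) (N P : Matrix ℕ ℕ A) :
    imul M (N - P) = imul M N - imul M P := by
  rw [sub_eq_add_neg, imul_add hM, imul_neg, sub_eq_add_neg]

theorem smul_imul {K : Type*} [Field K] [Algebra K A] (c : K) {M : Matrix ℕ ℕ A}
    (hM : RowFinite M) (N : Matrix ℕ ℕ A) : imul (c • M) N = c • imul M N := by
  ext i j
  have h : ∀ k ∉ (hM i).toFinset, M i k = 0 := fun k hk => by simpa using hk
  rw [Matrix.smul_apply, imul_eq_sum h,
    imul_eq_sum (M := c • M) fun k hk => by rw [Matrix.smul_apply, h k hk, smul_zero],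
    Finset.smul_sum]
  simp

theorem imul_smul {K : Type*} [Field K] [Algebra K A] (c : K) {M : Matrix ℕ ℕ A}
    (hM : RowFinite M) (N : Matrix ℕ ℕ A) : imul M (c • N) = c • imul M N := by
  ext i j
  rw [Matrix.smul_apply, imul_eq_sum (s := (hM i).toFinset) fun k hk => by simpa using hk,
    imul_eq_sum (s := (hM i).toFinset) fun k hk => by simpa using hk, Finset.smul_sum]
  simp

theorem imul_lower {M N : Matrix ℕ ℕ A} (hM : ∀ i j, i < j → M i j = 0)
    (hN : ∀ i j, i < j → N i j = 0) (i j : ℕ) (h : i < j) : imul M N i j = 0 := by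
  rw [imul_eq_sum_of_lower hM N (Nat.lt_succ_self i)]
  refine Finset.sum_eq_zero fun k hk => ?_
  rw [hN k j (by simp at hk; lia), mul_zero]

theorem rowFinite_ipow {M : Matrix ℕ ℕ A} (hM : RowFinite M) (k : ℕ) : RowFinite (ipow M k) := by
  induction k with
  | zero => exact rowFinite_one
  | succ k ih => exact ih.imul hM

theorem imul_ipow_comm {M : Matrix ℕ ℕ A} (hM : RowFinite M) (k : ℕ) :
    imul (ipow M k) M = imul M (ipow M k) := by
  induction k with
  | zero => rw [ipow, one_imul, imul_one]
  | succ k ih => rw [ipow, ih, imul_assoc hM (rowFinite_ipow hM k), ih]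

theorem ipow_comm {M : Matrix ℕ ℕ A} (hM : RowFinite M) (k l : ℕ) :
    imul (ipow M k) (ipow M l) = imul (ipow M l) (ipow M k) := by
  induction l with
  | zero => rw [ipow, one_imul, imul_one]
  | succ l ih =>
    rw [ipow, ← imul_assoc (rowFinite_ipow hM k) (rowFinite_ipow hM l), ih,
      imul_assoc (rowFinite_ipow hM l) (rowFinite_ipow hM k), imul_ipow_comm hM k,
      imul_assoc (rowFinite_ipow hM l) hM]

end iact

end RowFinite

/-! ### Consequences of a factorization of a Hankel matrix -/

section Factorization

open Polynomial

variable {A : Type*} [CommRing A]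

theorem iact_lower_eq_sum {S : Matrix ℕ ℕ A} (h : ∀ i j, i < j → S i j = 0) {V : Type*}
    [AddCommGroup V] [Module A V] (v : ℕ → V) (n : ℕ) :
    iact S v n = ∑ k ∈ Finset.range (n + 1), S n k • v k :=
  iact_eq_sum (fun k hk => h n k (by simp at hk; lia)) v

theorem coeff_pPoly {S : Matrix ℕ ℕ A} (h : ∀ i j, i < j → S i j = 0) (n k : ℕ) :
    (pPoly S n).coeff k = S n k := by
  rw [pPoly, iact_lower_eq_sum h, finsetSum_coeff]
  simp only [coeff_smul, coeff_X_pow, smul_eq_mul, mul_ite, mul_one, mul_zero]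
  rw [Finset.sum_ite_eq]
  split_ifs with hk
  · rfl
  · exact (h n k (by simp at hk; lia)).symm

theorem momFun_pPoly {S : Matrix ℕ ℕ A} (h : ∀ i j, i < j → S i j = 0) {B : Type*}
    [AddCommGroup B] [Module A B] (ν : ℕ → B) (n : ℕ) : momFun ν (pPoly S n) = iact S ν n := by
  rw [pPoly, iact_map (rowFinite_of_lower h)]
  simp only [momFun_X_pow]

theorem rowFinite_lax {S T : Matrix ℕ ℕ A} (hS : ∀ i j, i < j → S i j = 0)
    (hT : ∀ i j, i < j → T i j = 0) : RowFinite (lax S T) :=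
  ((rowFinite_of_lower hS).imul rowFinite_shiftMat).imul (rowFinite_of_lower hT)

namespace IsLowerFactorization

variable {m S T : Matrix ℕ ℕ A} (hf : IsLowerFactorization m S T)
include hf

theorem rowFinite_S : RowFinite S := rowFinite_of_lower hf.lower

theorem rowFinite_T : RowFinite T := rowFinite_of_lower hf.lower_inv

theorem rowFinite_L : RowFinite (lax S T) := rowFinite_lax hf.lower hf.lower_inv

theorem S_mul_T (n : ℕ) : S n n * T n n = 1 := by
  have := congrFun (congrFun hf.mul_inv n) n
  rw [imul_eq_sum_of_lower hf.lower T (Nat.lt_succ_self n), Finset.sum_range_succ,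
    Finset.sum_eq_zero, zero_add, Matrix.one_apply_eq] at this
  · exact this
  · intro k hk
    rw [hf.lower_inv k n (by simpa using hk), mul_zero]

theorem imul_S_m : imul S m = T.transpose := by
  rw [hf.factor, ← imul_assoc hf.rowFinite_S hf.rowFinite_T, hf.mul_inv, one_imul]

/-- `L p = z p`. -/
theorem iact_lax_pPoly (n : ℕ) : iact (lax S T) (pPoly S) n = X * pPoly S n := by
  rw [lax, iact_imul (hf.rowFinite_S.imul rowFinite_shiftMat) hf.rowFinite_T, pPoly,
    ← iact_imul hf.rowFinite_T hf.rowFinite_S, hf.inv_mul, iact_one,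
    iact_imul hf.rowFinite_S rowFinite_shiftMat]
  have := iact_map hf.rowFinite_S (LinearMap.mulLeft A (X : A[X])) (fun k => X ^ k) n
  simp only [LinearMap.mulLeft_apply] at this
  rw [this]
  congr 1
  ext1 k
  rw [iact_shiftMat, pow_succ']

/-- Any linear functional may be applied to L p = X p. Evaluation at z, the Stieltjes transform and
pairing with p_j are the cases used. -/
theorem iact_lax_momFun {B : Type*} [AddCommGroup B] [Module A B] (f : A[X] →ₗ[A] B) (n : ℕ) :
    iact (lax S T) (fun k => f (pPoly S k)) n = f (X * pPoly S n) := by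
  rw [← iact_lax_pPoly hf, iact_map hf.rowFinite_L]

theorem natDegree_pPoly_le (n : ℕ) : (pPoly S n).natDegree ≤ n :=
  natDegree_le_iff_coeff_eq_zero.mpr fun k hk => by rw [coeff_pPoly hf.lower, hf.lower n k hk]

theorem natDegree_pPoly (n : ℕ) : (pPoly S n).natDegree = n :=
  natDegree_eq_of_le_of_coeff_ne_zero (hf.natDegree_pPoly_le n)
    (by rw [coeff_pPoly hf.lower]; exact hf.diag n)

variable {μ : ℕ → A} (hm : ∀ i j, m i j = μ (i + j))
include hm

/-- An entry of S m = Tᵀ. Triangularity of T makes this the orthogonality of p_n to lower powers. -/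
theorem momFun_pPoly_mul_X_pow (n j : ℕ) : momFun μ (pPoly S n * X ^ j) = T j n := by
  rw [momFun_mul_X_pow, momFun_pPoly hf.lower]
  have := congrFun (congrFun hf.imul_S_m n) j
  simp only [imul_apply_eq_iact, hm, Matrix.transpose_apply] at this
  exact this

theorem momFun_pPoly_mul_pPoly (i j : ℕ) :
    momFun μ (pPoly S i * pPoly S j) = if i = j then 1 else 0 := by
  rw [momFun_mul, momFun_pPoly hf.lower]
  simp only [hf.momFun_pPoly_mul_X_pow hm]
  rw [← imul_apply_eq_iact, hf.mul_inv, Matrix.one_apply]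
  simp only [eq_comm]

/-- Pairing L p = X p with p_j picks out one entry by orthonormality. The right-hand side is
symmetric in i and j, whence the symmetry of L. -/
theorem lax_eq_momFun (i j : ℕ) : lax S T i j = momFun μ (X * pPoly S i * pPoly S j) := by
  have := hf.iact_lax_momFun ((momFun μ).comp (LinearMap.mulRight A (pPoly S j))) i
  simp only [LinearMap.comp_apply, LinearMap.mulRight_apply, hf.momFun_pPoly_mul_pPoly hm] at this
  rw [← this, ← imul_one (lax S T), imul_apply_eq_iact, imul_one]
  rfl

theorem lax_symm (i j : ℕ) : lax S T i j = lax S T j i := by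
  rw [hf.lax_eq_momFun hm, hf.lax_eq_momFun hm]; ring_nf

omit hm in
theorem lax_eq_zero_of_lt (i j : ℕ) (h : i + 1 < j) : lax S T i j = 0 := by
  have hS : ∀ k ∉ Finset.range (i + 2), imul S shiftMat i k = 0 := fun k hk => by
    rw [imul_eq_sum_of_lower hf.lower _ (Nat.lt_succ_self i)]
    refine Finset.sum_eq_zero fun l hl => ?_
    rw [shiftMat, if_neg (by simp at hk hl; lia), mul_zero]
  rw [lax, imul_eq_sum hS]
  refine Finset.sum_eq_zero fun l hl => ?_
  rw [hf.lower_inv l j (by simp at hl; lia), mul_zero]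

theorem lax_eq_zero (i j : ℕ) (h : i + 1 < j) : lax S T i j = 0 ∧ lax S T j i = 0 :=
  ⟨hf.lax_eq_zero_of_lt i j h, hf.lax_symm hm i j ▸ hf.lax_eq_zero_of_lt i j h⟩

omit hm in
-- Leading coefficients in L p = X p, compared in degree n + 1.
theorem lax_succ_mul (n : ℕ) : lax S T n (n + 1) * S (n + 1) (n + 1) = S n n := by
  have := congrArg (fun p => coeff p (n + 1)) (hf.iact_lax_pPoly n)
  rw [coeff_X_mul, coeff_pPoly hf.lower, iact_eq_sum (s := Finset.range (n + 2))
    (fun k hk => hf.lax_eq_zero_of_lt n k (by simp at hk; lia)), Finset.sum_range_succ,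
    coeff_add, finsetSum_coeff, Finset.sum_eq_zero, zero_add, coeff_smul, coeff_pPoly hf.lower]
    at this
  · exact this
  · intro k hk
    rw [coeff_smul, coeff_pPoly hf.lower, hf.lower _ _ (by simpa using hk), smul_zero]

omit hm in
theorem lax_diag_mul (n : ℕ) : lax S T n n * S n n + lax S T n (n + 1) * S (n + 1) n =
    (X * pPoly S n).coeff n := by
  rw [← hf.iact_lax_pPoly n, iact_eq_sum (s := Finset.range (n + 2))
    (fun k hk => hf.lax_eq_zero_of_lt n k (by simp at hk; lia)), Finset.sum_range_succ,
    Finset.sum_range_succ, coeff_add, coeff_add, finsetSum_coeff, Finset.sum_eq_zero, zero_add,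
    coeff_smul, coeff_smul, coeff_pPoly hf.lower, coeff_pPoly hf.lower, smul_eq_mul, smul_eq_mul]
  intro k hk
  rw [coeff_smul, coeff_pPoly hf.lower, hf.lower _ _ (by simpa using hk), smul_zero]

/-- T being lower triangular, the n × n corner of T Tᵀ is the product of the corners, so the
determinant is read off the diagonal. -/
theorem hankel_eq_prod (n : ℕ) : hankel μ n = ∏ i ∈ Finset.range n, T i i ^ 2 := by
  set t : Matrix (Fin n) (Fin n) A := Matrix.of fun i j => T i j with ht
  have h : hankelMat μ n = t * t.transpose := by
    ext i j
    rw [Matrix.mul_apply, hankelMat, Matrix.of_apply, ← hm, hf.factor,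
      imul_eq_sum_of_lower hf.lower_inv _ i.2, Finset.sum_range]
    rfl
  rw [hankel, h, Matrix.det_mul, Matrix.det_transpose, Matrix.det_of_isLowerTriangular, ← sq,
    ← Finset.prod_pow, Finset.prod_range]
  · rfl
  · intro i j hij
    exact hf.lower_inv i j hij

theorem hankel_succ (n : ℕ) : hankel μ (n + 1) = hankel μ n * T n n ^ 2 := by
  rw [hf.hankel_eq_prod hm, hf.hankel_eq_prod hm, Finset.prod_range_succ]

theorem S_sq_mul (n : ℕ) : S n n ^ 2 * hankel μ (n + 1) = hankel μ n := by
  have := hf.S_mul_T n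
  rw [hf.hankel_succ hm]
  linear_combination (hankel μ n * (S n n * T n n + 1)) * this

theorem lax_succ_sq_mul (n : ℕ) :
    lax S T n (n + 1) ^ 2 * hankel μ (n + 1) ^ 2 = hankel μ n * hankel μ (n + 2) := by
  have h1 := hf.S_sq_mul hm n
  have h2 := hf.S_sq_mul hm (n + 1)
  have h3 := hf.lax_succ_mul n
  linear_combination (hankel μ (n + 2)) * h1 - lax S T n (n + 1) ^ 2 * hankel μ (n + 1) * h2 +
    hankel μ (n + 1) * hankel μ (n + 2) * (lax S T n (n + 1) * S (n + 1) (n + 1) + S n n) * h3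

theorem isUnit_hankel (n : ℕ) : IsUnit (hankel μ n) := by
  rw [hf.hankel_eq_prod hm]
  refine IsUnit.of_mul_eq_one (∏ i ∈ Finset.range n, S i i ^ 2) ?_
  rw [← Finset.prod_mul_distrib]
  refine Finset.prod_eq_one fun i _ => ?_
  rw [← mul_pow, mul_comm, hf.S_mul_T, one_pow]

/-- Both polynomials have degree at most n and are orthogonal to 1, …, X^{n-1}; they are
proportional by uniqueness. -/
theorem hankel_mul_pPoly [IsDomain A] (n : ℕ) :
    C (hankel μ n) * pPoly S n = C (S n n) * hankelPoly μ n := by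
  have := hankel_mul_eq_of_orthogonal μ (hf.isUnit_hankel hm n).ne_zero (hf.natDegree_pPoly_le n)
    fun k hk => by rw [hf.momFun_pPoly_mul_X_pow hm, hf.lower_inv k n hk]
  rwa [coeff_pPoly hf.lower] at this

/-- The diagonal of `L`. -/
theorem lax_diag_mul_hankel [IsDomain A] (n : ℕ) :
    lax S T n n * (hankel μ n * hankel μ (n + 1)) =
      (X * hankelPoly μ n).coeff n * hankel μ (n + 1) -
        (hankelPoly μ (n + 1)).coeff n * hankel μ n := by
  have h1 := congrArg (fun p => coeff (X * p) n) (hf.hankel_mul_pPoly hm n)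
  have h2 := congrArg (fun p => coeff p n) (hf.hankel_mul_pPoly hm (n + 1))
  simp only [mul_left_comm X, coeff_C_mul, coeff_pPoly hf.lower] at h1 h2
  have h3 := hf.lax_diag_mul n
  have h4 := hf.lax_succ_mul n
  refine mul_left_cancel₀ (hf.diag n) ?_
  refine mul_left_cancel₀ (hf.diag (n + 1)) ?_
  linear_combination S (n+1) (n+1) * hankel μ n * hankel μ (n+1) * h3 +
    S (n+1) (n+1) * hankel μ (n+1) * h1 - S n n * hankel μ n * h2 - hankel μ n * hankel μ (n+1) *
     S (n+1) n * h4

end IsLowerFactorization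

/-! ### Second solutions of the three-term recursion: Stieltjes transforms. -/

section Stieltjes

variable {m S T : Matrix ℕ ℕ A} (hf : IsLowerFactorization m S T) {μ : ℕ → A}
  (hm : ∀ i j, m i j = μ (i + j)) {B : Type*} [CommRing B] [Algebra A B]
  (ν : ℕ → B) (z w : B) (hzw : z * w = 1)
  (hν : ∀ j, ν j - w * ν (j + 1) = algebraMap A B (μ j))

include hν in
-- Here `momFun ν` stands for p ↦ z ∫ p(u)/(z-u) ρ(u) du with w = z⁻¹, and the identity is u/(z-u) =
-- z/(z-u) - 1. An abstract target B serves the formal case (Laurent series) and the analytic case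
-- (ℂ) together.
theorem mul_momFun_X_mul (p : A[X]) :
    w * momFun ν (X * p) = momFun ν p - algebraMap A B (momFun μ p) := by
  induction p using Polynomial.induction_on' with
  | add p q hp hq => simp only [mul_add, map_add, hp, hq]; ring
  | monomial k a =>
    rw [← C_mul_X_pow_eq_monomial, mul_left_comm, ← pow_succ', momFun_C_mul_X_pow,
      momFun_C_mul_X_pow, momFun_C_mul_X_pow, smul_eq_mul, map_mul, ← hν k]
    simp only [Algebra.smul_def]
    ring

include hzw hν in
theorem momFun_X_mul (p : A[X]) :
    momFun ν (X * p) = z * (momFun ν p - algebraMap A B (momFun μ p)) := by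
  rw [← mul_momFun_X_mul ν w hν, ← mul_assoc, hzw, one_mul]

include hf hm hzw hν

/-- The defect in the eigenvalue equation is z ∫ p_n ρ, which vanishes by orthogonality to 1 as soon
as n ≥ 1. -/
theorem iact_lax_stieltjes {n : ℕ} (hn : 1 ≤ n) :
    iact (lax S T) (fun k => momFun ν (pPoly S k)) n = z * momFun ν (pPoly S n) := by
  have h := hf.momFun_pPoly_mul_X_pow hm n 0
  rw [pow_zero, mul_one, hf.lower_inv 0 n (by lia)] at h
  rw [hf.iact_lax_momFun, momFun_X_mul ν z w hzw hν, h, map_zero, sub_zero]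

/-- Row 0 separates the two: p satisfies the eigenvalue equation there, whereas q misses it by z T₀₀
≠ 0. So a relation has b = 0, and then a = 0 because p_0 is a non-zero constant. -/
theorem linearIndependent_pPoly_stieltjes [IsDomain B] [Nontrivial A]
    (hinj : Function.Injective (algebraMap A B)) :
    LinearIndependent B ![fun n => aeval z (pPoly S n), fun n => momFun ν (pPoly S n)] := by
  rw [LinearIndependent.pair_iff]
  intro a b hab
  have hp : ∀ n, a * aeval z (pPoly S n) + b * momFun ν (pPoly S n) = 0 := fun n =>
    congrFun hab n
  set f : A[X] →ₗ[A] B :=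
    a • (aeval z : A[X] →ₐ[A] B).toLinearMap + b • momFun ν with hfdef
  have hf0 : ∀ p, f p = a * aeval z p + b * momFun ν p := fun p => rfl
  have h0 : f (X * pPoly S 0) = 0 := by
    rw [← hf.iact_lax_momFun, iact_eq_sum_toFinset hf.rowFinite_L]
    exact Finset.sum_eq_zero fun k _ => by rw [hf0, hp, smul_zero]
  have hz : z ≠ 0 := left_ne_zero_of_mul_eq_one hzw
  have hne : ∀ {x y : A}, x * y = 1 → algebraMap A B x ≠ 0 := fun {x y} h h' =>
    left_ne_zero_of_mul_eq_one h ((map_eq_zero_iff _ hinj).mp h')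
  have hT := hf.momFun_pPoly_mul_X_pow hm 0 0
  rw [pow_zero, mul_one] at hT
  rw [hf0, map_mul, aeval_X, momFun_X_mul ν z w hzw hν, hT] at h0
  have h1 := hp 0
  have hb : b * (z * algebraMap A B (T 0 0)) = 0 := by linear_combination z * h1 - h0
  have hb0 : b = 0 := by
    refine (mul_eq_zero.mp hb).resolve_right (mul_ne_zero hz (hne
      ((mul_comm _ _).trans (hf.S_mul_T 0))))
  refine ⟨?_, hb0⟩
  rw [hb0, zero_mul, add_zero] at h1
  have h2 : pPoly S 0 = C (S 0 0) := by
    rw [eq_C_of_natDegree_eq_zero (hf.natDegree_pPoly 0), coeff_pPoly hf.lower]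
  rw [h2, aeval_C] at h1
  exact (mul_eq_zero.mp h1).resolve_right (hne (hf.S_mul_T 0))

end Stieltjes

end Factorization

/-! ### The Toda vector fields -/

section Toda

variable {A : Type*} [CommRing A]

theorem skewPart_add_borelPart (M : Matrix ℕ ℕ A) : skewPart M + borelPart M = M := by
  rw [borelPart, add_sub_cancel]

theorem skewPart_add (M N : Matrix ℕ ℕ A) : skewPart (M + N) = skewPart M + skewPart N := by
  ext i j
  simp only [skewPart, Matrix.add_apply]
  split_ifs <;> ring

theorem skewPart_sub (M N : Matrix ℕ ℕ A) : skewPart (M - N) = skewPart M - skewPart N := by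
  ext i j
  simp only [skewPart, Matrix.sub_apply]
  split_ifs <;> ring

theorem skewPart_of_lower {M : Matrix ℕ ℕ A} (h : ∀ i j, i < j → M i j = 0) : skewPart M = 0 := by
  ext i j
  simp only [skewPart, Matrix.zero_apply]
  split_ifs with h1 h2
  · exact h i j h1
  · rw [h j i h2, neg_zero]
  · rfl

theorem skewPart_of_skew {M : Matrix ℕ ℕ A} (h : M.transpose = -M) (h0 : ∀ i, M i i = 0) :
    skewPart M = M := by
  ext i j
  rcases lt_trichotomy i j with hij | hij | hij
  · simp [skewPart, hij]
  · simp [skewPart, hij, h0]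
  · have := congrFun (congrFun h i) j
    simp only [Matrix.transpose_apply, Matrix.neg_apply] at this
    simp [skewPart, hij, hij.not_gt, this]

theorem RowFinite.skewPart {M : Matrix ℕ ℕ A} (h : RowFinite M) : RowFinite (skewPart M) := by
  intro i
  refine ((h i).union (Set.finite_lt_nat i)).subset fun j hj => ?_
  by_cases hij : i < j
  · left
    simpa [TodaKP.skewPart, hij] using hj
  · by_cases hji : j < i
    · exact Or.inr hji
    · simp [TodaKP.skewPart, hij, hji] at hj

theorem RowFinite.borelPart {M : Matrix ℕ ℕ A} (h : RowFinite M) : RowFinite (borelPart M) :=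
  h.sub h.skewPart

variable {K : Type*} [Field K] [Algebra K A]

/-- L^k commutes with L, so the commutators of its two parts with L are opposite. -/
theorem todaSkew_eq_todaBorel {L : Matrix ℕ ℕ A} (hL : RowFinite L) (k : ℕ) :
    todaSkew K L k = todaBorel K L k := by
  have hk := rowFinite_ipow hL k
  have hc := imul_ipow_comm hL k
  unfold todaSkew todaBorel ibracket
  rw [smul_imul _ hk.skewPart, smul_imul _ hk.borelPart, imul_smul _ hL, imul_smul _ hL, borelPart,
    sub_imul hk hk.skewPart, imul_sub hL, hc]
  module

/-- The derivative of `L = S Λ S⁻¹` when the moment matrix moves by `Λ^k`. -/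
theorem deriv_lax_eq_todaSkew [CharZero K] {m S T : Matrix ℕ ℕ A} (hf : IsLowerFactorization m S T)
    (k : ℕ) {m' S' T' : Matrix ℕ ℕ A} (hS' : ∀ i j, i < j → S' i j = 0)
    (hT' : ∀ i j, i < j → T' i j = 0) (hm : ∀ i j, m' i j = m (i + k) j)
    (h1 : m' = imul T' T.transpose + imul T T'.transpose) (h2 : imul S' T + imul S T' = 0) :
    imul (imul S' shiftMat) T + imul (imul S shiftMat) T' = todaSkew K (lax S T) k := by
  have rS := hf.rowFinite_S
  have rT := hf.rowFinite_T
  have rS' := rowFinite_of_lower hS'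
  have rT' := rowFinite_of_lower hT'
  have rL := hf.rowFinite_L
  have rΛ : RowFinite (shiftMat : Matrix ℕ ℕ A) := rowFinite_shiftMat
  set L := lax S T with hL
  have hshift : ∀ k, ∀ (N : Matrix ℕ ℕ A) i j, imul (ipow shiftMat k) N i j = N (i + k) j := by
    intro k
    induction k with
    | zero => intro N i j; rw [ipow, one_imul, add_zero]
    | succ k ih =>
      intro N i j
      rw [ipow, imul_assoc (rowFinite_ipow rΛ k) rΛ, ih, imul_apply_eq_iact, iact_shiftMat,
        add_assoc]
  have hpow : ∀ k, ipow L k = imul (imul S (ipow shiftMat k)) T := by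
    intro k
    induction k with
    | zero => rw [ipow, ipow, imul_one, hf.mul_inv]
    | succ k ih =>
      have rk := rowFinite_ipow rΛ k
      rw [ipow, ih, hL, lax, imul_assoc (rS.imul rk) rT, ← imul_assoc rT (rS.imul rΛ),
        ← imul_assoc rT rS, hf.inv_mul, one_imul, ← imul_assoc (rS.imul rk) rΛ, imul_assoc rS rk,
        ipow]
  -- Y is minus the logarithmic derivative S' S⁻¹, and it is lower triangular.
  set Y := imul S T' with hY
  have rY : RowFinite Y := rS.imul rT'
  have hYl : ∀ i j, i < j → Y i j = 0 := imul_lower hf.lower hT'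
  have hSm : imul S m' = imul (ipow L k) T.transpose := by
    have : m' = imul (ipow shiftMat k) m := by ext i j; rw [hm, hshift]
    have rk := rowFinite_ipow rΛ k
    rw [this, hf.factor, hpow, imul_assoc (rS.imul rk) rT, imul_assoc rS rk]
  -- S m' Sᵀ is computed twice: as Y + Yᵀ from m = T Tᵀ, and as L^k from m' = Λ^k m. The transpose
  -- is taken first because the associativity law requires the two left-hand factors to have finite
  -- rows.
  have hYY : Y.transpose + Y = (ipow L k).transpose := by
    have e1 : imul S m' = imul Y T.transpose + T'.transpose := by
      rw [h1, imul_add rS, ← imul_assoc rS rT', ← imul_assoc rS rT, hf.mul_inv, one_imul]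
    have e2 := congrArg (fun M => imul S M.transpose) (e1.symm.trans hSm)
    simp only [Matrix.transpose_add, transpose_imul, Matrix.transpose_transpose] at e2
    rwa [imul_add rS, ← imul_assoc rS rT, ← imul_assoc rS rT, hf.mul_inv, one_imul, one_imul] at e2
  have h2' : (algebraMap K A 2) * algebraMap K A 2⁻¹ = 1 := by
    rw [← map_mul, mul_inv_cancel₀ two_ne_zero, map_one]
  -- L^k = Y + Yᵀ is symmetric, so its Borel part doubles the entries below the diagonal and keeps
  -- the diagonal ones, which are already 2 Y_ii. Either way it equals 2Y.
  have hYB : Y = (2⁻¹ : K) • borelPart (ipow L k) := by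
    have hsum : ∀ i j, ipow L k i j = Y i j + Y j i := fun i j => by
      have := congrFun (congrFun hYY j) i
      simp only [Matrix.add_apply, Matrix.transpose_apply] at this
      exact this.symm
    have two : ∀ a : A, a = (2⁻¹ : K) • (a + a) := fun a => by
      rw [Algebra.smul_def]
      rw [map_ofNat] at h2'
      linear_combination (-a) * h2'
    ext i j
    rw [Matrix.smul_apply, borelPart, Matrix.sub_apply, skewPart, hsum i j, hsum j i]
    rcases lt_trichotomy i j with hij | hij | hij
    · simp [hij, hYl i j hij]
    · rw [← hij, if_neg (lt_irrefl i), if_neg (lt_irrefl i), sub_zero]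
      exact two _
    · rw [if_neg hij.not_gt, if_pos hij, hYl j i hij, add_zero, zero_add, sub_neg_eq_add]
      exact two _
  have hS2 : S' = -imul Y S := by
    have := congrArg (fun M => imul M S) (eq_neg_of_add_eq_zero_left h2)
    rwa [imul_assoc rS' rT, hf.inv_mul, imul_one, neg_imul] at this
  have hT2 : T' = imul T Y := by
    rw [hY, ← imul_assoc rT rS, hf.inv_mul, one_imul]
  rw [todaSkew_eq_todaBorel rL, todaBorel, ← hYB, ibracket, hS2, hT2, neg_imul, neg_imul,
    imul_assoc rY rS, imul_assoc rY (rS.imul rΛ), ← imul_assoc (rS.imul rΛ) rT, hL, lax]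
  abel

/-- A matrix with finite rows as an endomorphism of the space of all columns. -/
def toEnd {M : Matrix ℕ ℕ A} (h : RowFinite M) : Module.End A (ℕ → A) where
  toFun v := iact M v
  map_add' := iact_add h
  map_smul' c v := by
    ext i
    simp [iact_eq_sum_toFinset h, Finset.mul_sum, mul_left_comm]

/-- The standard columns recover the entries. Polynomial identities among matrices with finite rows
can therefore be checked in the ring of endomorphisms, where `noncomm_ring` is available. -/
theorem eq_of_toEnd_eq {M N : Matrix ℕ ℕ A} (hM : RowFinite M) (hN : RowFinite N)
    (h : toEnd hM = toEnd hN) : M = N := by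
  ext i j
  have := congrFun (congrArg (fun f : Module.End A (ℕ → A) => f fun k => (1 : Matrix ℕ ℕ A) k j) h) i
  change imul M 1 i j = imul N 1 i j at this
  rwa [imul_one, imul_one] at this

theorem toEnd_imul {M N : Matrix ℕ ℕ A} (hM : RowFinite M) (hN : RowFinite N) :
    toEnd (hM.imul hN) = toEnd hM * toEnd hN := by
  ext1 v
  exact iact_imul hM hN v

theorem toEnd_sub {M N : Matrix ℕ ℕ A} (hM : RowFinite M) (hN : RowFinite N) :
    toEnd (hM.sub hN) = toEnd hM - toEnd hN := by
  ext v i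
  exact congrFun (congrFun (sub_imul hM hN (fun k _ => v k)) i) 0

theorem toEnd_add {M N : Matrix ℕ ℕ A} (hM : RowFinite M) (hN : RowFinite N) :
    toEnd (hM.add hN) = toEnd hM + toEnd hN := by
  ext v i
  exact congrFun (congrFun (add_imul hM hN (fun k _ => v k)) i) 0

theorem RowFinite.ibracket {M N : Matrix ℕ ℕ A} (hM : RowFinite M) (hN : RowFinite N) :
    RowFinite (ibracket M N) := (hM.imul hN).sub (hN.imul hM)

theorem toEnd_ibracket {M N : Matrix ℕ ℕ A} (hM : RowFinite M) (hN : RowFinite N) :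
    toEnd (hM.ibracket hN) = toEnd hM * toEnd hN - toEnd hN * toEnd hM := by
  rw [← toEnd_imul, ← toEnd_imul, ← toEnd_sub]
  rfl

theorem toEnd_congr {M N : Matrix ℕ ℕ A} (hM : RowFinite M) (h : M = N) :
    toEnd hM = toEnd (h ▸ hM : RowFinite N) := by subst h; rfl

theorem transpose_ibracket (M N : Matrix ℕ ℕ A) :
    (ibracket M N).transpose = ibracket N.transpose M.transpose := by
  rw [ibracket, Matrix.transpose_sub, transpose_imul, transpose_imul, ibracket]

/-- The second derivative of `L` along two Toda flows, as an expression in `L`. -/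
def todaSkewDeriv (K : Type*) [Field K] [Algebra K A] (L : Matrix ℕ ℕ A) (k l : ℕ) : Matrix ℕ ℕ A :=
  ibracket ((2⁻¹ : K) • skewPart (ibracket ((2⁻¹ : K) • skewPart (ipow L l)) (ipow L k))) L +
    ibracket ((2⁻¹ : K) • skewPart (ipow L k)) (todaSkew K L l)

/-- Zero curvature. Write L^k = 2(P + Q) and L^l = 2(P' + Q') with P, P' skew and Q, Q' lower
triangular. Since L^k and L^l commute, [P', L^k] - [P, L^l] = 2[P', P] + 2[Q, Q']; the first bracket
is skew and the second lower triangular, so the skew part is 2[P', P]. -/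
theorem half_skewPart_sub [CharZero K] {L : Matrix ℕ ℕ A} (hL : RowFinite L) (k l : ℕ) :
    (2⁻¹ : K) • skewPart (ibracket ((2⁻¹ : K) • skewPart (ipow L l)) (ipow L k)) -
      (2⁻¹ : K) • skewPart (ibracket ((2⁻¹ : K) • skewPart (ipow L k)) (ipow L l)) =
    ibracket ((2⁻¹ : K) • skewPart (ipow L l)) ((2⁻¹ : K) • skewPart (ipow L k)) := by
  have two : ∀ M : Matrix ℕ ℕ A, RowFinite M → ∃ P Q : Matrix ℕ ℕ A, ∃ _ : RowFinite P,
      ∃ _ : RowFinite Q, P = (2⁻¹ : K) • skewPart M ∧ M = (P + P) + (Q + Q) ∧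
      (∀ i j, i < j → Q i j = 0) ∧ P.transpose = -P := fun M hM => by
    refine ⟨(2⁻¹ : K) • skewPart M, (2⁻¹ : K) • borelPart M, hM.skewPart.smul _,
      hM.borelPart.smul _, rfl, ?_, ?_, ?_⟩
    · rw [← two_smul K, ← two_smul K, smul_inv_smul₀ two_ne_zero, smul_inv_smul₀ two_ne_zero,
        skewPart_add_borelPart]
    · intro i j hij
      rw [Matrix.smul_apply, borelPart_of_lt M hij, smul_zero]
    · rw [Matrix.transpose_smul, skewPart_transpose, smul_neg]
  have hcomm := ipow_comm hL k l
  have hk := rowFinite_ipow hL k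
  have hl := rowFinite_ipow hL l
  obtain ⟨P, Q, hP, hQ, hPe, hPQ, hQl, hPs⟩ := two _ hk
  obtain ⟨P', Q', hP', hQ', hPe', hPQ', hQl', hPs'⟩ := two _ hl
  rw [← hPe, ← hPe', ← smul_sub, ← skewPart_sub]
  have key : ibracket P' (ipow L k) - ibracket P (ipow L l) =
      (ibracket P' P + ibracket P' P) + (ibracket Q Q' + ibracket Q Q') := by
    refine eq_of_toEnd_eq ((hP'.ibracket hk).sub (hP.ibracket hl))
      (((hP'.ibracket hP).add (hP'.ibracket hP)).add ((hQ.ibracket hQ').add (hQ.ibracket hQ'))) ?_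
    have hkE : toEnd hk = (toEnd hP + toEnd hP) + (toEnd hQ + toEnd hQ) := by
      rw [← toEnd_add, ← toEnd_add, ← toEnd_add]
      exact toEnd_congr hk hPQ
    have hlE : toEnd hl = (toEnd hP' + toEnd hP') + (toEnd hQ' + toEnd hQ') := by
      rw [← toEnd_add, ← toEnd_add, ← toEnd_add]
      exact toEnd_congr hl hPQ'
    have hcE : toEnd hk * toEnd hl = toEnd hl * toEnd hk := by
      rw [← toEnd_imul, ← toEnd_imul]
      exact toEnd_congr _ hcomm
    have e0 : ∀ x y : Module.End A (ℕ → A), x + x = y + y → x = y := fun x y h => by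
      have h2 := congrArg (fun e => (2⁻¹ : K) • e) h
      simp only [← two_smul K, smul_smul, inv_mul_cancel₀ (two_ne_zero (α := K)), one_smul] at h2
      exact h2
    -- Twice the difference of the two sides is exactly -[L^k, L^l], so no division is left for
    -- `noncomm_ring`.
    refine e0 _ _ ?_
    rw [toEnd_sub (hP'.ibracket hk) (hP.ibracket hl),
      toEnd_add ((hP'.ibracket hP).add (hP'.ibracket hP)) ((hQ.ibracket hQ').add (hQ.ibracket hQ')),
      toEnd_add (hP'.ibracket hP) (hP'.ibracket hP), toEnd_add (hQ.ibracket hQ') (hQ.ibracket hQ'),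
      toEnd_ibracket hP' hk, toEnd_ibracket hP hl, toEnd_ibracket hP' hP, toEnd_ibracket hQ hQ',
      ← sub_eq_zero, ← neg_eq_zero]
    rw [hkE, hlE] at hcE ⊢
    rw [← sub_eq_zero] at hcE
    rw [← hcE]
    noncomm_ring
  have hskew : skewPart (ibracket P' P) = ibracket P' P := by
    refine skewPart_of_skew ?_ fun i => ?_
    · rw [transpose_ibracket, hPs, hPs', ibracket, ibracket]
      simp only [imul_neg, neg_imul]
      abel
    · rw [ibracket, Matrix.sub_apply, ← Matrix.transpose_apply (imul P P') i i, transpose_imul, hPs,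
        hPs', imul_neg, neg_imul, neg_neg, sub_self]
  have hlow : skewPart (ibracket Q Q') = 0 := skewPart_of_lower fun i j hij => by
    rw [ibracket, Matrix.sub_apply, imul_lower hQl hQl' i j hij, imul_lower hQl' hQl i j hij,
      sub_zero]
  rw [key, skewPart_add, skewPart_add, skewPart_add, hskew, hlow, add_zero, add_zero,
    ← two_smul K, inv_smul_smul₀ two_ne_zero]

theorem jacobi_aux {R : Type*} [Ring R] (v p q l : R) :
    (v + (q * p - p * q)) * l - l * (v + (q * p - p * q)) + (p * (q * l - l * q) - (q * l - l * q) * p)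
      = v * l - l * v + (q * (p * l - l * p) - (p * l - l * p) * q) := by
  noncomm_ring

/-- Exchanging k and l changes the first term by [[P', P], L] (zero curvature), and the Jacobi
identity compensates this in the second term. -/
theorem todaSkewDeriv_comm [CharZero K] {L : Matrix ℕ ℕ A} (hL : RowFinite L) (k l : ℕ) :
    todaSkewDeriv K L k l = todaSkewDeriv K L l k := by
  have h := half_skewPart_sub (K := K) hL k l
  have hk := rowFinite_ipow hL k
  have hl := rowFinite_ipow hL l
  unfold todaSkewDeriv todaSkew
  set P := (2⁻¹ : K) • skewPart (ipow L k)
  set P' := (2⁻¹ : K) • skewPart (ipow L l)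
  have hP : RowFinite P := hk.skewPart.smul _
  have hP' : RowFinite P' := hl.skewPart.smul _
  set U := (2⁻¹ : K) • skewPart (ibracket P' (ipow L k))
  set V := (2⁻¹ : K) • skewPart (ibracket P (ipow L l))
  have hU : RowFinite U := (hP'.ibracket hk).skewPart.smul _
  have hV : RowFinite V := (hP.ibracket hl).skewPart.smul _
  refine eq_of_toEnd_eq ((hU.ibracket hL).add (hP.ibracket (hP'.ibracket hL)))
    ((hV.ibracket hL).add (hP'.ibracket (hP.ibracket hL))) ?_
  have hUV : toEnd hU = toEnd hV + (toEnd hP' * toEnd hP - toEnd hP * toEnd hP') := by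
    rw [← toEnd_ibracket, ← toEnd_add]
    exact toEnd_congr hU (by rw [← h]; abel)
  rw [toEnd_add (hU.ibracket hL) (hP.ibracket (hP'.ibracket hL)),
    toEnd_add (hV.ibracket hL) (hP'.ibracket (hP.ibracket hL)), toEnd_ibracket hU hL,
    toEnd_ibracket hV hL, toEnd_ibracket hP (hP'.ibracket hL), toEnd_ibracket hP' (hP.ibracket hL),
    toEnd_ibracket hP hL, toEnd_ibracket hP' hL, hUV]
  exact jacobi_aux _ _ _ _

theorem leibniz_aux {R : Type*} [Ring R] (p q l : R) :
    (p * q - q * p) * l + q * (p * l - l * p) = p * (q * l) - q * l * p := by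
  noncomm_ring

/-- Bracketing with P is a derivation. This is the inductive step showing that all powers of L obey
the Lax equation of L. -/
theorem ibracket_ipow_succ {P L : Matrix ℕ ℕ A} (hP : RowFinite P) (hL : RowFinite L) (k : ℕ) :
    imul (ibracket P (ipow L k)) L + imul (ipow L k) (ibracket P L) =
      ibracket P (ipow L (k + 1)) := by
  have hk := rowFinite_ipow hL k
  rw [ipow]
  refine eq_of_toEnd_eq (((hP.ibracket hk).imul hL).add (hk.imul (hP.ibracket hL)))
    (hP.ibracket (hk.imul hL)) ?_
  rw [toEnd_add ((hP.ibracket hk).imul hL) (hk.imul (hP.ibracket hL)),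
    toEnd_imul (hP.ibracket hk) hL, toEnd_imul hk (hP.ibracket hL), toEnd_ibracket hP hk,
    toEnd_ibracket hP hL, toEnd_ibracket hP (hk.imul hL), toEnd_imul hk hL]
  exact leibniz_aux _ _ _

end Toda

/-! ### Existence of the factorization -/

section Existence

open Polynomial

variable {A : Type*} [CommRing A]

/-- The factorization attached to square roots `s n` of `τ_n / τ_{n+1}` and inverses `v n` of
`τ_n`. -/
def factS (μ s v : ℕ → A) : Matrix ℕ ℕ A := fun n k => s n * v n * (hankelPoly μ n).coeff k

/-- The inverse of `factS`. -/
def factT (μ s v : ℕ → A) : Matrix ℕ ℕ A := fun i j =>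
  s j * v j * momFun μ (hankelPoly μ j * X ^ i)

/-- The rows of S are the normalized orthogonal polynomials. Roots and inverses are supplied as
data, so that one construction works over formal power series, ℝ and ℂ. -/
theorem isLowerFactorization_fact [Nontrivial A] {m : Matrix ℕ ℕ A} {μ : ℕ → A}
    (hm : ∀ i j, m i j = μ (i + j)) (s v : ℕ → A) (hv : ∀ n, v n * hankel μ n = 1)
    (hs : ∀ n, s n ^ 2 * hankel μ (n + 1) = hankel μ n) :
    IsLowerFactorization m (factS μ s v) (factT μ s v) ∧ ∀ n, factS μ s v n n = s n := by
  set S := factS μ s v with hS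
  set T := factT μ s v with hT
  have hSl : ∀ i j, i < j → S i j = 0 := fun i j hij => by
    simp only [hS, factS]
    rw [coeff_eq_zero_of_natDegree_lt ((natDegree_hankelPoly_le μ i).trans_lt hij), mul_zero]
  have hTl : ∀ i j, i < j → T i j = 0 := fun i j hij => by
    simp only [hT, factT]
    rw [hankelPoly_orthogonal μ hij, mul_zero]
  have hSd : ∀ n, S n n = s n := fun n => by
    simp only [hS, factS, coeff_hankelPoly_self]
    rw [mul_assoc, hv, mul_one]
  have hsu : ∀ n, IsUnit (s n) := fun n => by
    refine IsUnit.of_mul_eq_one (s n * hankel μ (n + 1) * v n) ?_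
    have := hs n; have := hv n
    linear_combination v n * hs n + hv n
  have hp : ∀ n, pPoly S n = C (s n * v n) * hankelPoly μ n := fun n => by
    ext k
    rw [coeff_pPoly hSl, coeff_C_mul, hS, factS]
  have hTp : ∀ i j, T i j = momFun μ (pPoly S j * X ^ i) := fun i j => by
    rw [hp, mul_assoc, C_mul', map_smul, smul_eq_mul, hT, factT]
  have hST0 : ∀ i j, imul S T i j = momFun μ (pPoly S j * pPoly S i) := fun i j => by
    rw [momFun_mul, momFun_pPoly hSl, imul_apply_eq_iact]
    simp only [hTp]
  -- S T is lower triangular as a product and symmetric as a table of moments of p_i p_j, hence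
  -- diagonal; the normalization of s makes the diagonal 1.
  have hST : imul S T = 1 := by
    have hlt : ∀ i j, i < j → imul S T i j = 0 := imul_lower hSl hTl
    have hsymm : ∀ i j, imul S T i j = imul S T j i := fun i j => by rw [hST0, hST0, mul_comm]
    ext i j
    rcases lt_trichotomy i j with hij | hij | hij
    · rw [hlt i j hij, Matrix.one_apply_ne hij.ne]
    · subst hij
      rw [imul_eq_sum_of_lower hSl T (Nat.lt_succ_self i), Finset.sum_range_succ,
        Finset.sum_eq_zero, zero_add, Matrix.one_apply_eq, hSd]
      · simp only [hT, factT]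
        rw [momFun_hankelPoly_mul_X_pow_self]
        linear_combination v i * hs i + hv i
      · intro k hk
        rw [hTl k i (by simpa using hk), mul_zero]
    · rw [hsymm, hlt j i hij, Matrix.one_apply_ne hij.ne']
  -- Triangular products are computed exactly by finite corners, where a one-sided inverse is
  -- two-sided.
  have hTS : imul T S = 1 := by
    ext i j
    set n := max i j + 1 with hn
    set s' : Matrix (Fin n) (Fin n) A := Matrix.of fun a b => S a b
    set t' : Matrix (Fin n) (Fin n) A := Matrix.of fun a b => T a b
    have hst : s' * t' = 1 := by
      ext a b
      have := congrFun (congrFun hST a) b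
      rw [imul_eq_sum_of_lower hSl T a.2, Finset.sum_range] at this
      rw [Matrix.mul_apply, Matrix.one_apply]
      simpa [s', t', Matrix.one_apply, Fin.ext_iff] using this
    have hts := mul_eq_one_comm.mp hst
    have := congrFun (congrFun hts ⟨i, by lia⟩) ⟨j, by lia⟩
    rw [Matrix.mul_apply, Matrix.one_apply] at this
    rw [imul_eq_sum_of_lower hTl S (n := n) (by lia), Finset.sum_range, Matrix.one_apply]
    simpa [s', t', Fin.ext_iff] using this
  refine ⟨⟨hSl, fun n => ?_, hTl, hST, hTS, ?_⟩, hSd⟩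
  · rw [hSd]; exact (hsu n).ne_zero
  · have hSm : imul S m = T.transpose := by
      ext i j
      rw [imul_apply_eq_iact, Matrix.transpose_apply, hTp, momFun_mul_X_pow, momFun_pPoly hSl]
      simp only [hm]
    rw [← hSm, ← imul_assoc (rowFinite_of_lower hTl) (rowFinite_of_lower hSl), hTS, one_imul]

end Existence

/-! ### Flows of derivations on formal power series -/

section Flow

open PowerSeries

variable {K B : Type*} [Field K] [CommRing B] [Algebra K B]

/-- A derivation acting on the coefficients of a power series. -/
def mapDer (d : Derivation K B B) (F : PowerSeries B) : PowerSeries B :=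
  PowerSeries.mk fun n => d (coeff n F)

theorem mapDer_mul (d : Derivation K B B) (F G : PowerSeries B) :
    mapDer d (F * G) = mapDer d F * G + F * mapDer d G := by
  ext n
  simp only [mapDer, coeff_mk, coeff_mul, map_add, map_sum, Derivation.leibniz, smul_eq_mul,
    Finset.sum_add_distrib]
  rw [add_comm]
  simp only [mul_comm]

/-- `w F'(w) = ∑_{i ≥ 1} w^i D_i F(w)`. -/
def IsFlow (D : ℕ → Derivation K B B) (F : PowerSeries B) : Prop :=
  ∀ N : ℕ, ((N : B) + 1) * coeff (N + 1) F = ∑ i ∈ Finset.range (N + 1), D (i + 1) (coeff (N - i) F)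

/-- The difference of the two sides of the flow equation, up to higher order terms. -/
def flowDefect (D : ℕ → Derivation K B B) (N : ℕ) (F : PowerSeries B) : PowerSeries B :=
  derivative B F - ∑ i ∈ Finset.range (N + 1), X ^ i * mapDer (D (i + 1)) F

theorem coeff_flowDefect (D : ℕ → Derivation K B B) {n N : ℕ} (h : n ≤ N) (F : PowerSeries B) :
    coeff n (flowDefect D N F) =
      ((n : B) + 1) * coeff (n + 1) F - ∑ i ∈ Finset.range (n + 1), D (i + 1) (coeff (n - i) F) := by
  rw [flowDefect, map_sub, coeff_derivative, map_sum, mul_comm]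
  congr 1
  rw [← Finset.sum_subset (Finset.range_mono (by lia : n + 1 ≤ N + 1))]
  · refine Finset.sum_congr rfl fun i hi => ?_
    rw [coeff_X_pow_mul', if_pos (by simp at hi; lia), mapDer, coeff_mk]
  · intro i _ hi
    rw [coeff_X_pow_mul', if_neg (by simp at hi; lia)]

theorem isFlow_iff (D : ℕ → Derivation K B B) (F : PowerSeries B) :
    IsFlow D F ↔ ∀ N, X ^ (N + 1) ∣ flowDefect D N F := by
  simp only [X_pow_dvd_iff]
  refine ⟨fun h N n hn => ?_, fun h N => ?_⟩
  · rw [coeff_flowDefect D (by lia), h n, sub_self]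
  · have := h N N (Nat.lt_succ_self N)
    rwa [coeff_flowDefect D le_rfl, sub_eq_zero] at this

/-- Both sides of the flow equation are derivations in F, so the defect obeys the Leibniz rule.
Cutting the infinite sum of D_i at N is harmless modulo `X ^ (N + 1)`. -/
theorem IsFlow.mul {D : ℕ → Derivation K B B} {F G : PowerSeries B} (hF : IsFlow D F)
    (hG : IsFlow D G) : IsFlow D (F * G) := by
  rw [isFlow_iff] at *
  intro N
  have : flowDefect D N (F * G) = flowDefect D N F * G + F * flowDefect D N G := by
    simp only [flowDefect, Derivation.leibniz, smul_eq_mul, mapDer_mul, mul_add,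
      Finset.sum_add_distrib, sub_mul, mul_sub, Finset.sum_mul, Finset.mul_sum]
    simp only [mul_left_comm F, ← mul_assoc]
    ring
  rw [this]
  exact dvd_add ((hF N).mul_right G) ((hG N).mul_left F)

theorem IsFlow.add {D : ℕ → Derivation K B B} {F G : PowerSeries B} (hF : IsFlow D F)
    (hG : IsFlow D G) : IsFlow D (F + G) := fun N => by
  simp only [map_add, mul_add, Finset.sum_add_distrib, hF N, hG N]

theorem isFlow_C {D : ℕ → Derivation K B B} (c : K) :
    IsFlow D (C (algebraMap K B c)) := fun N => by
  simp only [coeff_C]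
  rw [if_neg (Nat.succ_ne_zero N), mul_zero, Finset.sum_eq_zero]
  intro i _
  split_ifs <;> simp

/-- The flow equation is a recursion for the coefficients, N + 1 being invertible: a flow is
determined by its value at w = 0. -/
theorem IsFlow.ext [CharZero K] {D : ℕ → Derivation K B B} {F G : PowerSeries B}
    (hF : IsFlow D F) (hG : IsFlow D G) (h : coeff 0 F = coeff 0 G) : F = G := by
  ext n
  induction n using Nat.strong_induction_on with
  | _ n ih =>
    cases n with
    | zero => exact h
    | succ n =>
      have hu : IsUnit ((n : B) + 1) := by
        have : ((n : B) + 1) = algebraMap K B ((n : K) + 1) := by simp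
        rw [this]
        exact (IsUnit.mk0 _ (Nat.cast_add_one_ne_zero n)).map _
      refine hu.mul_left_cancel ?_
      rw [hF n, hG n]
      exact Finset.sum_congr rfl fun i _ => by rw [ih (n - i) (by lia)]

theorem isFlow_aeval {ι : Type*} {D : ℕ → Derivation K B B} {ν : ι → PowerSeries B} (hν : ∀ i, IsFlow D (ν i)) (f : MvPolynomial ι K) :
    IsFlow D (MvPolynomial.aeval ν f) := by
  induction f using MvPolynomial.induction_on with
  | C a =>
    have h : MvPolynomial.aeval ν (MvPolynomial.C a) = C (algebraMap K B a) :=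
      (MvPolynomial.aeval_C ν a).trans PowerSeries.algebraMap_apply
    rw [h]
    exact isFlow_C a
  | add p q hp hq => rw [map_add]; exact hp.add hq
  | mul_X p i hp => rw [map_mul, MvPolynomial.aeval_X]; exact hp.mul (hν i)

end Flow

/-! ### Elementary Schur polynomials -/

section Schur

open PowerSeries

theorem succ_mul_coeff_pow_succ {B : Type*} [CommRing B] (F : PowerSeries B) (j N : ℕ) :
    ((N : B) + 1) * coeff (N + 1) (F ^ (j + 1)) = ((j : B) + 1) *
      ∑ i ∈ Finset.range (N + 1), ((i : B) + 1) * coeff (i + 1) F * coeff (N - i) (F ^ j) := by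
  have h1 : derivative B (F ^ (j + 1)) = C ((j : B) + 1) * (derivative B F * F ^ j) := by
    rw [Derivation.leibniz_pow, Nat.add_sub_cancel, smul_eq_mul, nsmul_eq_mul]
    push_cast
    rw [map_add, map_natCast, map_one, mul_comm (F ^ j)]
  have h2 := congrArg (coeff N) h1
  rw [coeff_derivative, coeff_C_mul, coeff_mul,
    Finset.Nat.sum_antidiagonal_eq_sum_range_succ_mk] at h2
  rw [mul_comm, h2]
  congr 1
  refine Finset.sum_congr rfl fun i _ => ?_
  rw [coeff_derivative]
  ring

variable (K : Type*) [Field K]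

theorem coeff_schurExponent_succ (i : ℕ) :
    coeff (i + 1) (schurExponent K) = MvPolynomial.X (Nat.succPNat i) := by
  rw [schurExponent, coeff_mk]

theorem X_dvd_schurExponent : (X : PowerSeries (MvPolynomial ℕ+ K)) ∣ schurExponent K := by
  rw [X_dvd_iff, ← coeff_zero_eq_constantCoeff_apply, schurExponent, coeff_mk]

theorem coeff_schurExponent_pow {j k : ℕ} (h : k < j) : coeff k (schurExponent K ^ j) = 0 :=
  X_pow_dvd_iff.mp (pow_dvd_pow_of_dvd (X_dvd_schurExponent K) j) k h

theorem schur_eq_sum_range {k N : ℕ} (h : k < N) :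
    schur K k = ∑ j ∈ Finset.range N,
      MvPolynomial.C ((j.factorial : K)⁻¹) * coeff k (schurExponent K ^ j) := by
  rw [schur]
  refine Finset.sum_subset (Finset.range_mono h) fun j _ hj => ?_
  rw [coeff_schurExponent_pow K (by simp at hj; lia), mul_zero]

@[simp] theorem schur_zero : schur K 0 = 1 := by simp [schur]

theorem succ_mul_inv_factorial [CharZero K] (j : ℕ) :
    ((j + 1).factorial : K)⁻¹ * ((j : K) + 1) = (j.factorial : K)⁻¹ := by
  have h1 : ((j : K) + 1) ≠ 0 := Nat.cast_add_one_ne_zero j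
  rw [Nat.factorial_succ, Nat.cast_mul, Nat.cast_add, Nat.cast_one, mul_inv]
  field_simp

/-- The coefficients of d/dz exp ξ = ξ' exp ξ with ξ = Σ t_i z^i. -/
theorem succ_mul_schur_succ [CharZero K] (N : ℕ) :
    ((N : MvPolynomial ℕ+ K) + 1) * schur K (N + 1) =
      ∑ i ∈ Finset.range (N + 1), ((i : MvPolynomial ℕ+ K) + 1) *
        MvPolynomial.X (Nat.succPNat i) * schur K (N - i) := by
  have hd : ∀ j : ℕ, ((N : MvPolynomial ℕ+ K) + 1) * coeff (N + 1) (schurExponent K ^ (j + 1)) =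
      ((j : MvPolynomial ℕ+ K) + 1) * ∑ i ∈ Finset.range (N + 1), ((i : MvPolynomial ℕ+ K) + 1) *
        MvPolynomial.X (Nat.succPNat i) * coeff (N - i) (schurExponent K ^ j) := fun j => by
    rw [succ_mul_coeff_pow_succ]
    simp only [coeff_schurExponent_succ]
  rw [schur, Finset.sum_range_succ', mul_add, Finset.mul_sum]
  have h0 : coeff (N + 1) (schurExponent K ^ 0) = 0 := by
    rw [pow_zero, coeff_one, if_neg (Nat.succ_ne_zero N)]
  rw [h0, mul_zero, mul_zero, add_zero]
  have h2 : ∀ i ∈ Finset.range (N + 1), schur K (N - i) = ∑ j ∈ Finset.range (N + 1),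
      MvPolynomial.C ((j.factorial : K)⁻¹) * coeff (N - i) (schurExponent K ^ j) := fun i _ =>
    schur_eq_sum_range K (by lia)
  have h3 : ∀ i ∈ Finset.range (N + 1), ((i : MvPolynomial ℕ+ K) + 1) *
        MvPolynomial.X (Nat.succPNat i) * schur K (N - i) = ∑ j ∈ Finset.range (N + 1),
      ((i : MvPolynomial ℕ+ K) + 1) * MvPolynomial.X (Nat.succPNat i) *
        (MvPolynomial.C ((j.factorial : K)⁻¹) * coeff (N - i) (schurExponent K ^ j)) :=
    fun i hi => by rw [h2 i hi, Finset.mul_sum]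
  rw [Finset.sum_congr rfl h3, Finset.sum_comm]
  refine Finset.sum_congr rfl fun j _ => ?_
  rw [mul_left_comm, hd j, Finset.mul_sum, Finset.mul_sum]
  refine Finset.sum_congr rfl fun i _ => ?_
  rw [← succ_mul_inv_factorial K j]
  simp only [map_mul, map_add, map_one, map_natCast]
  ring

@[simp] theorem schurTilde_zero : schurTilde K 0 = 1 := by simp [schurTilde]

/-- Replacing t_i by t_i / i removes the weights i, and the recursion takes the form of `IsFlow`. -/
theorem succ_mul_schurTilde_succ [CharZero K] (N : ℕ) :
    ((N : MvPolynomial ℕ+ K) + 1) * schurTilde K (N + 1) =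
      ∑ i ∈ Finset.range (N + 1), MvPolynomial.X (Nat.succPNat i) * schurTilde K (N - i) := by
  have := congrArg (MvPolynomial.bind₁
    (fun i : ℕ+ => MvPolynomial.C ((i : K)⁻¹) * (MvPolynomial.X i : MvPolynomial ℕ+ K)))
    (succ_mul_schur_succ K N)
  simp only [map_mul, map_add, map_natCast, map_one, map_sum, MvPolynomial.bind₁_X_right] at this
  rw [schurTilde, this]
  refine Finset.sum_congr rfl fun i _ => ?_
  have h1 : MvPolynomial.C (σ := ℕ+) (((Nat.succPNat i : ℕ+) : ℕ) : K)⁻¹ *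
      ((i : MvPolynomial ℕ+ K) + 1) = 1 := by
    rw [← MvPolynomial.C_eq_coe_nat, ← MvPolynomial.C_1, ← MvPolynomial.C_add, ← MvPolynomial.C_mul,
      Nat.succPNat_coe, Nat.succ_eq_add_one, Nat.cast_add, Nat.cast_one,
      inv_mul_cancel₀ (Nat.cast_add_one_ne_zero i)]
  rw [schurTilde]
  linear_combination (MvPolynomial.X (Nat.succPNat i) *
    (MvPolynomial.bind₁ fun i : ℕ+ => MvPolynomial.C ((i : K)⁻¹) * MvPolynomial.X i)
      (schur K (N - i))) * h1

/-- The coefficients of ∂/∂t_k exp ξ = z^k exp ξ, where ∂/∂t_k acts coefficientwise as `mapDer`. -/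
theorem pderiv_schur [CharZero K] (k : ℕ+) (N : ℕ) :
    MvPolynomial.pderiv k (schur K N) = if (k : ℕ) ≤ N then schur K (N - k) else 0 := by
  set δ := mapDer (MvPolynomial.pderiv (R := K) k) with hδ
  have h1 : δ (schurExponent K) = X ^ (k : ℕ) := by
    ext1 n
    rw [hδ, mapDer, coeff_mk, coeff_X_pow]
    cases n with
    | zero => simp [schurExponent, k.ne_zero.symm]
    | succ n =>
      rw [coeff_schurExponent_succ, MvPolynomial.pderiv_X, Pi.single_apply]
      simp only [← PNat.coe_inj, Nat.succPNat_coe, Nat.succ_eq_add_one]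
  have hpow : ∀ j : ℕ, δ (schurExponent K ^ (j + 1)) =
      ((j : PowerSeries (MvPolynomial ℕ+ K)) + 1) * (X ^ (k : ℕ) * schurExponent K ^ j) := by
    intro j
    induction j with
    | zero => simp [h1]
    | succ j ih =>
      rw [pow_succ, hδ, mapDer_mul, ← hδ, ih, h1]
      push_cast
      ring
  have hc : ∀ j : ℕ, MvPolynomial.pderiv k (coeff N (schurExponent K ^ (j + 1))) =
      MvPolynomial.C ((j : K) + 1) * coeff N (X ^ (k : ℕ) * schurExponent K ^ j) := fun j => by
    have := congrArg (coeff N) (hpow j)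
    rw [hδ, mapDer, coeff_mk] at this
    rw [this, ← Nat.cast_add_one, ← map_natCast (C (R := MvPolynomial ℕ+ K)), coeff_C_mul]
    simp
  rw [schur, map_sum, Finset.sum_range_succ']
  simp only [Derivation.leibniz, MvPolynomial.pderiv_C, smul_eq_mul, hc]
  have h0 : MvPolynomial.pderiv k (coeff N (schurExponent K ^ 0)) = 0 := by
    rw [pow_zero, coeff_one]
    split_ifs <;> simp
  simp only [h0, mul_zero, add_zero]
  simp only [← mul_assoc, ← MvPolynomial.C_mul, succ_mul_inv_factorial]
  simp only [coeff_X_pow_mul']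
  split_ifs with h
  · rw [schur_eq_sum_range K (by have := k.pos; lia : N - k < N)]
  · simp

end Schur

/-! ### Polynomials in commuting operators -/

section PolyOp

variable {K : Type*} [Field K] {V W : Type*} [AddCommGroup V] [Module K V] [AddCommGroup W]
  [Module K W]

/-- Transfer principle. A relation is used rather than a linear map because `apd` is not additive on
arbitrary functions and its formulas hold at convergent times only. -/
theorem polyOp_rel {D : ℕ+ → V → V} {D' : ℕ+ → W → W} (r : V → W → Prop) (h0 : r 0 0)
    (hadd : ∀ v w v' w', r v v' → r w w' → r (v + w) (v' + w'))
    (hsmul : ∀ (c : K) v v', r v v' → r (c • v) (c • v'))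
    (hD : ∀ k v v', r v v' → r (D k v) (D' k v')) (p : MvPolynomial ℕ+ K) {v : V} {w : W}
    (h : r v w) : r (polyOp D p v) (polyOp D' p w) := by
  have hiter : ∀ k n v v', r v v' → r ((D k)^[n] v) ((D' k)^[n] v') := by
    intro k n
    induction n with
    | zero => exact fun v v' h => h
    | succ n ih =>
      intro v v' h
      rw [Function.iterate_succ_apply, Function.iterate_succ_apply]
      exact ih _ _ (hD k v v' h)
  have hmono : ∀ (β : ℕ+ →₀ ℕ) (l : List ℕ+), r (l.foldr (fun k w => (D k)^[β k] w) v)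
      (l.foldr (fun k w => (D' k)^[β k] w) w) := by
    intro β l
    induction l with
    | nil => exact h
    | cons a l ih => exact hiter a (β a) _ _ ih
  unfold polyOp
  refine Finset.induction_on p.support ?_ fun β s hβ ih => ?_
  · simpa using h0
  · rw [Finset.sum_insert hβ, Finset.sum_insert hβ]
    exact hadd _ _ _ _ (hsmul _ _ _ (hmono β _)) ih

variable (D : ℕ+ → V →ₗ[K] V)

theorem polyOp_eq_sum_of_subset (p : MvPolynomial ℕ+ K) (v : V) {s : Finset (ℕ+ →₀ ℕ)}
    (h : p.support ⊆ s) :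
    polyOp (fun k => D k) p v = ∑ β ∈ s, p.coeff β • monoOp (fun k => D k) β v :=
  Finset.sum_subset h fun β _ hβ => by
    rw [MvPolynomial.notMem_support_iff.mp hβ, zero_smul]

theorem polyOp_add (p q : MvPolynomial ℕ+ K) (v : V) :
    polyOp (fun k => D k) (p + q) v = polyOp (fun k => D k) p v + polyOp (fun k => D k) q v := by
  classical
  rw [polyOp_eq_sum_of_subset D _ v MvPolynomial.support_add,
    polyOp_eq_sum_of_subset D p v Finset.subset_union_left,
    polyOp_eq_sum_of_subset D q v Finset.subset_union_right, ← Finset.sum_add_distrib]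
  simp only [MvPolynomial.coeff_add, add_smul]

theorem polyOp_monomial (β : ℕ+ →₀ ℕ) (c : K) (v : V) :
    polyOp (fun k => D k) (MvPolynomial.monomial β c) v = c • monoOp (fun k => D k) β v := by
  classical
  rw [polyOp_eq_sum_of_subset D _ v MvPolynomial.support_monomial_subset]
  simp

theorem polyOp_one (v : V) : polyOp (fun k => D k) (1 : MvPolynomial ℕ+ K) v = v := by
  have := polyOp_monomial D 0 1 v
  rw [one_smul] at this
  simpa [monoOp] using this

theorem polyOp_C_mul (c : K) (p : MvPolynomial ℕ+ K) (v : V) :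
    polyOp (fun k => D k) (MvPolynomial.C c * p) v = c • polyOp (fun k => D k) p v := by
  rw [polyOp_eq_sum_of_subset D _ v (s := p.support), polyOp, Finset.smul_sum]
  · simp only [MvPolynomial.coeff_C_mul, mul_smul]
  · rw [← MvPolynomial.smul_eq_C_mul]
    exact MvPolynomial.support_smul

theorem polyOp_sub (p q : MvPolynomial ℕ+ K) (v : V) :
    polyOp (fun k => D k) (p - q) v = polyOp (fun k => D k) p v - polyOp (fun k => D k) q v := by
  rw [sub_eq_add_neg, polyOp_add, ← neg_one_mul q, ← map_one MvPolynomial.C, ← map_neg,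
    polyOp_C_mul, neg_one_smul, sub_eq_add_neg]

theorem polyOp_sum {ι : Type*} (s : Finset ι) (p : ι → MvPolynomial ℕ+ K) (v : V) :
    polyOp (fun k => D k) (∑ i ∈ s, p i) v = ∑ i ∈ s, polyOp (fun k => D k) (p i) v := by
  classical
  induction s using Finset.induction_on with
  | empty => simp [polyOp]
  | insert a s ha ih => rw [Finset.sum_insert ha, polyOp_add, ih, Finset.sum_insert ha]

variable (hD : ∀ k l v, D k (D l v) = D l (D k v))
include hD

/-- Since the operators commute, the fold over the sorted support may be read as a fold over a
multiset, and the factor of index i moved to the front. -/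
theorem monoOp_single_add (i : ℕ+) (β : ℕ+ →₀ ℕ) (v : V) :
    monoOp (fun k => D k) (Finsupp.single i 1 + β) v = D i (monoOp (fun k => D k) β v) := by
  classical
  have hcomm : ∀ k l, Function.Commute (D k) (D l) := fun k l v => hD k l v
  have lc : ∀ β : ℕ+ →₀ ℕ, LeftCommutative (fun k w => (D k)^[β k] w) := fun β =>
    ⟨fun k l w => ((hcomm k l).iterate_iterate (β k) (β l)) w⟩
  have h1 : ∀ β : ℕ+ →₀ ℕ, monoOp (fun k => D k) β v =
      (D i)^[β i] (Multiset.foldr (fun k w => (D k)^[β k] w) v (β.support.erase i).val) := by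
    intro β
    have : monoOp (fun k => D k) β v =
        Multiset.foldr (fun k w => (D k)^[β k] w) v β.support.val := by
      conv_rhs => rw [← Finset.sort_eq (r := (· ≤ ·)) β.support]
      rw [Multiset.coe_foldr]
      rfl
    rw [this]
    by_cases hi : i ∈ β.support
    · conv_lhs => rw [← Finset.insert_erase hi, Finset.insert_val_of_notMem (Finset.notMem_erase _ _),
        Multiset.foldr_cons]
    · rw [Finset.erase_eq_of_notMem hi, Finsupp.notMem_support_iff.mp hi]
      rfl
  have h2 : (Finsupp.single i 1 + β).support.erase i = β.support.erase i := by
    ext k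
    by_cases hk : k = i
    · simp [hk]
    · simp [hk]
  rw [h1, h1, h2, Finsupp.add_apply, Finsupp.single_eq_same, add_comm 1, Function.iterate_succ_apply']
  congr 2
  have h3 : ∀ l : List ℕ+, i ∉ l → l.foldr (fun k w => (D k)^[(Finsupp.single i 1 + β : ℕ+ →₀ ℕ) k] w) v =
      l.foldr (fun k w => (D k)^[β k] w) v := by
    intro l hl
    induction l with
    | nil => rfl
    | cons a l ih =>
      simp only [List.mem_cons, not_or] at hl
      simp only [List.foldr_cons]
      rw [ih hl.2, Finsupp.add_apply, Finsupp.single_eq_of_ne (Ne.symm hl.1), zero_add]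
  rw [← Finset.sort_eq (r := (· ≤ ·)) (β.support.erase i), Multiset.coe_foldr, Multiset.coe_foldr]
  exact h3 _ (by simp)

theorem polyOp_X_mul (i : ℕ+) (p : MvPolynomial ℕ+ K) (v : V) :
    polyOp (fun k => D k) (MvPolynomial.X i * p) v = D i (polyOp (fun k => D k) p v) := by
  induction p using MvPolynomial.induction_on' with
  | add p q hp hq => rw [mul_add, polyOp_add, hp, hq, polyOp_add, map_add]
  | monomial β c =>
    rw [MvPolynomial.X, MvPolynomial.monomial_mul, one_mul, polyOp_monomial, polyOp_monomial,
      monoOp_single_add D hD, map_smul]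

/-- The operators s̃_N(D) and the sequence f obey the same recursion. For a flow f this is Taylor's
formula, f_N being the coefficient of w^N. -/
theorem polyOp_schurTilde [CharZero K] {f : ℕ → V}
    (hf : ∀ N : ℕ, ((N : K) + 1) • f (N + 1) =
      ∑ i ∈ Finset.range (N + 1), D (Nat.succPNat i) (f (N - i))) (N : ℕ) :
    polyOp (fun k => D k) (schurTilde K N) (f 0) = f N := by
  induction N using Nat.strong_induction_on with
  | _ N ih =>
    cases N with
    | zero => rw [schurTilde_zero, polyOp_one]
    | succ N =>
      have h := congrArg (fun p => polyOp (fun k => D k) p (f 0)) (succ_mul_schurTilde_succ K N)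
      simp only [polyOp_sum, polyOp_X_mul D hD] at h
      rw [← map_natCast MvPolynomial.C, ← map_one MvPolynomial.C, ← map_add, polyOp_C_mul,
        Finset.sum_congr rfl fun i _ => by rw [ih (N - i) (by lia)], ← hf N] at h
      exact smul_right_injective V (Nat.cast_add_one_ne_zero (R := K) N) h

end PolyOp

/-! ### The universal moment sequence -/

section Universal

open PowerSeries

theorem momFun_map {A B : Type*} [CommRing A] [CommRing B] [Algebra A B] (ν : ℕ → B)
    (p : Polynomial A) : momFun ν (p.map (algebraMap A B)) = momFun ν p := by
  induction p using Polynomial.induction_on' with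
  | add p q hp hq => rw [Polynomial.map_add, map_add, map_add, hp, hq]
  | monomial n a =>
    rw [← Polynomial.C_mul_X_pow_eq_monomial, Polynomial.map_mul, Polynomial.map_C,
      Polynomial.map_pow, Polynomial.map_X, momFun_C_mul_X_pow, momFun_C_mul_X_pow,
      algebraMap_smul]

theorem map_momFun {A B : Type*} [CommRing A] [CommRing B] (f : A →+* B) (μ : ℕ → A)
    (p : Polynomial A) : f (momFun μ p) = momFun (fun k => f (μ k)) (p.map f) := by
  induction p using Polynomial.induction_on' with
  | add p q hp hq => rw [Polynomial.map_add, map_add, map_add, map_add, hp, hq]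
  | monomial n a =>
    rw [← Polynomial.C_mul_X_pow_eq_monomial, Polynomial.map_mul, Polynomial.map_C,
      Polynomial.map_pow, Polynomial.map_X, momFun_C_mul_X_pow, momFun_C_mul_X_pow,
      smul_eq_mul, map_mul, smul_eq_mul]

/-- The sequence `∑_k w^k μ_{j+k}`. -/
def stieltjesSeq {A : Type*} [CommRing A] (μ : ℕ → A) (j : ℕ) : PowerSeries A :=
  PowerSeries.mk fun k => μ (j + k)

/-- The sequence `μ_j - w μ_{j+1}`. -/
def shiftDiffSeq {A : Type*} [CommRing A] (μ : ℕ → A) (j : ℕ) : PowerSeries A :=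
  C (μ j) - X * C (μ (j + 1))

section

variable {A : Type*} [CommRing A] (μ : ℕ → A)

theorem stieltjesSeq_sub (j : ℕ) :
    stieltjesSeq μ j - X * stieltjesSeq μ (j + 1) = algebraMap A (PowerSeries A) (μ j) := by
  ext n
  cases n with
  | zero => simp [stieltjesSeq]
  | succ n =>
    rw [map_sub, coeff_succ_X_mul, PowerSeries.algebraMap_apply, coeff_C,
      if_neg (Nat.succ_ne_zero n), stieltjesSeq, stieltjesSeq, coeff_mk, coeff_mk, add_right_comm,
      add_assoc, sub_self]

theorem hankel_shiftDiffSeq (n : ℕ) : hankel (shiftDiffSeq μ) n =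
    ∑ j : Fin (n + 1), C ((hankelPoly μ n).coeff j) * X ^ (n - j) := by
  have := hankel_sub_shift (fun j => C (μ j)) (X : PowerSeries A) n
  rw [← map_hankelPoly] at this
  simp only [Polynomial.coeff_map] at this
  rw [← this]
  rfl

theorem momFun_stieltjesSeq_coeff (p : Polynomial A) (N : ℕ) :
    coeff N (momFun (stieltjesSeq μ) p) = momFun μ (p * Polynomial.X ^ N) := by
  rw [momFun_mul_X_pow]
  induction p using Polynomial.induction_on' with
  | add p q hp hq => rw [map_add, map_add, map_add, hp, hq]
  | monomial n a =>
    rw [← Polynomial.C_mul_X_pow_eq_monomial, momFun_C_mul_X_pow, momFun_C_mul_X_pow, coeff_smul,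
      stieltjesSeq, coeff_mk, smul_eq_mul]

theorem hankel_stieltjesSeq_coeff (n N : ℕ) : coeff N (hankel (stieltjesSeq μ) (n + 1)) =
    momFun μ (hankelPoly μ n * Polynomial.X ^ (N + n)) := by
  have := hankel_of_sub_shift_eq _ (stieltjesSeq μ) X (stieltjesSeq_sub μ) n
  rw [← map_hankelPoly (algebraMap A (PowerSeries A)), momFun_mul_X_pow, momFun_map] at this
  rw [this, ← momFun_mul_X_pow, momFun_stieltjesSeq_coeff, mul_assoc, ← pow_add, add_comm n N]

theorem X_pow_mul_hankel_stieltjesSeq (n : ℕ) :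
    X ^ n * hankel (stieltjesSeq μ) (n + 1) = momFun (stieltjesSeq μ) (hankelPoly μ n) := by
  have := pow_mul_hankel_of_sub_shift_eq _ (stieltjesSeq μ) X (stieltjesSeq_sub μ) n
  rwa [← map_hankelPoly (algebraMap A (PowerSeries A)), momFun_map] at this

/-- The coefficient j of P_n carries w^{n-j} and is paired with the moment of Q_m X^{k+j}. Where the
remaining power of w would be negative one has k + j < m, and that moment vanishes by orthogonality
as well. -/
theorem coeff_hankel_shiftDiffSeq_mul (μ' : ℕ → A) {n m : ℕ} (hmn : m ≤ n) (k : ℕ) :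
    coeff (k + n - m) (hankel (shiftDiffSeq μ) n * hankel (stieltjesSeq μ') (m + 1)) =
      momFun μ' (Polynomial.X ^ k * hankelPoly μ n * hankelPoly μ' m) := by
  have hd := Nat.lt_succ_of_le (natDegree_hankelPoly_le μ n)
  rw [hankel_shiftDiffSeq, Finset.sum_mul, map_sum, mul_right_comm, mul_comm (Polynomial.X ^ k),
    momFun_mul, momFun_eq_sum_range _ _ hd, Finset.sum_range]
  refine Finset.sum_congr rfl fun j _ => ?_
  rw [mul_assoc, coeff_C_mul, coeff_X_pow_mul', smul_eq_mul, mul_assoc, ← pow_add]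
  congr 1
  have := j.2
  split_ifs with h
  · rw [hankel_stieltjesSeq_coeff, show k + n - m - (n - j) + m = k + j by lia]
  · rw [hankelPoly_orthogonal μ' (by lia)]

end

variable (K : Type*) [Field K]

/-- The derivation `∂/∂t_k` on polynomials in the moments. -/
def umD (k : ℕ) : Derivation K (MvPolynomial ℕ K) (MvPolynomial ℕ K) :=
  MvPolynomial.mkDerivation K fun j => MvPolynomial.X (j + k)

@[simp] theorem umD_X (k j : ℕ) : umD K k (MvPolynomial.X j) = MvPolynomial.X (j + k) :=
  MvPolynomial.mkDerivation_X K _ j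

theorem umD_comm (k l : ℕ) (f : MvPolynomial ℕ K) : umD K k (umD K l f) = umD K l (umD K k f) := by
  have : ⁅umD K k, umD K l⁆ = 0 := by
    refine MvPolynomial.derivation_ext fun j => ?_
    rw [Derivation.commutator_apply, umD_X, umD_X, umD_X, umD_X, add_right_comm, sub_self]
    rfl
  have h := congrArg (fun d : Derivation K _ _ => d f) this
  simp only [Derivation.commutator_apply] at h
  exact sub_eq_zero.mp h

/-- The Hankel determinants of the universal sequence. -/
abbrev uTau (n : ℕ) : MvPolynomial ℕ K := hankel (fun j => MvPolynomial.X j) n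

/-- The orthogonal polynomials of the universal sequence. -/
abbrev uPoly (n : ℕ) : Polynomial (MvPolynomial ℕ K) := hankelPoly (fun j => MvPolynomial.X j) n

section

variable {K} {B : Type*} [CommRing B] [Algebra K B] {D : ℕ → Derivation K B B} {μ : ℕ → B}

/-- All N + 1 terms on the right of the flow equation equal μ_{j+N+1}. -/
theorem isFlow_stieltjesSeq (h : ∀ k j, D (k + 1) (μ j) = μ (j + (k + 1))) (j : ℕ) :
    IsFlow D (stieltjesSeq μ j) := by
  intro N
  simp only [stieltjesSeq, coeff_mk, h]
  rw [Finset.sum_congr rfl fun i hi => show μ (j + (N - i) + (i + 1)) = μ (j + (N + 1)) by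
    congr 1; simp at hi; lia]
  simp

/-- Beyond first order only the coefficients of w^0 and w^1 contribute, and they cancel. -/
theorem isFlow_shiftDiffSeq (h : ∀ k j, D (k + 1) (μ j) = -μ (j + (k + 1))) (j : ℕ) :
    IsFlow D (shiftDiffSeq μ j) := by
  intro N
  have h0 : coeff 0 (shiftDiffSeq μ j) = μ j := by simp [shiftDiffSeq]
  have h1 : ∀ n, coeff (n + 1) (shiftDiffSeq μ j) = if n = 0 then -μ (j + 1) else 0 := fun n => by
    rw [shiftDiffSeq, map_sub, coeff_succ_X_mul, coeff_C, coeff_C, if_neg (Nat.succ_ne_zero n)]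
    split_ifs <;> simp
  rw [Finset.sum_range_succ, Nat.sub_self, h0, h1]
  cases N with
  | zero => simp [h]
  | succ N =>
    rw [if_neg (Nat.succ_ne_zero N), mul_zero, Finset.sum_range_succ, Finset.sum_eq_zero,
      show N + 1 - N = 0 + 1 by lia, h1]
    · rw [h, if_pos rfl, map_neg, h, show j + 1 + (N + 1) = j + (N + 1 + 1) by lia]
      ring
    · intro i hi
      rw [show N + 1 - i = (N - i) + 1 by simp at hi; lia, h1, if_neg (by simp at hi; lia), map_zero]

end

theorem aeval_hankel {A : Type*} [CommRing A] [Algebra K A] (μ : ℕ → A) (n : ℕ) :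
    MvPolynomial.aeval μ (uTau K n) = hankel μ n := by
  have := map_hankel (MvPolynomial.aeval μ : MvPolynomial ℕ K →ₐ[K] A).toRingHom
    (fun j => MvPolynomial.X j) n
  simpa using this

theorem map_aeval_hankelPoly {A : Type*} [CommRing A] [Algebra K A] (μ : ℕ → A) (n : ℕ) :
    (uPoly K n).map (MvPolynomial.aeval μ : MvPolynomial ℕ K →ₐ[K] A).toRingHom =
      hankelPoly μ n := by
  have := map_hankelPoly (MvPolynomial.aeval μ : MvPolynomial ℕ K →ₐ[K] A).toRingHom
    (fun j => MvPolynomial.X j) n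
  simpa using this

/-- The first-order term in w of τ_{n+1}(t + [w]). -/
theorem umD_one_hankel_succ (n : ℕ) : umD K 1 (uTau K (n + 1)) =
    momFun (fun j => MvPolynomial.X j) (uPoly K n * Polynomial.X ^ (n + 1)) := by
  have h := isFlow_aeval (isFlow_stieltjesSeq (D := umD K) (fun k j => umD_X K (k + 1) j)) (uTau K (n + 1)) 0
  have h2 := aeval_hankel K (stieltjesSeq (fun j => (MvPolynomial.X j : MvPolynomial ℕ K))) (n + 1)
  rw [h2, hankel_stieltjesSeq_coeff] at h
  simp only [zero_add, Nat.cast_zero, one_mul, Finset.range_one, Finset.sum_singleton, Nat.sub_self]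
    at h
  rw [add_comm 1 n, hankel_stieltjesSeq_coeff, zero_add, momFun_hankelPoly_mul_X_pow_self] at h
  exact h.symm

/-- The first-order term in w of τ_n(t - [w]), that is, the subleading coefficient of P_n. The
factor X covers n = 0. -/
theorem umD_one_hankel (n : ℕ) :
    (Polynomial.X * uPoly K n).coeff n = -umD K 1 (uTau K n) := by
  cases n with
  | zero => simp
  | succ n =>
    have h := isFlow_aeval (isFlow_shiftDiffSeq (D := fun k => -umD K k)
      (fun k j => congrArg Neg.neg (umD_X K (k + 1) j))) (uTau K (n + 1)) 0
    have h2 := aeval_hankel K (shiftDiffSeq (fun j => (MvPolynomial.X j : MvPolynomial ℕ K))) (n + 1)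
    have h3 : ∀ N, coeff N (hankel (shiftDiffSeq (fun j => (MvPolynomial.X j : MvPolynomial ℕ K)))
      (n + 1)) = ∑ j : Fin (n + 1 + 1), if N = n + 1 - j then (uPoly K (n + 1)).coeff j else 0 :=
        fun N => by
      rw [hankel_shiftDiffSeq, map_sum]
      simp only [coeff_C_mul, coeff_X_pow, mul_ite, mul_one, mul_zero]
    rw [h2] at h
    simp only [zero_add, Nat.cast_zero, one_mul, Finset.range_one, Finset.sum_singleton,
      Nat.sub_self, h3] at h
    rw [Finset.sum_eq_single (Fin.castSucc (Fin.last n)), Finset.sum_eq_single (Fin.last (n + 1))]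
      at h
    · simpa [coeff_hankelPoly_self] using h
    · intro b _ hb
      rw [if_neg]
      have := b.2
      simp [Fin.ext_iff] at hb
      lia
    · simp
    · intro b _ hb
      rw [if_neg]
      have := b.2
      simp [Fin.ext_iff] at hb
      lia
    · simp

theorem umD_momFun (k : ℕ) (p : Polynomial (MvPolynomial ℕ K)) :
    umD K k (momFun (fun j => MvPolynomial.X j) p) =
      momFun (fun j => MvPolynomial.X j) (p.sum fun j a => Polynomial.C (umD K k a) * Polynomial.X ^ j)
        + momFun (fun j => MvPolynomial.X j) (p * Polynomial.X ^ k) := by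
  induction p using Polynomial.induction_on' with
  | add p q hp hq =>
    rw [map_add, map_add, hp, hq, Polynomial.sum_add_index _ _ _ (by simp)
      (by simp [add_mul]), map_add, add_mul, map_add]
    ring
  | monomial n a =>
    rw [Polynomial.sum_monomial_index _ _ (by simp), ← Polynomial.C_mul_X_pow_eq_monomial,
      mul_assoc, ← pow_add]
    simp only [momFun_C_mul_X_pow, smul_eq_mul, Derivation.leibniz, umD_X]
    ring

/-- `τ ∂_1 ∂_k τ - ∂_1 τ ∂_k τ` as a moment. -/
theorem momFun_uPoly_mul_uPoly (n k : ℕ) :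
    momFun (fun j => MvPolynomial.X j)
        (Polynomial.X ^ k * uPoly K (n + 1) * uPoly K n) =
      uTau K (n + 1) * umD K k (umD K 1 (uTau K (n + 1))) -
        umD K k (uTau K (n + 1)) * umD K 1 (uTau K (n + 1)) := by
  set φ := momFun (A := MvPolynomial ℕ K) (fun j => (MvPolynomial.X j : MvPolynomial ℕ K)) with hφ
  set P := uPoly K (n + 1) with hP
  set Q := uPoly K n with hQ
  set PD := P.sum fun j a => Polynomial.C (umD K k a) * Polynomial.X ^ j with hPD
  have hPDc : ∀ j, PD.coeff j = umD K k (P.coeff j) := fun j => by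
    rw [hPD, Polynomial.sum_def, Polynomial.finsetSum_coeff]
    simp only [Polynomial.coeff_C_mul_X_pow]
    rw [Finset.sum_ite_eq]
    split_ifs with h
    · rfl
    · rw [Polynomial.notMem_support_iff.mp h, map_zero]
  have hsX : ∀ i, (P * Polynomial.X ^ i).sum
      (fun j a => Polynomial.C (umD K k a) * Polynomial.X ^ j) = PD * Polynomial.X ^ i := fun i => by
    rw [hPD]
    refine Polynomial.induction_on' (motive := fun p : Polynomial (MvPolynomial ℕ K) => (p * Polynomial.X ^ i).sum
      (fun j a => Polynomial.C (umD K k a) * Polynomial.X ^ j) =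
      (p.sum fun j a => Polynomial.C (umD K k a) * Polynomial.X ^ j) * Polynomial.X ^ i) P ?_ ?_
    · intro p q hp hq
      rw [add_mul, Polynomial.sum_add_index _ _ _ (by simp) (by simp [add_mul]),
        Polynomial.sum_add_index _ _ _ (by simp) (by simp [add_mul]), hp, hq, add_mul]
    · intro m a
      rw [Polynomial.monomial_mul_X_pow, Polynomial.sum_monomial_index _ _ (by simp),
        Polynomial.sum_monomial_index _ _ (by simp), mul_assoc, pow_add]
  -- The orthogonality relation φ(P X^i) = 0 is differentiated with respect to t_k; PD collects the
  -- derivatives of the coefficients of P.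
  have h1 : ∀ i ≤ n, φ (PD * Polynomial.X ^ i) = -φ (P * Polynomial.X ^ k * Polynomial.X ^ i) :=
      fun i hi => by
    have h := umD_momFun K k (P * Polynomial.X ^ i)
    rw [hP, hankelPoly_orthogonal _ (by lia : i < n + 1), map_zero, ← hP, hsX] at h
    rw [mul_right_comm]
    linear_combination -h
  have h2 : φ (PD * Q) = -φ (P * Polynomial.X ^ k * Q) := by
    have hd : Q.natDegree < n + 1 := Nat.lt_succ_of_le (natDegree_hankelPoly_le _ n)
    rw [hφ, momFun_mul, momFun_mul, momFun_eq_sum_range _ _ hd, momFun_eq_sum_range _ _ hd,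
      ← Finset.sum_neg_distrib]
    refine Finset.sum_congr rfl fun i hi => ?_
    rw [← hφ, h1 i (by simp at hi; lia), smul_neg]
  -- Q is orthogonal to powers below n, so only the two top coefficients of PD contribute; these are
  -- derivatives of τ and of -∂_1 τ.
  have h3 : φ (PD * Q) = umD K k (uTau K (n + 1)) * umD K 1 (uTau K (n + 1)) -
      umD K k (umD K 1 (uTau K (n + 1))) * uTau K (n + 1) := by
    have hd : PD.natDegree < n + 2 := by
      refine Nat.lt_succ_of_le (Polynomial.natDegree_le_iff_coeff_eq_zero.mpr fun j hj => ?_)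
      rw [hPDc, Polynomial.coeff_eq_zero_of_natDegree_lt
        ((natDegree_hankelPoly_le _ (n + 1)).trans_lt hj), map_zero]
    have hc : P.coeff n = -umD K 1 (uTau K (n + 1)) := by
      rw [← umD_one_hankel, Polynomial.coeff_X_mul]
    rw [mul_comm, hφ, momFun_mul, momFun_eq_sum_range _ _ hd, Finset.sum_range_succ,
      Finset.sum_range_succ, Finset.sum_eq_zero, hPDc, hPDc, hc, hP, coeff_hankelPoly_self,
      momFun_hankelPoly_mul_X_pow_self, ← umD_one_hankel_succ, map_neg]
    · simp only [smul_eq_mul]; ring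
    · intro i hi
      rw [hQ, hankelPoly_orthogonal _ (by simpa using hi), smul_zero]
  rw [mul_comm (Polynomial.X ^ k)]
  linear_combination h2 - h3

/-! ### The Hirota equations for the universal moment sequence -/

/-- The derivation `∂/∂y_k` on polynomials in the moments of `t + y` and those of `t - y`. -/
def hirotaD (k : ℕ) : Derivation K (MvPolynomial (ℕ ⊕ ℕ) K) (MvPolynomial (ℕ ⊕ ℕ) K) :=
  MvPolynomial.mkDerivation K
    (Sum.elim (fun j => MvPolynomial.X (Sum.inl (j + k))) fun j => -MvPolynomial.X (Sum.inr (j + k)))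

theorem hirotaD_inl (k j : ℕ) :
    hirotaD K k (MvPolynomial.X (Sum.inl j)) = MvPolynomial.X (Sum.inl (j + k)) :=
  MvPolynomial.mkDerivation_X K _ _

theorem hirotaD_inr (k j : ℕ) :
    hirotaD K k (MvPolynomial.X (Sum.inr j)) = -MvPolynomial.X (Sum.inr (j + k)) :=
  MvPolynomial.mkDerivation_X K _ _

theorem hirotaD_comm (k l : ℕ) (f : MvPolynomial (ℕ ⊕ ℕ) K) :
    hirotaD K k (hirotaD K l f) = hirotaD K l (hirotaD K k f) := by
  have : ⁅hirotaD K k, hirotaD K l⁆ = 0 := by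
    refine MvPolynomial.derivation_ext fun j => ?_
    rw [Derivation.commutator_apply]
    rcases j with j | j
    · rw [hirotaD_inl, hirotaD_inl, hirotaD_inl, hirotaD_inl, add_right_comm, sub_self]
      rfl
    · rw [hirotaD_inr, hirotaD_inr, map_neg, map_neg, hirotaD_inr, hirotaD_inr, add_right_comm,
        sub_self]
      rfl
  have h := congrArg (fun d : Derivation K _ _ => d f) this
  simp only [Derivation.commutator_apply] at h
  exact sub_eq_zero.mp h

/-- Polynomials in the moments of `t + y`. -/
def hirotaInl : MvPolynomial ℕ K →ₐ[K] MvPolynomial (ℕ ⊕ ℕ) K :=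
  MvPolynomial.aeval fun j => MvPolynomial.X (Sum.inl j)

/-- Polynomials in the moments of `t - y`. -/
def hirotaInr : MvPolynomial ℕ K →ₐ[K] MvPolynomial (ℕ ⊕ ℕ) K :=
  MvPolynomial.aeval fun j => MvPolynomial.X (Sum.inr j)

/-- The value at `y = 0`. -/
def hirotaEval : MvPolynomial (ℕ ⊕ ℕ) K →ₐ[K] MvPolynomial ℕ K :=
  MvPolynomial.aeval (Sum.elim MvPolynomial.X MvPolynomial.X)

theorem hirotaEval_inl (f : MvPolynomial ℕ K) : hirotaEval K (hirotaInl K f) = f := by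
  have : (hirotaEval K).comp (hirotaInl K) = AlgHom.id K _ := by
    ext j : 1; simp [hirotaEval, hirotaInl]
  exact DFunLike.congr_fun this f

theorem hirotaEval_inr (f : MvPolynomial ℕ K) : hirotaEval K (hirotaInr K f) = f := by
  have : (hirotaEval K).comp (hirotaInr K) = AlgHom.id K _ := by
    ext j : 1; simp [hirotaEval, hirotaInr]
  exact DFunLike.congr_fun this f

theorem hirotaD_hirotaInl (k : ℕ) (f : MvPolynomial ℕ K) :
    hirotaD K k (hirotaInl K f) = hirotaInl K (umD K k f) := by
  induction f using MvPolynomial.induction_on with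
  | C a => simp [← MvPolynomial.algebraMap_eq]
  | add p q hp hq => simp only [map_add, hp, hq]
  | mul_X p j hp =>
    have hX : ∀ j, hirotaInl K (MvPolynomial.X j) = MvPolynomial.X (Sum.inl j) := fun j =>
      MvPolynomial.aeval_X _ _
    simp only [map_mul, map_add, Derivation.leibniz, smul_eq_mul, hp, hX, hirotaD_inl, umD_X]

theorem hirotaD_hirotaInr (k : ℕ) (f : MvPolynomial ℕ K) :
    hirotaD K k (hirotaInr K f) = -hirotaInr K (umD K k f) := by
  induction f using MvPolynomial.induction_on with
  | C a => simp [← MvPolynomial.algebraMap_eq]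
  | add p q hp hq => simp only [map_add, hp, hq, neg_add]
  | mul_X p j hp =>
    have hX : ∀ j, hirotaInr K (MvPolynomial.X j) = MvPolynomial.X (Sum.inr j) := fun j =>
      MvPolynomial.aeval_X _ _
    simp only [map_mul, map_add, Derivation.leibniz, smul_eq_mul, hp, hX, hirotaD_inr, umD_X]
    ring

/-- `τ_n(t + y) τ_n(t - y)`. -/
def hirotaPair (n : ℕ) : MvPolynomial (ℕ ⊕ ℕ) K := hirotaInl K (uTau K n) * hirotaInr K (uTau K n)

/-- `τ_n(t + y + [w]) τ_n(t - y - [w])`. -/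
def hirotaShift (n : ℕ) : PowerSeries (MvPolynomial (ℕ ⊕ ℕ) K) :=
  hankel (shiftDiffSeq fun j => MvPolynomial.X (Sum.inr j)) n *
    hankel (stieltjesSeq fun j => MvPolynomial.X (Sum.inl j)) n

theorem coeff_zero_hirotaShift (n : ℕ) : coeff 0 (hirotaShift K n) = hirotaPair K n := by
  rw [hirotaShift, coeff_zero_eq_constantCoeff_apply, map_mul, map_hankel, map_hankel, hirotaPair,
    hirotaInl, hirotaInr, aeval_hankel, aeval_hankel]
  have h1 : ∀ μ : ℕ → MvPolynomial (ℕ ⊕ ℕ) K, ∀ j, constantCoeff (stieltjesSeq μ j) = μ j :=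
    fun μ j => by rw [stieltjesSeq, ← coeff_zero_eq_constantCoeff_apply, coeff_mk, add_zero]
  have h2 : ∀ μ : ℕ → MvPolynomial (ℕ ⊕ ℕ) K, ∀ j, constantCoeff (shiftDiffSeq μ j) = μ j :=
    fun μ j => by simp [shiftDiffSeq]
  simp only [h1, h2]
  rw [mul_comm]

theorem isFlow_hirotaShift (n : ℕ) : IsFlow (hirotaD K) (hirotaShift K n) := by
  have h : ∀ i : ℕ ⊕ ℕ, IsFlow (hirotaD K) ((Sum.elim
      (stieltjesSeq fun j => (MvPolynomial.X (Sum.inl j) : MvPolynomial (ℕ ⊕ ℕ) K))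
      (shiftDiffSeq fun j => (MvPolynomial.X (Sum.inr j) : MvPolynomial (ℕ ⊕ ℕ) K))) i) := by
    rintro (j | j)
    · exact isFlow_stieltjesSeq (fun k => hirotaD_inl K (k + 1)) j
    · exact isFlow_shiftDiffSeq (fun k => hirotaD_inr K (k + 1)) j
  have h2 := isFlow_aeval h (hankel (fun j => MvPolynomial.X (Sum.inr j)) n *
    hankel (fun j => MvPolynomial.X (Sum.inl j)) n)
  rw [map_mul] at h2
  have h3 : ∀ μ : ℕ → MvPolynomial (ℕ ⊕ ℕ) K, ∀ f : MvPolynomial (ℕ ⊕ ℕ) K →ₐ[K]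
    PowerSeries (MvPolynomial (ℕ ⊕ ℕ) K), f (hankel μ n) = hankel (fun k => f (μ k)) n :=
    fun μ f => map_hankel f.toRingHom μ n
  rw [h3, h3] at h2
  simpa only [MvPolynomial.aeval_X, Sum.elim_inl, Sum.elim_inr] using! h2

theorem map_hirotaShift (n : ℕ) : PowerSeries.map (hirotaEval K).toRingHom (hirotaShift K n) =
    hankel (shiftDiffSeq fun j => MvPolynomial.X j) n *
      hankel (stieltjesSeq fun j => MvPolynomial.X j) n := by
  rw [hirotaShift, map_mul, map_hankel, map_hankel]
  congr 2 <;> ext1 j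
  · simp [shiftDiffSeq, hirotaEval]
  · ext1 k
    simp [stieltjesSeq, hirotaEval]

/-- At y = 0 the coefficient is the moment of X^k P_{n+1} P_n, by the product formula for two sizes
differing by one. -/
theorem hirotaEval_coeff_hirotaShift (n k : ℕ) :
    hirotaEval K (coeff (k + 1) (hirotaShift K (n + 1))) =
      uTau K (n + 1) * umD K k (umD K 1 (uTau K (n + 1))) -
        umD K k (uTau K (n + 1)) * umD K 1 (uTau K (n + 1)) := by
  have h := congrArg (coeff (k + 1)) (map_hirotaShift K (n + 1))
  rw [coeff_map] at h
  have h2 := coeff_hankel_shiftDiffSeq_mul (fun j => (MvPolynomial.X j : MvPolynomial ℕ K))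
    (fun j => MvPolynomial.X j) (Nat.le_succ n) k
  rw [show k + n.succ - n = k + 1 by lia] at h2
  rw [← momFun_uPoly_mul_uPoly, ← h2, ← h]
  rfl

/-- The factor 2 is what the coefficient ½ in `kpPoly` compensates. -/
theorem hirotaEval_D_D (n k l : ℕ) :
    hirotaEval K (hirotaD K k (hirotaD K l (hirotaPair K n))) =
      2 * (uTau K n * umD K k (umD K l (uTau K n)) - umD K k (uTau K n) * umD K l (uTau K n)) := by
  simp only [hirotaPair, Derivation.leibniz, smul_eq_mul, map_add, map_mul, map_neg,
    hirotaD_hirotaInl, hirotaD_hirotaInr, hirotaEval_inl, hirotaEval_inr]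
  ring

/-- The KP hierarchy in Hirota form. -/
theorem hirotaEval_polyOp_kpPoly [CharZero K] (n k : ℕ) (hn : 1 ≤ n) :
    hirotaEval K (polyOp (fun i : ℕ+ => hirotaD K i) (kpPoly K k) (hirotaPair K n)) = 0 := by
  obtain ⟨n, rfl⟩ := Nat.exists_eq_add_of_le' hn
  set D : ℕ+ → MvPolynomial (ℕ ⊕ ℕ) K →ₗ[K] MvPolynomial (ℕ ⊕ ℕ) K :=
    fun i => (hirotaD K i).toLinearMap with hD
  have hcomm : ∀ k l v, D k (D l v) = D l (D k v) := fun k l v => hirotaD_comm K k l v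
  -- Taylor's formula for the flow y ↦ y + [w] starting from τ(t + y) τ(t - y).
  have hs : polyOp (fun i : ℕ+ => D i) (schurTilde K (k + 4)) (hirotaPair K (n + 1)) =
      coeff (k + 4) (hirotaShift K (n + 1)) := by
    rw [← coeff_zero_hirotaShift]
    refine polyOp_schurTilde D hcomm (f := fun N => coeff N (hirotaShift K (n + 1))) (fun N => ?_) _
    have := isFlow_hirotaShift K (n + 1) N
    rw [Algebra.smul_def, map_add, map_natCast, map_one]
    exact this
  have h : polyOp (fun i : ℕ+ => D i) (kpPoly K k) (hirotaPair K (n + 1)) =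
      coeff (k + 4) (hirotaShift K (n + 1)) -
        (2⁻¹ : K) • D 1 (D (Nat.succPNat (k + 2)) (hirotaPair K (n + 1))) := by
    rw [kpPoly, polyOp_sub, hs, mul_assoc, polyOp_C_mul, polyOp_X_mul D hcomm,
      ← mul_one (MvPolynomial.X (Nat.succPNat (k + 2))), polyOp_X_mul D hcomm, polyOp_one]
  have h2 := hirotaEval_coeff_hirotaShift K n (k + 3)
  have h3 := hirotaEval_D_D K (n + 1) 1 (k + 3)
  change hirotaEval K (polyOp (fun i : ℕ+ => D i) _ _) = 0
  rw [h, map_sub, map_smul]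
  have h4 : hirotaEval K (D 1 (D (Nat.succPNat (k + 2)) (hirotaPair K (n + 1)))) = (2 : K) •
      (uTau K (n + 1) * umD K 1 (umD K (k + 3) (uTau K (n + 1))) -
        umD K 1 (uTau K (n + 1)) * umD K (k + 3) (uTau K (n + 1))) := by
    rw [Algebra.smul_def, map_ofNat, ← h3]
    rfl
  rw [h4, inv_smul_smul₀ two_ne_zero, h2, umD_comm K (k + 3) 1]
  ring

/-- The bilinear form of the KP equation. -/
theorem kp_bilinear [CharZero K] (n : ℕ) (hn : 1 ≤ n) :
    let T := uTau K n
    let D := umD K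
    T * D 1 (D 1 (D 1 (D 1 T))) - 4 * D 1 T * D 1 (D 1 (D 1 T)) + 3 * D 1 (D 1 T) ^ 2 +
      3 * (T * D 2 (D 2 T) - D 2 T ^ 2) - 4 * (T * D 1 (D 3 T) - D 1 T * D 3 T) = 0 := by
  intro T D
  obtain ⟨n, rfl⟩ := Nat.exists_eq_add_of_le' hn
  have e0 := coeff_zero_hirotaShift K (n + 1)
  have e1 := isFlow_hirotaShift K (n + 1) 0
  have e2 := isFlow_hirotaShift K (n + 1) 1
  have e3 := isFlow_hirotaShift K (n + 1) 2
  have e4 := isFlow_hirotaShift K (n + 1) 3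
  simp only [Finset.sum_range_succ, Finset.range_zero, Finset.sum_empty, zero_add, Nat.sub_self,
    Nat.reduceAdd, Nat.reduceSub, Nat.cast_zero, Nat.cast_one, Nat.cast_ofNat, one_mul, tsub_zero,
    e0] at e1 e2 e3 e4
  set v := hirotaPair K (n + 1) with hv
  have f2 : 2 * coeff 2 (hirotaShift K (n + 1)) = hirotaD K 1 (hirotaD K 1 v) + hirotaD K 2 v := by
    linear_combination e2 + congrArg (hirotaD K 1) e1
  have two : ∀ k x, hirotaD K k (2 * x) = 2 * hirotaD K k x := fun k x => by
    rw [two_mul, map_add, two_mul]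
  have three : ∀ k x, hirotaD K k (3 * x) = 3 * hirotaD K k x := fun k x => by
    rw [show (3 : MvPolynomial (ℕ ⊕ ℕ) K) * x = x + x + x by ring, map_add, map_add]; ring
  have f3 : 6 * coeff 3 (hirotaShift K (n + 1)) = hirotaD K 1 (hirotaD K 1 (hirotaD K 1 v)) +
      hirotaD K 1 (hirotaD K 2 v) + 2 * hirotaD K 2 (hirotaD K 1 v) + 2 * hirotaD K 3 v := by
    have := congrArg (hirotaD K 1) f2
    rw [two, map_add] at this
    rw [e1] at e3
    linear_combination 2 * e3 + this
  -- The right-hand side is 24 s̃_4(D). At y = 0 its terms with an odd number of derivatives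
  -- disappear, because the pair is even in y.
  have f4 : 24 * coeff 4 (hirotaShift K (n + 1)) =
      hirotaD K 1 (hirotaD K 1 (hirotaD K 1 (hirotaD K 1 v))) +
      6 * hirotaD K 1 (hirotaD K 1 (hirotaD K 2 v)) + 3 * hirotaD K 2 (hirotaD K 2 v) +
      8 * hirotaD K 1 (hirotaD K 3 v) + 6 * hirotaD K 4 v := by
    have g2 := congrArg (hirotaD K 2) f2
    have g3 := congrArg (hirotaD K 1) f3
    rw [two, map_add] at g2
    rw [show (6 : MvPolynomial (ℕ ⊕ ℕ) K) * coeff 3 (hirotaShift K (n + 1)) =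
      2 * (3 * coeff 3 (hirotaShift K (n + 1))) by ring, two, three, map_add, map_add, map_add, two,
      two] at g3
    rw [e1] at e4
    rw [hirotaD_comm K 2 1, hirotaD_comm K 2 1] at g2
    rw [hirotaD_comm K 2 1] at g3
    rw [hirotaD_comm K 3 1] at e4
    linear_combination 6 * e4 + 3 * g2 + g3
  have h := congrArg (hirotaEval K) f4
  have h1 := hirotaEval_coeff_hirotaShift K n 3
  simp only [map_mul, map_add, map_ofNat] at h
  rw [show 3 + 1 = 4 from rfl] at h1
  rw [h1] at h
  simp only [hv, hirotaPair, Derivation.leibniz, smul_eq_mul, map_add, map_mul, map_neg,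
    hirotaD_hirotaInl, hirotaD_hirotaInr, hirotaEval_inl, hirotaEval_inr, umD_comm K 3 1] at h
  have h2 : (2 : MvPolynomial ℕ K) ≠ 0 := two_ne_zero
  refine mul_left_cancel₀ h2 ?_
  linear_combination -h

/-- The numerator of `∂_k (a / τ^p)`, with denominator `τ^(p+1)`. -/
def quotD (T : MvPolynomial ℕ K) (k p : ℕ) (a : MvPolynomial ℕ K) : MvPolynomial ℕ K :=
  umD K k a * T - p * a * umD K k T

/-- The numerator of the KP equation for `log τ_n`. -/
theorem kp_numerator [CharZero K] (n : ℕ) (hn : 1 ≤ n) :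
    let T := uTau K n
    let D := umD K
    quotD K T 1 3 (quotD K T 1 2 (quotD K T 1 1 (D 1 T))) + 3 * quotD K T 2 1 (D 2 T) * T ^ 2 -
      4 * quotD K T 1 1 (D 3 T) * T ^ 2 + 6 * quotD K T 1 1 (D 1 T) ^ 2 = 0 := by
  intro T D
  have h := kp_bilinear K n hn
  simp only at h
  have d1 : ∀ k, umD K k 1 = 0 := fun k => (umD K k).map_one_eq_zero
  have d2 : ∀ k, umD K k 2 = 0 := fun k => by
    simpa using (umD K k).map_natCast 2
  simp only [quotD, map_sub, map_add, Derivation.leibniz, smul_eq_mul,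
    Nat.cast_one, Nat.cast_ofNat, T, D, d1, d2, mul_zero, add_zero]
  -- Over the common denominator τ⁴ the logarithmic equation is τ² times the bilinear one.
  linear_combination (uTau K n) ^ 2 * h

end Universal

/-! ### Hankel determinants of moments -/

section Andreief

open Equiv

/-- Substituting σπ for σ shows that every π contributes the same determinant. -/
theorem sum_perm_prod_eq_hankel {A : Type*} [CommRing A] (μ : ℕ → A) (n : ℕ) :
    ∑ σ : Perm (Fin n), ∑ π : Perm (Fin n), ((Perm.sign σ : ℤ) : A) * ((Perm.sign π : ℤ) : A) *
      ∏ k, μ (σ k + π k) = (n.factorial : A) * hankel μ n := by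
  have h : ∀ π : Perm (Fin n), ∑ σ : Perm (Fin n), ((Perm.sign σ : ℤ) : A) *
      ((Perm.sign π : ℤ) : A) * ∏ k, μ (σ k + π k) = hankel μ n := fun π => by
    rw [hankel, Matrix.det_apply', ← Equiv.sum_comp (Equiv.mulRight π)]
    refine Finset.sum_congr rfl fun σ _ => ?_
    have hs : ((Perm.sign (σ * π) : ℤ) : A) * ((Perm.sign π : ℤ) : A) =
        ((Perm.sign σ : ℤ) : A) := by
      rw [← Int.cast_mul, ← Units.val_mul, Perm.sign_mul, mul_assoc, Int.units_mul_self, mul_one]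
    have hp := Equiv.prod_comp π (fun i => hankelMat μ n (σ i) i)
    rw [← hs, ← hp]
    rfl
  rw [Finset.sum_comm, Finset.sum_congr rfl fun π _ => h π, Finset.sum_const, Finset.card_univ,
    Fintype.card_perm, Fintype.card_fin, nsmul_eq_mul]

theorem vandermondeSq_eq {n : ℕ} (x : Fin n → ℝ) : vandermondeSq x =
    ∑ σ : Perm (Fin n), ∑ π : Perm (Fin n), ((Perm.sign σ : ℤ) : ℝ) * ((Perm.sign π : ℤ) : ℝ) *
      ∏ k, x k ^ ((σ k : ℕ) + π k) := by
  have h : vandermondeSq x = (Matrix.vandermonde x).transpose.det ^ 2 := by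
    rw [Matrix.det_transpose, Matrix.det_vandermonde, vandermondeSq, ← Finset.prod_pow,
      ← Finset.prod_pow]
    refine Finset.prod_congr rfl fun i _ => ?_
    rw [← Finset.prod_pow, ← Finset.prod_pow]
    exact Finset.prod_congr rfl fun j _ => by ring
  rw [h, sq, Matrix.det_apply', Finset.sum_mul_sum]
  refine Finset.sum_congr rfl fun σ _ => Finset.sum_congr rfl fun π _ => ?_
  simp only [Matrix.transpose_apply, Matrix.vandermonde_apply, pow_add, Finset.prod_mul_distrib]
  ring

variable {𝕜 : Type*} [RCLike 𝕜] {E : Set ℝ} {n : ℕ} {g : Fin n → ℝ → 𝕜}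

theorem volume_restrict_univ_pi (E : Set ℝ) (n : ℕ) :
    (volume : Measure (Fin n → ℝ)).restrict (Set.univ.pi fun _ => E) =
      Measure.pi fun _ => volume.restrict E := by
  rw [volume_pi, Measure.restrict_pi_pi]

/-- The factors may depend on k: extracting a coefficient from a product of exponentials gives each
variable its own share of the exponent. -/
theorem vandermondeSq_mul_prod (x : Fin n → ℝ) : (vandermondeSq x : 𝕜) * ∏ k, g k (x k) =
    ∑ σ : Perm (Fin n), ∑ π : Perm (Fin n), ((Perm.sign σ : ℤ) : 𝕜) * ((Perm.sign π : ℤ) : 𝕜) *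
      ∏ k, ((x k : ℝ) : 𝕜) ^ ((σ k : ℕ) + π k) * g k (x k) := by
  rw [vandermondeSq_eq]
  push_cast
  simp only [Finset.sum_mul, mul_assoc, Finset.prod_mul_distrib]

variable (hg : ∀ k (j : ℕ), IntegrableOn (fun u : ℝ => (u : 𝕜) ^ j * g k u) E)
include hg

theorem integrable_prod_pow_mul (σ π : Perm (Fin n)) :
    Integrable (fun x : Fin n → ℝ => ((Perm.sign σ : ℤ) : 𝕜) * ((Perm.sign π : ℤ) : 𝕜) *
      ∏ k, ((x k : ℝ) : 𝕜) ^ ((σ k : ℕ) + π k) * g k (x k))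
        (Measure.pi fun _ => volume.restrict E) :=
  Integrable.const_mul (Integrable.fintype_prod
    (f := fun k (u : ℝ) => (u : 𝕜) ^ ((σ k : ℕ) + π k) * g k u) fun k => hg k _) _

theorem integrableOn_vandermondeSq_mul_prod :
    IntegrableOn (fun x : Fin n → ℝ => (vandermondeSq x : 𝕜) * ∏ k, g k (x k))
      (Set.univ.pi fun _ => E) := by
  simp only [IntegrableOn, vandermondeSq_mul_prod, volume_restrict_univ_pi]
  exact integrable_finsetSum _ fun σ _ => integrable_finsetSum _ fun π _ =>
    integrable_prod_pow_mul hg σ π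

/-- Andréief's identity. -/
theorem integral_vandermondeSq_mul_prod :
    ∫ x in Set.univ.pi fun _ : Fin n => E, (vandermondeSq x : 𝕜) * ∏ k, g k (x k) =
      ∑ σ : Perm (Fin n), ∑ π : Perm (Fin n), ((Perm.sign σ : ℤ) : 𝕜) *
        ((Perm.sign π : ℤ) : 𝕜) * ∏ k, ∫ u in E, (u : 𝕜) ^ ((σ k : ℕ) + π k) * g k u := by
  simp only [vandermondeSq_mul_prod, volume_restrict_univ_pi]
  rw [integral_finsetSum _ fun σ _ => integrable_finsetSum _ fun π _ =>
    integrable_prod_pow_mul hg σ π]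
  refine Finset.sum_congr rfl fun σ _ => ?_
  rw [integral_finsetSum _ fun π _ => integrable_prod_pow_mul hg σ π]
  refine Finset.sum_congr rfl fun π _ => ?_
  rw [integral_const_mul]
  congr 1
  exact integral_fintype_prod_eq_prod
    (fun k (u : ℝ) => (u : 𝕜) ^ ((σ k : ℕ) + π k) * g k u)

end Andreief

/-! ### Positivity of the Hankel determinants of a weight. -/

section Positivity

open Polynomial

/-- A non-zero polynomial vanishes only on a finite set, which is null, so ρ would be zero almost
everywhere on E. -/
theorem IsWeight.ae_of_integral_eq_zero {E : Set ℝ} {ρ : ℝ → ℝ} (hρ : IsWeight E ρ) (p : ℝ[X])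
    (h : ∫ u in E, p.eval u ^ 2 * ρ u = 0) (hi : IntegrableOn (fun u => p.eval u ^ 2 * ρ u) E) :
    p = 0 := by
  by_contra hp
  rw [setIntegral_eq_zero_iff_of_nonneg_ae] at h
  · have h0 : ∀ᵐ u ∂(volume.restrict E), u ∉ (p.roots.toFinset : Set ℝ) :=
      ae_restrict_of_ae ((Finset.finite_toSet _).countable.ae_notMem _)
    have h1 : ∀ᵐ u ∂(volume.restrict E), ρ u = 0 := by
      filter_upwards [h, h0] with u hu hu0
      have : p.eval u ≠ 0 := fun h2 => hu0 (by simpa [hp] using h2)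
      simpa [this] using hu
    have h2 := integral_congr_ae h1
    have := hρ.pos
    simp [h2] at this
  · filter_upwards [ae_restrict_mem hρ.meas] with u hu
    exact mul_nonneg (sq_nonneg _) (hρ.nonneg u hu)
  · exact hi

/-- The quadratic form of the Hankel matrix is ∫ p² ρ, p having the vector as its coefficients; it
is therefore positive definite. -/
theorem IsWeight.hankel_pos {E : Set ℝ} {ρ : ℝ → ℝ} (hρ : IsWeight E ρ) (n : ℕ) :
    0 < hankel (fun j => ∫ u in E, u ^ j * ρ u) n := by
  refine Matrix.PosDef.det_pos (Matrix.PosDef.of_dotProduct_mulVec_pos ?_ fun x hx => ?_)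
  · ext i j
    simp [hankelMat, add_comm]
  · set p : ℝ[X] := ∑ i, C (x i) * X ^ (i : ℕ) with hp
    have he : ∀ u, p.eval u ^ 2 * ρ u = ∑ i, ∑ j, x i * x j * (u ^ ((i : ℕ) + j) * ρ u) := by
      intro u
      simp only [hp, eval_finsetSum, eval_mul, eval_C, eval_pow, eval_X]
      rw [sq, Finset.sum_mul_sum, Finset.sum_mul]
      refine Finset.sum_congr rfl fun i _ => ?_
      rw [Finset.sum_mul]
      exact Finset.sum_congr rfl fun j _ => by ring
    have hI : ∀ i j : Fin n, IntegrableOn (fun u => x i * x j * (u ^ ((i : ℕ) + j) * ρ u)) E :=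
      fun i j => (hρ.moments _).const_mul _
    have hi : IntegrableOn (fun u => p.eval u ^ 2 * ρ u) E := by
      simp only [he]
      exact integrable_finsetSum _ fun i _ => integrable_finsetSum _ fun j _ => hI i j
    have hint : star x ⬝ᵥ (hankelMat (fun j => ∫ u in E, u ^ j * ρ u) n).mulVec x =
        ∫ u in E, p.eval u ^ 2 * ρ u := by
      simp only [he]
      rw [integral_finsetSum _ fun i _ => integrable_finsetSum _ fun j _ => hI i j]
      simp only [dotProduct, Matrix.mulVec, hankelMat, Matrix.of_apply]
      refine Finset.sum_congr rfl fun i _ => ?_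
      rw [integral_finsetSum _ fun j _ => hI i j, Finset.mul_sum]
      refine Finset.sum_congr rfl fun j _ => ?_
      rw [integral_const_mul]
      simp
      ring
    have hp0 : p ≠ 0 := fun h => hx <| by
      ext i
      have := congrArg (fun q => q.coeff i) h
      simpa [hp, finsetSum_coeff, coeff_C_mul, coeff_X_pow, Fin.val_inj] using this
    rw [hint]
    refine lt_of_le_of_ne ?_ fun h => hp0 (hρ.ae_of_integral_eq_zero p h.symm hi)
    exact setIntegral_nonneg hρ.meas fun u hu => mul_nonneg (sq_nonneg _) (hρ.nonneg u hu)

end Positivity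

/-! ### Substitutions and derivations of formal power series -/

section FinitelyDetermined

open MvPowerSeries

variable {σ τ υ R : Type*} [CommRing R]

/-- Every coefficient of the image depends on finitely many coefficients only. -/
def FinitelyDetermined (φ : MvPowerSeries σ R →ₗ[R] MvPowerSeries τ R) : Prop :=
  ∀ e, ∃ s : Finset (σ →₀ ℕ), ∀ f, (∀ d ∈ s, coeff d f = 0) → coeff e (φ f) = 0

namespace FinitelyDetermined

variable {φ ψ : MvPowerSeries σ R →ₗ[R] MvPowerSeries τ R}

theorem sub (hφ : FinitelyDetermined φ) (hψ : FinitelyDetermined ψ) :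
    FinitelyDetermined (φ - ψ) := fun e => by
  classical
  obtain ⟨s, hs⟩ := hφ e
  obtain ⟨t, ht⟩ := hψ e
  refine ⟨s ∪ t, fun f hf => ?_⟩
  rw [LinearMap.sub_apply, map_sub, hs f fun d hd => hf d (Finset.mem_union_left _ hd),
    ht f fun d hd => hf d (Finset.mem_union_right _ hd), sub_zero]

theorem sum {ι : Type*} (I : Finset ι) {φ : ι → MvPowerSeries σ R →ₗ[R] MvPowerSeries τ R}
    (hφ : ∀ i ∈ I, FinitelyDetermined (φ i)) : FinitelyDetermined (∑ i ∈ I, φ i) := fun e => by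
  classical
  choose! s hs using fun i hi => hφ i hi e
  refine ⟨I.biUnion s, fun f hf => ?_⟩
  rw [LinearMap.sum_apply, map_sum]
  exact Finset.sum_eq_zero fun i hi =>
    hs i hi f fun d hd => hf d (Finset.mem_biUnion.mpr ⟨i, hi, hd⟩)

theorem comp {χ : MvPowerSeries τ R →ₗ[R] MvPowerSeries υ R} (hχ : FinitelyDetermined χ)
    (hφ : FinitelyDetermined φ) : FinitelyDetermined (χ ∘ₗ φ) := fun e => by
  classical
  obtain ⟨s, hs⟩ := hχ e
  choose t ht using hφ
  exact ⟨s.biUnion t, fun f hf => hs _ fun d hd =>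
    ht d f fun c hc => hf c (Finset.mem_biUnion.mpr ⟨d, hd, hc⟩)⟩

/-- A density argument without topology: for each coefficient of the image, f is replaced by a
polynomial agreeing with it on the finitely many exponents that matter. -/
theorem ext (hφ : FinitelyDetermined φ) (hψ : FinitelyDetermined ψ)
    (h : ∀ p : MvPolynomial σ R, φ p = ψ p) (f : MvPowerSeries σ R) : φ f = ψ f := by
  classical
  rw [← sub_eq_zero, ← LinearMap.sub_apply]
  ext e
  obtain ⟨s, hs⟩ := hφ.sub hψ e
  let p : MvPolynomial σ R := ∑ d ∈ s, MvPolynomial.monomial d (coeff d f)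
  have hp : ∀ d ∈ s, coeff d (f - (p : MvPowerSeries σ R)) = 0 := fun d hd => by
    rw [map_sub, MvPolynomial.coeff_coe]
    simp [p, MvPolynomial.coeff_sum, MvPolynomial.coeff_monomial, hd]
  have h2 := hs _ hp
  rwa [map_sub, map_sub, LinearMap.sub_apply _ _ (p : MvPowerSeries σ R), h, sub_self, map_zero,
    sub_zero] at h2

end FinitelyDetermined

theorem finitelyDetermined_id :
    FinitelyDetermined (LinearMap.id : MvPowerSeries σ R →ₗ[R] MvPowerSeries σ R) :=
  fun e => ⟨{e}, fun _ hf => hf e (Finset.mem_singleton_self e)⟩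

theorem finitelyDetermined_smul (c : R) :
    FinitelyDetermined (c • LinearMap.id : MvPowerSeries σ R →ₗ[R] MvPowerSeries σ R) :=
  fun e => ⟨{e}, fun f hf => by simp [hf e (Finset.mem_singleton_self e)]⟩

theorem finitelyDetermined_mulLeft (a : MvPowerSeries σ R) :
    FinitelyDetermined (LinearMap.mulLeft R a) := fun e => by
  classical
  refine ⟨(Finset.HasAntidiagonal.antidiagonal e).image Prod.snd, fun f hf => ?_⟩
  rw [LinearMap.mulLeft_apply, coeff_mul]
  exact Finset.sum_eq_zero fun x hx => by
    rw [hf _ (Finset.mem_image_of_mem _ hx), mul_zero]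

theorem finitelyDetermined_pderiv (k : σ) :
    FinitelyDetermined (pderiv R k).toLinearMap := fun e =>
  ⟨{e + Finsupp.single k 1}, fun f hf => by
    change coeff e (pderiv R k f) = 0
    rw [coeff_pderiv, hf _ (Finset.mem_singleton_self _), zero_mul]⟩

theorem finitelyDetermined_subst {a : σ → MvPowerSeries τ R} (ha : HasSubst a) :
    FinitelyDetermined (substAlgHom (R := R) ha).toLinearMap := fun e => by
  have h : {d : σ →₀ ℕ | coeff e (d.prod fun s e => a s ^ e) ≠ 0}.Finite := by
    refine (coeff_subst_finite (R := R) ha (fun _ => 1) e).subset fun d hd => ?_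
    change (1 : R) • coeff e (d.prod fun s e => a s ^ e) ≠ 0
    rwa [one_smul]
  refine ⟨h.toFinset, fun f hf => ?_⟩
  rw [AlgHom.toLinearMap_apply, substAlgHom_apply, coeff_subst ha]
  refine finsum_eq_zero_of_forall_eq_zero fun d => ?_
  by_cases hd : d ∈ h.toFinset
  · rw [hf d hd, zero_smul]
  · rw [Set.Finite.mem_toFinset, Set.mem_ofPred_eq, not_not] at hd
    rw [hd, smul_zero]

/-- The chain rule when a single substituted series is moved by D. It is checked on polynomials and
extended by finite determination. -/
theorem derivation_subst {a : σ → MvPowerSeries τ R} (ha : HasSubst a)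
    (D : Derivation R (MvPowerSeries τ R) (MvPowerSeries τ R))
    (hD : FinitelyDetermined D.toLinearMap) (k : σ) (h : ∀ j, j ≠ k → D (a j) = 0)
    (f : MvPowerSeries σ R) : D (subst a f) = D (a k) * subst a (pderiv R k f) := by
  have h2 := FinitelyDetermined.ext (hD.comp (finitelyDetermined_subst ha))
    ((finitelyDetermined_mulLeft (D (a k))).comp
      ((finitelyDetermined_subst ha).comp (finitelyDetermined_pderiv k))) (fun p => ?_) f
  · simp only [LinearMap.comp_apply, AlgHom.toLinearMap_apply, substAlgHom_apply] at h2
    exact h2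
  · change D (substAlgHom ha (p : MvPowerSeries σ R)) =
      D (a k) * substAlgHom ha (pderiv R k (p : MvPowerSeries σ R))
    rw [pderiv_coe, substAlgHom_coe, substAlgHom_coe]
    induction p using MvPolynomial.induction_on with
    | C r => simp
    | add p q hp hq => simp only [map_add, hp, hq, mul_add]
    | mul_X p i hp =>
      simp only [map_mul, MvPolynomial.aeval_X, Derivation.leibniz, hp, smul_eq_mul, map_add]
      by_cases hi : i = k
      · subst hi
        simp only [MvPolynomial.pderiv_X_self, map_one]
        ring
      · rw [h i hi, MvPolynomial.pderiv_X_of_ne hi]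
        simp only [map_zero]
        ring

theorem pderiv_subst {a : σ → MvPowerSeries τ R} (ha : HasSubst a) (l : τ) (k : σ)
    (h : ∀ j, j ≠ k → pderiv R l (a j) = 0) (f : MvPowerSeries σ R) :
    pderiv R l (subst a f) = pderiv R l (a k) * subst a (pderiv R k f) :=
  derivation_subst ha _ (finitelyDetermined_pderiv l) k h f

theorem pderiv_powerSeries_subst {a : MvPowerSeries τ R} (ha : PowerSeries.HasSubst a) (l : τ)
    (f : PowerSeries R) : pderiv R l (PowerSeries.subst a f) =
      pderiv R l a * PowerSeries.subst a (PowerSeries.derivative R f) :=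
  pderiv_subst (a := fun _ : Unit => a) ha.const l () (fun _ hj => (hj rfl).elim) f

theorem hasSubst_X_comp {g : σ → τ} (hg : Function.Injective g) :
    HasSubst fun i => (X (g i) : MvPowerSeries τ R) where
  const_coeff i := by simp
  coeff_zero d := by
    classical
    refine Set.Subsingleton.finite fun i hi j hj => ?_
    simp only [coeff_X, ne_eq, ite_eq_right_iff, Classical.not_imp, Set.mem_ofPred_eq] at hi hj
    have h := hi.1.symm.trans hj.1
    exact hg (Finsupp.single_left_injective one_ne_zero h)

theorem pderiv_comm (k l : σ) (f : MvPowerSeries σ R) :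
    pderiv R k (pderiv R l f) = pderiv R l (pderiv R k f) := by
  classical
  ext e
  simp only [coeff_pderiv]
  rw [add_right_comm]
  by_cases h : k = l
  · rw [h]
  · simp [h, Ne.symm h]
    ring

/-- The square root of a power series with positive constant coefficient. -/
theorem exists_sq_eq (f : MvPowerSeries σ ℝ) (hf : 0 < constantCoeff f) :
    ∃ g : MvPowerSeries σ ℝ, 0 < constantCoeff g ∧ g ^ 2 = f := by
  set c := constantCoeff f with hc
  set a : MvPowerSeries σ ℝ := C c⁻¹ * f - 1 with hadef
  have ha0 : constantCoeff a = 0 := by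
    simp [hadef, ← hc, hf.ne']
  have ha : PowerSeries.HasSubst a := PowerSeries.HasSubst.of_constantCoeff_zero ha0
  -- The root of f is √c times (1 + X)^{1/2} evaluated at X = f/c - 1.
  have hb : (PowerSeries.binomialSeries ℝ (2⁻¹ : ℝ)) ^ 2 = 1 + PowerSeries.X := by
    rw [sq, ← PowerSeries.binomialSeries_add, show (2⁻¹ : ℝ) + 2⁻¹ = ((1 : ℕ) : ℝ) by norm_num,
      PowerSeries.binomialSeries_nat, pow_one]
  refine ⟨C (Real.sqrt c) * PowerSeries.subst a (PowerSeries.binomialSeries ℝ (2⁻¹ : ℝ)), ?_, ?_⟩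
  · rw [map_mul, constantCoeff_C]
    refine mul_pos (Real.sqrt_pos.mpr hf) ?_
    rw [PowerSeries.constantCoeff_subst ha, finsum_eq_single _ 0]
    · simp
    · intro d hd
      rw [map_pow, ha0, zero_pow hd, smul_zero]
  · have h2 := congrArg (PowerSeries.subst a) hb
    rw [PowerSeries.subst_pow ha, PowerSeries.subst_add ha, PowerSeries.subst_X ha,
      ← PowerSeries.coe_substAlgHom ha, map_one] at h2
    rw [mul_pow, ← PowerSeries.coe_substAlgHom ha, h2, ← map_pow, Real.sq_sqrt hf.le, hadef,
      add_sub_cancel, ← mul_assoc, ← map_mul, mul_inv_cancel₀ hf.ne', map_one, one_mul]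

end FinitelyDetermined

/-! ### Formal moments -/

section FormalMoments

open MvPowerSeries

theorem coeff_fexp (α : ℕ+ →₀ ℕ) (u : ℝ) : coeff α (fexp u) =
    (α.prod fun _ a => (a.factorial : ℝ))⁻¹ * u ^ (α.sum fun i a => (i : ℕ) * a) := by
  change (α.prod fun i a => (u ^ (i : ℕ)) ^ a / (a.factorial : ℝ)) = _
  simp only [Finsupp.prod, Finsupp.sum, Finset.prod_div_distrib, ← pow_mul, Finset.prod_pow_eq_pow_sum]
  rw [div_eq_inv_mul]

theorem prod_factorial_add_single (α : ℕ+ →₀ ℕ) (k : ℕ+) :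
    ((α + Finsupp.single k 1).prod fun _ a => (a.factorial : ℝ)) =
      (α k + 1) * α.prod fun _ a => (a.factorial : ℝ) := by
  classical
  have h : ∀ β : ℕ+ →₀ ℕ, β.support ⊆ insert k α.support → (β.prod fun _ a => (a.factorial : ℝ)) =
      (β k).factorial * ∏ i ∈ (insert k α.support).erase k, ((β i).factorial : ℝ) := fun β hβ => by
    rw [Finset.mul_prod_erase _ (fun i => ((β i).factorial : ℝ)) (Finset.mem_insert_self _ _),
      Finsupp.prod_of_support_subset _ hβ _ (by simp)]
  rw [h α (Finset.subset_insert _ _), h (α + Finsupp.single k 1), ← mul_assoc]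
  · congr 1
    · simp [Nat.factorial_succ]
    · refine Finset.prod_congr rfl fun i hi => ?_
      simp [(Finset.ne_of_mem_erase hi).symm]
  · intro i hi
    by_cases h : i = k
    · simp [h]
    · simpa [h, Ne.symm h] using hi

theorem sum_weight_add_single (α : ℕ+ →₀ ℕ) (k : ℕ+) :
    ((α + Finsupp.single k 1).sum fun i a => (i : ℕ) * a) =
      (α.sum fun i a => (i : ℕ) * a) + k := by
  rw [Finsupp.sum_add_index' (by simp) (fun _ _ _ => mul_add _ _ _)]
  simp

/-- The formal moments `∫ u^j ρ_t(u) du`. -/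
def fmu (E : Set ℝ) (ρ : ℝ → ℝ) (j : ℕ) : FSeries := fmom E ρ 0 j

variable {E : Set ℝ} {ρ : ℝ → ℝ}

theorem coeff_fmom (i j : ℕ) (α : ℕ+ →₀ ℕ) : coeff α (fmom E ρ i j) =
    ∫ u in E, u ^ (i + j) * coeff α (fexp u) * ρ u := by
  simp only [pow_add, ← coeff_C_mul]
  rfl

theorem fmom_eq (i j : ℕ) : fmom E ρ i j = fmu E ρ (i + j) := by
  ext α
  rw [fmu, coeff_fmom, coeff_fmom, zero_add]

theorem coeff_fmu (j : ℕ) (α : ℕ+ →₀ ℕ) : coeff α (fmu E ρ j) =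
    ∫ u in E, u ^ j * coeff α (fexp u) * ρ u := by
  rw [fmu, coeff_fmom, zero_add]

theorem coeff_fmu_eq (j : ℕ) (α : ℕ+ →₀ ℕ) : coeff α (fmu E ρ j) =
    (α.prod fun _ a => (a.factorial : ℝ))⁻¹ *
      ∫ u in E, u ^ (j + α.sum fun i a => (i : ℕ) * a) * ρ u := by
  rw [coeff_fmu, ← integral_const_mul]
  refine integral_congr_ae (Filter.Eventually.of_forall fun u => ?_)
  simp only [coeff_fexp, pow_add]
  ring

theorem constantCoeff_fmu (j : ℕ) : constantCoeff (fmu E ρ j) = ∫ u in E, u ^ j * ρ u := by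
  rw [← coeff_zero_eq_constantCoeff_apply, coeff_fmu_eq]
  simp

theorem IsWeight.integrableOn_pow_mul_fexp (hρ : IsWeight E ρ) (j : ℕ) (α : ℕ+ →₀ ℕ) :
    IntegrableOn (fun u => u ^ j * (coeff α (fexp u) * ρ u)) E := by
  have := (hρ.moments (j + α.sum fun i a => (i : ℕ) * a)).const_mul
    (α.prod fun _ a => (a.factorial : ℝ))⁻¹
  refine this.congr (Filter.Eventually.of_forall fun u => ?_)
  simp only [coeff_fexp, pow_add]
  ring

/-- Raising the exponent of t_k by one multiplies the factorials by α_k + 1, which cancels the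
factor from differentiation, and multiplies the integrand by u^k. -/
theorem fpd_fmu (k : ℕ+) (j : ℕ) : pderiv ℝ k (fmu E ρ j) = fmu E ρ (j + k) := by
  ext α
  rw [coeff_pderiv, coeff_fmu_eq, coeff_fmu_eq, prod_factorial_add_single, sum_weight_add_single,
    mul_inv, add_assoc, add_comm (k : ℕ)]
  have : ((α k : ℝ) + 1) ≠ 0 := by positivity
  field_simp

theorem ftau_eq_hankel (n : ℕ) : ftau E ρ n = hankel (fmu E ρ) n :=
  minorDet_eq_hankel (fun i j => fmom_eq i j) n

theorem IsWeight.constantCoeff_hankel_fmu_pos (hρ : IsWeight E ρ) (n : ℕ) :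
    0 < constantCoeff (hankel (fmu E ρ) n) := by
  rw [map_hankel]
  simp only [constantCoeff_fmu]
  exact hρ.hankel_pos n

end FormalMoments

/-! ### Formal shifts -/

section FormalShift

open MvPowerSeries

theorem hasSubst_fshiftVars (ε : ℝ) : HasSubst (fshiftVars ε) := by
  refine HasSubst.add (hasSubst_X_comp (Option.some_injective _)) (HasSubst.mul_left _ ?_)
  refine ⟨fun i => by simp, fun d => ?_⟩
  classical
  refine Set.Subsingleton.finite fun i hi j hj => ?_
  simp only [coeff_X_pow, ne_eq, ite_eq_right_iff, Classical.not_imp, Set.mem_ofPred_eq] at hi hj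
  have h := hi.1.symm.trans hj.1
  exact PNat.coe_injective (Finsupp.single_injective _ h)

/-- The substitution `t ↦ t + ε [w]` as an algebra homomorphism. -/
def fshiftHom (ε : ℝ) : FSeries →ₐ[ℝ] PowerSeries FSeries :=
  (optionEquivLeft ℕ+ ℝ).toAlgHom.comp (substAlgHom (hasSubst_fshiftVars ε))

theorem fshiftHom_apply (ε : ℝ) (f : FSeries) : fshiftHom ε f = fshift ε f := by
  simp only [fshiftHom, AlgHom.comp_apply, substAlgHom_apply]
  rfl

theorem fshiftHom_X (ε : ℝ) (i : ℕ+) : fshiftHom ε (X i) =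
    PowerSeries.C (X i) + PowerSeries.C (C (ε / (i : ℝ))) * PowerSeries.X ^ (i : ℕ) := by
  change optionEquivLeft ℕ+ ℝ (substAlgHom (hasSubst_fshiftVars ε) (X i)) = _
  rw [substAlgHom_X, fshiftVars, map_add, map_mul, map_pow, optionEquivLeft_X_some,
    optionEquivLeft_C, optionEquivLeft_X_none]

/-- The coefficient of `w ^ N` in `f(t + ε [w])`. -/
def fshiftCoeff (ε : ℝ) (N : ℕ) : FSeries →ₗ[ℝ] FSeries :=
  (PowerSeries.coeff (R := FSeries) N).restrictScalars ℝ ∘ₗ (fshiftHom ε).toLinearMap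

theorem fshiftCoeff_apply (ε : ℝ) (N : ℕ) (f : FSeries) :
    fshiftCoeff ε N f = PowerSeries.coeff N (fshiftHom ε f) := rfl

theorem finitelyDetermined_fshiftCoeff (ε : ℝ) (N : ℕ) :
    FinitelyDetermined (fshiftCoeff ε N) := fun e => by
  obtain ⟨s, hs⟩ := finitelyDetermined_subst (hasSubst_fshiftVars ε) (e.optionElim N)
  refine ⟨s, fun f hf => ?_⟩
  have := hs f hf
  rw [← coeff_coeff_optionEquivLeft] at this
  exact this

/-- The derivations whose flow is `t ↦ t + ε [w]`. -/
def fshiftDer (ε : ℝ) (k : ℕ) : Derivation ℝ FSeries FSeries := ε • pderiv ℝ k.toPNat'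

/-- Flows involve only indices ≥ 1, so the default value of `toPNat'` at 0 is immaterial. -/
theorem fshiftDer_succ (ε : ℝ) (k : ℕ) (f : FSeries) :
    fshiftDer ε (k + 1) f = ε • pderiv ℝ k.succPNat f := rfl

/-- t_i + ε w^i / i has a single term beyond the constant one; the factor i from w d/dw cancels the
denominator. -/
theorem isFlow_fshiftHom_X (ε : ℝ) (i : ℕ+) : IsFlow (fshiftDer ε) (fshiftHom ε (X i)) := by
  classical
  intro N
  have hc : ∀ n, PowerSeries.coeff n (fshiftHom ε (X i)) =
      (if n = 0 then X i else 0) + if n = i then C (ε / (i : ℝ)) else 0 := fun n => by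
    rw [fshiftHom_X, map_add, PowerSeries.coeff_C, PowerSeries.coeff_C_mul, PowerSeries.coeff_X_pow,
      mul_ite, mul_one, mul_zero]
  have hd : ∀ n k, fshiftDer ε (k + 1) (PowerSeries.coeff n (fshiftHom ε (X i))) =
      if n = 0 then (if k + 1 = i then C ε else 0) else 0 := fun n k => by
    rw [hc, fshiftDer_succ, map_add]
    have h1 : pderiv ℝ k.succPNat (if n = (i : ℕ) then C (ε / (i : ℝ)) else 0 : FSeries) = 0 := by
      split_ifs <;> simp
    rw [h1, add_zero]
    split_ifs with h h2
    · have : i = k.succPNat := PNat.coe_injective (by simpa using h2.symm)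
      rw [← this, pderiv_X_self, smul_eq_C_mul, mul_one]
    · rw [pderiv_X_of_ne, smul_zero]
      rintro rfl
      simp at h2
    · rw [map_zero, smul_zero]
  simp only [hd]
  rw [Finset.sum_range_succ, Nat.sub_self, if_pos rfl, Finset.sum_eq_zero, zero_add, hc,
    if_neg (Nat.succ_ne_zero N), zero_add]
  · split_ifs with h
    · have : ((N : FSeries) + 1) = C ((i : ℕ) : ℝ) := by rw [← h]; simp
      rw [this, ← map_mul, mul_div_cancel₀]
      exact_mod_cast i.ne_zero
    · rw [mul_zero]
  · intro k hk
    rw [if_neg]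
    have := Finset.mem_range.mp hk
    lia

theorem fshiftHom_coe (ε : ℝ) (p : MvPolynomial ℕ+ ℝ) :
    fshiftHom ε (p : FSeries) = MvPolynomial.aeval (fun i => fshiftHom ε (X i)) p := by
  have : (fshiftHom ε).comp (MvPolynomial.coeToMvPowerSeries.algHom ℝ) =
      MvPolynomial.aeval (fun i => fshiftHom ε (X i)) := by
    ext i : 1
    simp
  exact DFunLike.congr_fun this p

/-- True for the variables, hence for polynomials by multiplicativity of flows, hence for all series
because each coefficient equation is finitely determined. -/
theorem isFlow_fshiftHom (ε : ℝ) (f : FSeries) : IsFlow (fshiftDer ε) (fshiftHom ε f) := by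
  intro N
  have h := FinitelyDetermined.ext
    (φ := ((N : ℝ) + 1) • LinearMap.id ∘ₗ fshiftCoeff ε (N + 1))
    (ψ := ∑ i ∈ Finset.range (N + 1), (ε • LinearMap.id) ∘ₗ
      ((pderiv ℝ i.succPNat).toLinearMap ∘ₗ fshiftCoeff ε (N - i)))
    ((finitelyDetermined_smul _).comp (finitelyDetermined_fshiftCoeff ε _))
    (FinitelyDetermined.sum _ fun i _ => (finitelyDetermined_smul _).comp
      ((finitelyDetermined_pderiv _).comp (finitelyDetermined_fshiftCoeff ε _))) (fun p => ?_) f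
  · simp only [LinearMap.sum_apply] at h
    rw [← show ((N : ℝ) + 1) • PowerSeries.coeff (N + 1) (fshiftHom ε f) =
      (N + 1) * PowerSeries.coeff (N + 1) (fshiftHom ε f) by simp [smul_eq_C_mul]]
    exact h
  · have hp := isFlow_aeval (isFlow_fshiftHom_X ε) p N
    rw [← fshiftHom_coe] at hp
    simp only [LinearMap.sum_apply]
    rw [← show ((N : ℝ) + 1) • PowerSeries.coeff (N + 1) (fshiftHom ε p) =
      (N + 1) * PowerSeries.coeff (N + 1) (fshiftHom ε p) by simp [smul_eq_C_mul]] at hp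
    exact hp

theorem coeff_zero_fshiftHom (ε : ℝ) (f : FSeries) :
    PowerSeries.coeff 0 (fshiftHom ε f) = f := by
  refine FinitelyDetermined.ext (φ := fshiftCoeff ε 0) (ψ := LinearMap.id)
    (finitelyDetermined_fshiftCoeff ε 0) finitelyDetermined_id (fun p => ?_) f
  rw [fshiftCoeff_apply, LinearMap.id_apply]
  induction p using MvPolynomial.induction_on with
  | C a =>
    have : ((MvPolynomial.C a : MvPolynomial ℕ+ ℝ) : FSeries) = algebraMap ℝ FSeries a :=
      MvPolynomial.coe_C a
    rw [this, AlgHom.commutes, PowerSeries.algebraMap_apply, PowerSeries.coeff_zero_C]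
  | add p q hp hq => rw [MvPolynomial.coe_add, map_add, map_add, hp, hq]
  | mul_X p i hp =>
    rw [MvPolynomial.coe_mul, MvPolynomial.coe_X, map_mul,
      PowerSeries.coeff_zero_eq_constantCoeff_apply, map_mul,
      ← PowerSeries.coeff_zero_eq_constantCoeff_apply, hp, fshiftHom_X]
    simp

variable {E : Set ℝ} {ρ : ℝ → ℝ}

/-- Both sides are flows of the same derivations with the same value at w = 0. -/
theorem fshiftHom_one_fmu (j : ℕ) : fshiftHom 1 (fmu E ρ j) = stieltjesSeq (fmu E ρ) j := by
  refine (isFlow_fshiftHom 1 _).ext (isFlow_stieltjesSeq (fun k j => ?_) j) ?_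
  · rw [fshiftDer_succ, one_smul, fpd_fmu]
    rfl
  · rw [coeff_zero_fshiftHom, stieltjesSeq, PowerSeries.coeff_mk, add_zero]

theorem fshiftHom_neg_one_fmu (j : ℕ) : fshiftHom (-1) (fmu E ρ j) = shiftDiffSeq (fmu E ρ) j := by
  refine (isFlow_fshiftHom (-1) _).ext (isFlow_shiftDiffSeq (fun k j => ?_) j) ?_
  · rw [fshiftDer_succ, fpd_fmu, neg_one_smul]
    rfl
  · rw [coeff_zero_fshiftHom]
    simp [shiftDiffSeq]

theorem fshift_one_ftau (n : ℕ) : fshift 1 (ftau E ρ n) = hankel (stieltjesSeq (fmu E ρ)) n := by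
  rw [ftau_eq_hankel, ← fshiftHom_apply]
  refine (map_hankel (fshiftHom 1).toRingHom _ n).trans ?_
  congr 1
  exact funext fshiftHom_one_fmu

theorem fshift_neg_one_ftau (n : ℕ) :
    fshift (-1) (ftau E ρ n) = hankel (shiftDiffSeq (fmu E ρ)) n := by
  rw [ftau_eq_hankel, ← fshiftHom_apply]
  refine (map_hankel (fshiftHom (-1)).toRingHom _ n).trans ?_
  congr 1
  exact funext fshiftHom_neg_one_fmu

end FormalShift

/-! ### Two sets of formal times -/

section TwoTimes

open MvPowerSeries

/-- `f(t) ↦ f(t')` and `f(t) ↦ f(t)` as algebra homomorphisms. -/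
def renameTimes {g : ℕ+ → ℕ+ ⊕ ℕ+} (hg : Function.Injective g) : FSeries →ₐ[ℝ] FSeries2 :=
  substAlgHom (hasSubst_X_comp hg)

theorem renameTimes_inl (f : FSeries) : renameTimes Sum.inl_injective f = inFst f :=
  substAlgHom_apply _ _

theorem renameTimes_inr (f : FSeries) : renameTimes Sum.inr_injective f = inSnd f :=
  substAlgHom_apply _ _

theorem pderiv_renameTimes {g : ℕ+ → ℕ+ ⊕ ℕ+} (hg : Function.Injective g) (k : ℕ+) (f : FSeries) :
    pderiv ℝ (g k) (renameTimes hg f) = renameTimes hg (pderiv ℝ k f) := by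
  simp only [renameTimes, substAlgHom_apply]
  rw [pderiv_subst (hasSubst_X_comp hg) (g k) k fun j hj => pderiv_X_of_ne (hg.ne hj),
    pderiv_X_self, one_mul]

theorem pderiv_renameTimes_of_notMem {g : ℕ+ → ℕ+ ⊕ ℕ+} (hg : Function.Injective g)
    {l : ℕ+ ⊕ ℕ+} (hl : ∀ j, g j ≠ l) (f : FSeries) : pderiv ℝ l (renameTimes hg f) = 0 := by
  simp only [renameTimes, substAlgHom_apply]
  rw [pderiv_subst (hasSubst_X_comp hg) l 1 fun j _ => pderiv_X_of_ne (hl j),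
    pderiv_X_of_ne (hl 1), zero_mul]

theorem hasSubst_X_add_X : HasSubst fun i : ℕ+ =>
    (X (Sum.inl i) + X (Sum.inr i) : FSeries2) :=
  HasSubst.add (hasSubst_X_comp Sum.inl_injective) (hasSubst_X_comp Sum.inr_injective)

theorem hasSubst_X_sub_X : HasSubst fun i : ℕ+ =>
    (X (Sum.inl i) - X (Sum.inr i) : FSeries2) := by
  have := HasSubst.add (hasSubst_X_comp (R := ℝ) (Sum.inl_injective (α := ℕ+) (β := ℕ+)))
    (HasSubst.mul_left (fun _ => -1)
      (hasSubst_X_comp (R := ℝ) (Sum.inr_injective (α := ℕ+) (β := ℕ+))))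
  convert! this using 2 with i
  simp [sub_eq_add_neg]

/-- `f(t) ↦ f(t + y)`. -/
def plusHom : FSeries →ₐ[ℝ] FSeries2 := substAlgHom hasSubst_X_add_X

/-- `f(t) ↦ f(t - y)`. -/
def minusHom : FSeries →ₐ[ℝ] FSeries2 := substAlgHom hasSubst_X_sub_X

theorem pderiv_plusHom (k : ℕ+) (f : FSeries) :
    pderiv ℝ (Sum.inr k) (plusHom f) = plusHom (pderiv ℝ k f) := by
  simp only [plusHom, substAlgHom_apply]
  rw [pderiv_subst hasSubst_X_add_X (Sum.inr k) k fun j hj => by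
      rw [map_add, pderiv_X_of_ne Sum.inl_ne_inr, pderiv_X_of_ne (Sum.inr_injective.ne hj),
        add_zero],
    map_add, pderiv_X_self, pderiv_X_of_ne Sum.inl_ne_inr, zero_add, one_mul]

theorem pderiv_minusHom (k : ℕ+) (f : FSeries) :
    pderiv ℝ (Sum.inr k) (minusHom f) = -minusHom (pderiv ℝ k f) := by
  simp only [minusHom, substAlgHom_apply]
  rw [pderiv_subst hasSubst_X_sub_X (Sum.inr k) k fun j hj => by
      rw [map_sub, pderiv_X_of_ne Sum.inl_ne_inr, pderiv_X_of_ne (Sum.inr_injective.ne hj),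
        sub_zero],
    map_sub, pderiv_X_self, pderiv_X_of_ne Sum.inl_ne_inr, zero_sub, neg_one_mul]

theorem evalY0_eq_killCompl (F : FSeries2) :
    evalY0 F = killCompl (⟨Sum.inl, Sum.inl_injective⟩ : ℕ+ ↪ ℕ+ ⊕ ℕ+) F := by
  ext α
  rw [coeff_killCompl, Finsupp.embDomain_eq_mapDomain]
  rfl

theorem finitelyDetermined_killCompl (e : ℕ+ ↪ ℕ+ ⊕ ℕ+) :
    FinitelyDetermined (killCompl (R := ℝ) e).toLinearMap := fun d =>
  ⟨{Finsupp.embDomain e d}, fun f hf => by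
    rw [AlgHom.toLinearMap_apply, coeff_killCompl, hf _ (Finset.mem_singleton_self _)]⟩

/-- This serves to show that setting y = 0 in f(t ± y) returns f; it is checked on polynomials and
extended by finite determination. -/
theorem killCompl_substAlgHom {a : ℕ+ → FSeries2} (ha : HasSubst a) (e : ℕ+ ↪ ℕ+ ⊕ ℕ+)
    (h : ∀ i, killCompl e (a i) = X i) (f : FSeries) : killCompl e (substAlgHom ha f) = f := by
  refine FinitelyDetermined.ext (ψ := LinearMap.id)
    ((finitelyDetermined_killCompl e).comp (finitelyDetermined_subst ha)) finitelyDetermined_id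
    (fun p => ?_) f
  rw [LinearMap.comp_apply, AlgHom.toLinearMap_apply, AlgHom.toLinearMap_apply, LinearMap.id_apply,
    substAlgHom_coe]
  have : ((killCompl (R := ℝ) e).comp (MvPolynomial.aeval a)) =
      MvPolynomial.coeToMvPowerSeries.algHom ℝ := by
    ext i : 1
    simp [h]
  exact DFunLike.congr_fun this p

theorem killCompl_inl_X_inr (i : ℕ+) :
    killCompl (R := ℝ) (⟨Sum.inl, Sum.inl_injective⟩ : ℕ+ ↪ ℕ+ ⊕ ℕ+) (X (Sum.inr i)) = 0 :=
  killCompl_X_eq_zero (by simp)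

theorem killCompl_inl_X_inl (i : ℕ+) :
    killCompl (R := ℝ) (⟨Sum.inl, Sum.inl_injective⟩ : ℕ+ ↪ ℕ+ ⊕ ℕ+) (X (Sum.inl i)) = X i :=
  killCompl_X (e := (⟨Sum.inl, Sum.inl_injective⟩ : ℕ+ ↪ ℕ+ ⊕ ℕ+)) i

theorem evalY0_plusHom (f : FSeries) : evalY0 (plusHom f) = f := by
  rw [evalY0_eq_killCompl]
  exact killCompl_substAlgHom _ _ (fun i => by
    rw [map_add, killCompl_inl_X_inl, killCompl_inl_X_inr, add_zero]) f

theorem evalY0_minusHom (f : FSeries) : evalY0 (minusHom f) = f := by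
  rw [evalY0_eq_killCompl]
  exact killCompl_substAlgHom _ _ (fun i => by
    rw [map_sub, killCompl_inl_X_inl, killCompl_inl_X_inr, sub_zero]) f

variable (E : Set ℝ) (ρ : ℝ → ℝ)

/-- Evaluation of polynomials in the moments of `t + y` and of `t - y`. -/
def fhirotaEval : MvPolynomial (ℕ ⊕ ℕ) ℝ →ₐ[ℝ] FSeries2 :=
  MvPolynomial.aeval (Sum.elim (fun j => plusHom (fmu E ρ j)) fun j => minusHom (fmu E ρ j))

theorem pderiv_fhirotaEval (k : ℕ+) (f : MvPolynomial (ℕ ⊕ ℕ) ℝ) :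
    pderiv ℝ (Sum.inr k) (fhirotaEval E ρ f) = fhirotaEval E ρ (hirotaD ℝ k f) := by
  induction f using MvPolynomial.induction_on with
  | C a => simp [← MvPolynomial.algebraMap_eq]
  | add p q hp hq => simp only [map_add, hp, hq]
  | mul_X p j hp =>
    have hX : ∀ j, fhirotaEval E ρ (MvPolynomial.X j) = _ := fun j =>
      MvPolynomial.aeval_X _ _
    rcases j with j | j
    · simp only [map_mul, map_add, Derivation.leibniz, smul_eq_mul, hp, hX, hirotaD_inl,
        Sum.elim_inl, pderiv_plusHom, fpd_fmu]
    · simp only [map_mul, map_add, map_neg, Derivation.leibniz, smul_eq_mul, hp, hX, hirotaD_inr,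
        Sum.elim_inr, pderiv_minusHom, fpd_fmu]

theorem evalY0_fhirotaEval (f : MvPolynomial (ℕ ⊕ ℕ) ℝ) :
    evalY0 (fhirotaEval E ρ f) = MvPolynomial.aeval (fmu E ρ) (hirotaEval ℝ f) := by
  rw [evalY0_eq_killCompl]
  have : (killCompl (R := ℝ) (⟨Sum.inl, Sum.inl_injective⟩ : ℕ+ ↪ ℕ+ ⊕ ℕ+)).comp
      (fhirotaEval E ρ) = (MvPolynomial.aeval (fmu E ρ)).comp (hirotaEval ℝ) := by
    ext j : 1
    rcases j with j | j
    · simp [fhirotaEval, hirotaEval, ← evalY0_eq_killCompl, evalY0_plusHom]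
    · simp [fhirotaEval, hirotaEval, ← evalY0_eq_killCompl, evalY0_minusHom]
  exact DFunLike.congr_fun this f

theorem fhirotaEval_hirotaPair (n : ℕ) : fhirotaEval E ρ (hirotaPair ℝ n) =
    fhirotaProd (ftau E ρ n) (ftau E ρ n) := by
  have h1 : ∀ μ : ℕ → MvPolynomial (ℕ ⊕ ℕ) ℝ,
      fhirotaEval E ρ (hankel μ n) = hankel (fun k => fhirotaEval E ρ (μ k)) n :=
    fun μ => map_hankel (fhirotaEval E ρ).toRingHom μ n
  have h2 : plusHom (hankel (fmu E ρ) n) = hankel (fun k => plusHom (fmu E ρ k)) n :=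
    map_hankel plusHom.toRingHom _ n
  have h3 : minusHom (hankel (fmu E ρ) n) = hankel (fun k => minusHom (fmu E ρ k)) n :=
    map_hankel minusHom.toRingHom _ n
  rw [hirotaPair, map_mul, hirotaInl, hirotaInr, aeval_hankel, aeval_hankel, h1, h1, ftau_eq_hankel,
    fhirotaProd, ← substAlgHom_apply hasSubst_X_add_X, ← substAlgHom_apply hasSubst_X_sub_X]
  change _ = plusHom _ * minusHom _
  rw [h2, h3]
  simp [fhirotaEval]

/-- The universal identity is evaluated at the moments of t ± y, an evaluation intertwining
`hirotaD` with the y-derivatives. -/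
theorem fhirota_kpPoly_ftau (n k : ℕ) (hn : 1 ≤ n) :
    fhirota (kpPoly ℝ k) (ftau E ρ n) (ftau E ρ n) = 0 := by
  have h := polyOp_rel (D := fun i : ℕ+ => hirotaD ℝ i)
    (D' := fun (k : ℕ+) (F : FSeries2) => pderiv ℝ (Sum.inr k) F)
    (fun f F => fhirotaEval E ρ f = F) (map_zero _)
    (fun v w v' w' hv hw => by rw [map_add, hv, hw]) (fun c v v' hv => by rw [map_smul, hv])
    (fun k v v' hv => by rw [← hv, pderiv_fhirotaEval]) (kpPoly ℝ k)
    (fhirotaEval_hirotaPair E ρ n)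
  rw [fhirota, ← h, evalY0_fhirotaEval, hirotaEval_polyOp_kpPoly ℝ n k hn, map_zero]

end TwoTimes

/-! ### The formal bilinear identity -/

section FormalBilinear

open MvPowerSeries

/-- The weight `∑ i α_i` of a monomial in two sets of times. -/
def weight2 (α : (ℕ+ ⊕ ℕ+) →₀ ℕ) : ℕ := α.sum fun i a => Sum.elim PNat.val PNat.val i * a

theorem weight2_add (α β : (ℕ+ ⊕ ℕ+) →₀ ℕ) : weight2 (α + β) = weight2 α + weight2 β :=
  Finsupp.sum_add_index' (by simp) (fun _ _ _ => mul_add _ _ _)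

theorem weight2_single (i : ℕ+ ⊕ ℕ+) :
    weight2 (Finsupp.single i 1) = Sum.elim PNat.val PNat.val i := by
  simp [weight2]

/-- The algebra homomorphism `t_i ↦ t_i - t'_i`. -/
def diffHom : MvPolynomial ℕ+ ℝ →ₐ[ℝ] FSeries2 := MvPolynomial.aeval fun i : ℕ+ =>
  (X (Sum.inl i) - X (Sum.inr i) : FSeries2)

theorem pderiv_inl_diffHom (k : ℕ+) (p : MvPolynomial ℕ+ ℝ) :
    pderiv ℝ (Sum.inl k) (diffHom p) = diffHom (MvPolynomial.pderiv k p) := by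
  induction p using MvPolynomial.induction_on with
  | C a => simp [← MvPolynomial.algebraMap_eq]
  | add p q hp hq => simp only [map_add, hp, hq]
  | mul_X p j hp =>
    have hX : ∀ j, diffHom (MvPolynomial.X j) = X (Sum.inl j) - X (Sum.inr j) := fun j =>
      MvPolynomial.aeval_X _ _
    simp only [map_mul, map_add, Derivation.leibniz, smul_eq_mul, hp, hX, map_sub]
    rw [pderiv_X_of_ne Sum.inr_ne_inl, sub_zero]
    by_cases h : j = k
    · rw [h]; simp
    · rw [pderiv_X_of_ne (Sum.inl_injective.ne h), MvPolynomial.pderiv_X_of_ne h, map_zero]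

theorem pderiv_inr_diffHom (k : ℕ+) (p : MvPolynomial ℕ+ ℝ) :
    pderiv ℝ (Sum.inr k) (diffHom p) = -diffHom (MvPolynomial.pderiv k p) := by
  induction p using MvPolynomial.induction_on with
  | C a => simp [← MvPolynomial.algebraMap_eq]
  | add p q hp hq => simp only [map_add, hp, hq, neg_add]
  | mul_X p j hp =>
    have hX : ∀ j, diffHom (MvPolynomial.X j) = X (Sum.inl j) - X (Sum.inr j) := fun j =>
      MvPolynomial.aeval_X _ _
    simp only [map_mul, map_add, Derivation.leibniz, smul_eq_mul, hp, hX, map_sub]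
    rw [pderiv_X_of_ne Sum.inl_ne_inr, zero_sub]
    by_cases h : j = k
    · rw [h]; simp; ring
    · rw [pderiv_X_of_ne (Sum.inr_injective.ne h), MvPolynomial.pderiv_X_of_ne h, map_zero]; ring

theorem pderiv_inl_schurDiff (k : ℕ+) (j : ℕ) : pderiv ℝ (Sum.inl k) (schurDiff j) =
    if (k : ℕ) ≤ j then schurDiff (j - k) else 0 := by
  have h := pderiv_inl_diffHom k (schur ℝ j)
  rw [pderiv_schur] at h
  refine h.trans ?_
  split_ifs
  · rfl
  · exact map_zero _

theorem pderiv_inr_schurDiff (k : ℕ+) (j : ℕ) : pderiv ℝ (Sum.inr k) (schurDiff j) =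
    -if (k : ℕ) ≤ j then schurDiff (j - k) else 0 := by
  have h := pderiv_inr_diffHom k (schur ℝ j)
  rw [pderiv_schur] at h
  refine h.trans ?_
  split_ifs
  · rfl
  · exact congrArg Neg.neg (map_zero _)

theorem constantCoeff_schurDiff (j : ℕ) :
    constantCoeff (schurDiff j) = if j = 0 then 1 else 0 := by
  cases j with
  | zero => simp [schurDiff]
  | succ j =>
    have h := congrArg (fun p => constantCoeff (diffHom p)) (succ_mul_schur_succ ℝ j)
    simp only [map_mul, map_add, map_natCast, map_one, map_sum] at h
    have hX : ∀ j, constantCoeff (diffHom (MvPolynomial.X j)) = 0 := fun j => by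
      rw [diffHom, MvPolynomial.aeval_X]; simp
    simp only [hX, mul_zero, zero_mul, Finset.sum_const_zero] at h
    rw [if_neg (Nat.succ_ne_zero j)]
    exact (mul_eq_zero.mp h).resolve_left (Nat.cast_add_one_ne_zero j)

/-- Induction on exponents, lowering one exponent at a time. -/
@[elab_as_elim]
theorem exponent_induction {P : ((ℕ+ ⊕ ℕ+) →₀ ℕ) → Prop} (h0 : P 0)
    (hs : ∀ α i, P α → P (α + Finsupp.single i 1)) (α : (ℕ+ ⊕ ℕ+) →₀ ℕ) : P α := by
  refine Finsupp.induction₂ α h0 fun a b f _ _ hf => ?_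
  clear * - hs hf
  induction b with
  | zero => simpa using hf
  | succ b ih =>
    rw [Finsupp.single_add, ← add_assoc]
    exact hs _ a ih

/-- s_j(t - t') is homogeneous of weight j. Differentiation lowers the index j and the weight of the
exponent by the same amount, so one may induct on the exponent; this makes the residue sum finite in
each coefficient. -/
theorem coeff_schurDiff_eq_zero (α : (ℕ+ ⊕ ℕ+) →₀ ℕ) :
    ∀ j, weight2 α < j → coeff α (schurDiff j) = 0 := by
  induction α using exponent_induction with
  | h0 =>
    intro j hj
    rw [coeff_zero_eq_constantCoeff_apply, constantCoeff_schurDiff, if_neg (by lia)]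
  | hs α i ih =>
    intro j hj
    rw [weight2_add, weight2_single] at hj
    have h : coeff α (pderiv ℝ i (schurDiff j)) = 0 := by
      rcases i with k | k
      · rw [pderiv_inl_schurDiff]
        split_ifs
        · exact ih _ (by simp at hj; lia)
        · exact map_zero _
      · rw [pderiv_inr_schurDiff, map_neg]
        split_ifs
        · rw [ih _ (by simp at hj; lia), neg_zero]
        · simp
    rw [coeff_pderiv] at h
    exact (mul_eq_zero.mp h).resolve_right (Nat.cast_add_one_ne_zero _)

variable {E : Set ℝ} {ρ : ℝ → ℝ}

theorem pderiv_inFst_inl (k : ℕ+) (f : FSeries) :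
    pderiv ℝ (Sum.inl k) (inFst f) = inFst (pderiv ℝ k f) := by
  rw [← renameTimes_inl, ← renameTimes_inl, pderiv_renameTimes Sum.inl_injective]

theorem pderiv_inFst_inr (k : ℕ+) (f : FSeries) : pderiv ℝ (Sum.inr k) (inFst f) = 0 := by
  rw [← renameTimes_inl, pderiv_renameTimes_of_notMem _ (by simp)]

theorem pderiv_inSnd_inr (k : ℕ+) (f : FSeries) :
    pderiv ℝ (Sum.inr k) (inSnd f) = inSnd (pderiv ℝ k f) := by
  rw [← renameTimes_inr, ← renameTimes_inr, pderiv_renameTimes Sum.inr_injective]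

theorem pderiv_inSnd_inl (k : ℕ+) (f : FSeries) : pderiv ℝ (Sum.inl k) (inSnd f) = 0 := by
  rw [← renameTimes_inr, pderiv_renameTimes_of_notMem _ (by simp)]

theorem constantCoeff_renameTimes {g : ℕ+ → ℕ+ ⊕ ℕ+} (hg : Function.Injective g) (f : FSeries) :
    constantCoeff (renameTimes hg f) = constantCoeff f := by
  rw [renameTimes, substAlgHom_apply, constantCoeff_subst (hasSubst_X_comp hg),
    finsum_eq_single _ 0]
  · simp
  · intro d hd
    obtain ⟨i, hi⟩ := Finsupp.ne_iff.mp hd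
    rw [Finsupp.prod, map_prod, Finset.prod_eq_zero (Finsupp.mem_support_iff.mpr hi), smul_zero]
    simpa using hi

theorem sum_ite_le_sub {A : Type*} [AddCommMonoid A] (f : ℕ → A) (J k : ℕ) :
    ∑ j ∈ Finset.range (J + 1), (if k ≤ j then f j else 0) =
      if k ≤ J then ∑ j ∈ Finset.range (J - k + 1), f (j + k) else 0 := by
  split_ifs with h
  · rw [← Finset.sum_filter]
    refine (Finset.sum_bij' (fun j _ => j + k) (fun j _ => j - k) ?_ ?_ ?_ ?_ ?_).symm <;>
      simp <;> intros <;> lia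
  · exact Finset.sum_eq_zero fun j hj => if_neg (by simp at hj; lia)

/-- Taylor's formula for the moments, truncated. -/
theorem coeff_sum_schurDiff_mul (α : (ℕ+ ⊕ ℕ+) →₀ ℕ) : ∀ i J, weight2 α ≤ J →
    coeff α (∑ j ∈ Finset.range (J + 1), schurDiff j * inSnd (fmu E ρ (i + j))) =
      coeff α (inFst (fmu E ρ i)) := by
  induction α using exponent_induction with
  | h0 =>
    intro i J _
    simp only [coeff_zero_eq_constantCoeff_apply, map_sum, map_mul, constantCoeff_schurDiff]
    rw [Finset.sum_eq_single_of_mem 0 (by simp) fun j _ hj => by rw [if_neg hj, zero_mul],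
      if_pos rfl, one_mul, add_zero, ← renameTimes_inl, ← renameTimes_inr,
      constantCoeff_renameTimes, constantCoeff_renameTimes]
  | hs α l ih =>
    intro i J hJ
    rw [weight2_add, weight2_single] at hJ
    have hc : ((α l : ℝ) + 1) ≠ 0 := Nat.cast_add_one_ne_zero _
    refine mul_right_cancel₀ hc ?_
    rw [← coeff_pderiv, ← coeff_pderiv, map_sum]
    have hsum : ∀ k : ℕ+, ∑ j ∈ Finset.range (J + 1),
        (if (k : ℕ) ≤ j then schurDiff (j - k) else 0) * inSnd (fmu E ρ (i + j)) =
        if (k : ℕ) ≤ J then ∑ j ∈ Finset.range (J - k + 1),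
          schurDiff j * inSnd (fmu E ρ (i + k + j)) else 0 := fun k => by
      simp only [ite_mul, zero_mul]
      rw [sum_ite_le_sub]
      refine if_congr Iff.rfl (Finset.sum_congr rfl fun j _ => ?_) rfl
      rw [Nat.add_sub_cancel, add_assoc, add_comm j]
    -- A t_k-derivative moves both sides from i to i + k. A t'_k-derivative produces two sums, cut
    -- off at J and at J - k, which cancel since both bounds are at least the weight of α.
    rcases l with k | k
    · rw [Sum.elim_inl] at hJ
      simp only [Derivation.leibniz, pderiv_inl_schurDiff, pderiv_inSnd_inl, mul_zero, zero_add,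
        smul_eq_mul, pderiv_inFst_inl, fpd_fmu]
      simp only [mul_comm (inSnd _), hsum]
      rw [if_pos (by lia)]
      exact ih _ _ (by lia)
    · rw [Sum.elim_inr] at hJ
      simp only [Derivation.leibniz, pderiv_inr_schurDiff, pderiv_inSnd_inr, smul_eq_mul,
        pderiv_inFst_inr, fpd_fmu, mul_neg, Finset.sum_add_distrib, Finset.sum_neg_distrib]
      simp only [mul_comm (inSnd _), hsum]
      rw [if_pos (by lia), map_add, map_neg, map_zero, ih _ _ (by lia)]
      simp only [add_right_comm i _ (k : ℕ)]
      rw [ih _ _ (by lia), add_neg_cancel]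

theorem shiftedProductCoeff_ftau {n m : ℕ} (hmn : m + 1 ≤ n) (j : ℕ) :
    shiftedProductCoeff (ftau E ρ n) (ftau E ρ (m + 1)) (j + (n - m - 1) + 1) =
      momFun (fun k => inSnd (fmu E ρ k)) (Polynomial.X ^ j *
        hankelPoly (fun k => inFst (fmu E ρ k)) n * hankelPoly (fun k => inSnd (fmu E ρ k)) m) := by
  rw [← coeff_hankel_shiftDiffSeq_mul _ _ (by lia), show j + n - m = j + (n - m - 1) + 1 by lia,
    PowerSeries.coeff_mul, Finset.Nat.sum_antidiagonal_eq_sum_range_succ_mk, shiftedProductCoeff]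
  have h1 : hankel (shiftDiffSeq fun k => inFst (fmu E ρ k)) n =
      (fshift (-1) (ftau E ρ n)).map (renameTimes Sum.inl_injective).toRingHom := by
    rw [fshift_neg_one_ftau, map_hankel]
    congr 1
    ext1 k
    simp [shiftDiffSeq, renameTimes_inl]
  have h2 : hankel (stieltjesSeq fun k => inSnd (fmu E ρ k)) (m + 1) =
      (fshift 1 (ftau E ρ (m + 1))).map (renameTimes Sum.inr_injective).toRingHom := by
    rw [fshift_one_ftau, map_hankel]
    congr 1
    ext1 k
    ext1 l
    simp [stieltjesSeq, renameTimes_inr]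
  refine Finset.sum_congr rfl fun a _ => ?_
  rw [h1, h2, PowerSeries.coeff_map, PowerSeries.coeff_map, ← renameTimes_inl, ← renameTimes_inr]
  rfl

theorem momFun_hankelPoly_mul_eq_zero {A : Type*} [CommRing A] (μ : ℕ → A) {n : ℕ}
    (p : Polynomial A) (hp : p.natDegree < n) : momFun μ (hankelPoly μ n * p) = 0 := by
  rw [momFun_mul, momFun_eq_sum_range _ _ hp]
  exact Finset.sum_eq_zero fun k hk => by
    rw [hankelPoly_orthogonal μ (Finset.mem_range.mp hk), smul_zero]

/-- The j-th term is s_j(t - t') times the moment at t' of u^j P_n(t;u) P_m(t';u). Summing over j,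
Taylor's formula turns moments at t' into moments at t, where P_n(t) is orthogonal to the
lower-degree P_m(t'). -/
theorem formal_bilinear {n m : ℕ} (hmn : m + 1 ≤ n) (α : (ℕ+ ⊕ ℕ+) →₀ ℕ) :
    (Function.support fun j => coeff α
      (residueTerm (ftau E ρ n) (ftau E ρ (m + 1)) (n - m - 1) j)).Finite ∧
    ∑ᶠ j, coeff α (residueTerm (ftau E ρ n) (ftau E ρ (m + 1)) (n - m - 1) j) = 0 := by
  classical
  have hle : ∀ {β γ : (ℕ+ ⊕ ℕ+) →₀ ℕ}, (β, γ) ∈ Finset.HasAntidiagonal.antidiagonal α →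
      weight2 β ≤ weight2 α := fun {β γ} h => by
    rw [← Finset.HasAntidiagonal.mem_antidiagonal.mp h, weight2_add]
    exact Nat.le_add_right _ _
  have hsupp : (Function.support fun j => coeff α
      (residueTerm (ftau E ρ n) (ftau E ρ (m + 1)) (n - m - 1) j)) ⊆
        Finset.range (weight2 α + 1) := by
    intro j hj
    rw [Finset.coe_range, Set.mem_Iio]
    by_contra! h
    refine hj ?_
    change coeff α (schurDiff j * _) = 0
    rw [coeff_mul]
    exact Finset.sum_eq_zero fun x hx => by
      rw [coeff_schurDiff_eq_zero _ _ (by have := hle hx; lia), zero_mul]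
  refine ⟨(Finset.finite_toSet _).subset hsupp, ?_⟩
  rw [finsum_eq_sum_of_support_subset _ hsupp]
  set Q := hankelPoly (fun k => inFst (fmu E ρ k)) n * hankelPoly (fun k => inSnd (fmu E ρ k)) m
    with hQ
  have hQ0 : momFun (fun k => inFst (fmu E ρ k)) Q = 0 :=
    momFun_hankelPoly_mul_eq_zero _ _ (lt_of_le_of_lt (natDegree_hankelPoly_le _ _) (by lia))
  have hterm : ∀ j, residueTerm (ftau E ρ n) (ftau E ρ (m + 1)) (n - m - 1) j =
      ∑ i ∈ Finset.range (Q.natDegree + 1),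
        Q.coeff i * (schurDiff j * inSnd (fmu E ρ (i + j))) := fun j => by
    rw [residueTerm, shiftedProductCoeff_ftau hmn, mul_assoc, ← hQ, mul_comm (Polynomial.X ^ j),
      momFun_mul_X_pow, momFun_eq_sum_range _ _ (Nat.lt_succ_self _), Finset.mul_sum]
    exact Finset.sum_congr rfl fun i _ => by rw [smul_eq_mul, mul_left_comm]
  simp only [hterm]
  rw [← map_sum, Finset.sum_comm]
  simp only [← Finset.mul_sum]
  rw [momFun_eq_sum_range _ _ (Nat.lt_succ_self _)] at hQ0
  rw [← map_zero (coeff α), ← hQ0, map_sum, map_sum]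
  refine Finset.sum_congr rfl fun i _ => ?_
  rw [smul_eq_mul, coeff_mul, coeff_mul]
  refine Finset.sum_congr rfl fun x hx => ?_
  rw [coeff_sum_schurDiff_mul]
  rw [← Finset.HasAntidiagonal.mem_antidiagonal.mp hx, weight2_add]
  exact Nat.le_add_left _ _

end FormalBilinear

/-! ### Derivations that shift the moments, on any algebra. -/

section Universal

variable {K A : Type*} [Field K] [CommRing A] [Algebra K A]

theorem derivation_aeval {d : Derivation K A A} {μ : ℕ → A} {k : ℕ}
    (h : ∀ j, d (μ j) = μ (j + k)) (f : MvPolynomial ℕ K) :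
    d (MvPolynomial.aeval μ f) = MvPolynomial.aeval μ (umD K k f) := by
  induction f using MvPolynomial.induction_on with
  | C a => simp [← MvPolynomial.algebraMap_eq]
  | add p q hp hq => simp only [map_add, hp, hq]
  | mul_X p j hp =>
    simp only [map_mul, map_add, Derivation.leibniz, smul_eq_mul, hp, MvPolynomial.aeval_X, h, umD_X]

/-- The quotient rule, with v in the role of 1/τ; the numerators stay polynomials in the moments. -/
theorem derivation_mul_pow {d : Derivation K A A} {μ : ℕ → A} {k : ℕ}
    (h : ∀ j, d (μ j) = μ (j + k)) {T : MvPolynomial ℕ K} {v : A}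
    (hv : v * MvPolynomial.aeval μ T = 1) (p : ℕ) (a : MvPolynomial ℕ K) :
    d (MvPolynomial.aeval μ a * v ^ p) =
      MvPolynomial.aeval μ (quotD K T k p a) * v ^ (p + 1) := by
  have hdv : d v = -v ^ 2 * MvPolynomial.aeval μ (umD K k T) := by
    have h1 := congrArg d hv
    rw [Derivation.leibniz, Derivation.map_one_eq_zero, derivation_aeval h, smul_eq_mul,
      smul_eq_mul] at h1
    linear_combination v * h1 - d v * hv
  rw [Derivation.leibniz, Derivation.leibniz_pow, hdv, derivation_aeval h, quotD]
  simp only [smul_eq_mul, nsmul_eq_mul, map_sub, map_mul, map_natCast]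
  cases p with
  | zero =>
    simp
    linear_combination -(MvPolynomial.aeval μ (umD K k a)) * hv
  | succ p =>
    rw [Nat.add_sub_cancel]
    push_cast
    linear_combination -(v ^ (p + 1) * MvPolynomial.aeval μ (umD K k a)) * hv

theorem coeff_X_mul_hankelPoly {d : Derivation K A A} {μ : ℕ → A}
    (h : ∀ j, d (μ j) = μ (j + 1)) (n : ℕ) :
    (Polynomial.X * hankelPoly μ n).coeff n = -d (hankel μ n) := by
  have := congrArg (MvPolynomial.aeval μ) (umD_one_hankel K n)
  rw [map_neg, ← derivation_aeval h, aeval_hankel] at this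
  rw [← this, ← map_aeval_hankelPoly K μ n]
  cases n with
  | zero => simp
  | succ n => simp

theorem coeff_hankelPoly_succ {d : Derivation K A A} {μ : ℕ → A}
    (h : ∀ j, d (μ j) = μ (j + 1)) (n : ℕ) :
    (hankelPoly μ (n + 1)).coeff n = -d (hankel μ (n + 1)) := by
  rw [← coeff_X_mul_hankelPoly h (n + 1), Polynomial.coeff_X_mul]

theorem derivation_imul {M : Matrix ℕ ℕ A} (hM : RowFinite M) (N : Matrix ℕ ℕ A)
    (d : Derivation K A A) : (imul M N).map d = imul (M.map d) N + imul M (N.map d) := by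
  ext i j
  have h1 : ∀ k ∉ (hM i).toFinset, M i k = 0 := fun k hk => by simpa using hk
  have h2 : ∀ k ∉ (hM i).toFinset, M.map d i k = 0 := fun k hk => by
    rw [Matrix.map_apply, h1 k hk, map_zero]
  rw [Matrix.map_apply, Matrix.add_apply, imul_eq_sum h1, imul_eq_sum h1, imul_eq_sum h2, map_sum,
    ← Finset.sum_add_distrib]
  refine Finset.sum_congr rfl fun k _ => ?_
  rw [Derivation.leibniz, smul_eq_mul, smul_eq_mul, Matrix.map_apply, Matrix.map_apply]
  ring

/-- The Toda equation for a derivation shifting the moments by `k`. -/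
theorem IsLowerFactorization.map_lax [CharZero K] {m S T : Matrix ℕ ℕ A}
    (hf : IsLowerFactorization m S T) (d : Derivation K A A) (k : ℕ)
    (hm : ∀ i j, d (m i j) = m (i + k) j) : (lax S T).map d = todaSkew K (lax S T) k := by
  have hl : ∀ M : Matrix ℕ ℕ A, (∀ i j, i < j → M i j = 0) → ∀ i j, i < j → M.map d i j = 0 :=
    fun M h i j hij => by rw [Matrix.map_apply, h i j hij, map_zero]
  have hΛ : (shiftMat : Matrix ℕ ℕ A).map d = 0 := by
    ext i j
    rw [Matrix.map_apply, shiftMat]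
    split_ifs <;> simp
  have h1 : (1 : Matrix ℕ ℕ A).map d = 0 := by
    ext i j
    rw [Matrix.map_apply, Matrix.one_apply]
    split_ifs <;> simp
  have h0 : ∀ N : Matrix ℕ ℕ A, imul N 0 = 0 := fun N => by
    ext i j; simp [imul]
  rw [← deriv_lax_eq_todaSkew hf k (hl S hf.lower) (hl T hf.lower_inv) (m' := m.map d) hm, lax,
    derivation_imul (hf.rowFinite_S.imul rowFinite_shiftMat), derivation_imul hf.rowFinite_S, hΛ,
    h0, add_zero]
  · conv_lhs => rw [hf.factor]
    rw [derivation_imul hf.rowFinite_T]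
    rfl
  · rw [← derivation_imul hf.rowFinite_S, hf.mul_inv, h1]

end Universal

/-! ### Formal factorizations -/

section FormalFactorization

open MvPowerSeries

variable {E : Set ℝ} {ρ : ℝ → ℝ}

/-- Each coefficient of the integrand is a finite combination of integrable monomials times ρ, so
the integral may be taken termwise. -/
theorem IsWeight.fint_eval (hρ : IsWeight E ρ) (p : Polynomial FSeries) :
    (fint E ρ fun u => p.eval (C u) * fexp u) = momFun (fmu E ρ) p := by
  classical
  rw [momFun_eq_sum_range _ _ (Nat.lt_succ_self _)]
  ext α
  have h : ∀ u, coeff α (p.eval (C u) * fexp u) * ρ u = ∑ k ∈ Finset.range (p.natDegree + 1),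
      ∑ x ∈ Finset.HasAntidiagonal.antidiagonal α,
        coeff x.1 (p.coeff k) * (u ^ k * (coeff x.2 (fexp u) * ρ u)) := fun u => by
    rw [Polynomial.eval_eq_sum_range, Finset.sum_mul, map_sum, Finset.sum_mul]
    refine Finset.sum_congr rfl fun k _ => ?_
    rw [mul_assoc, coeff_mul, Finset.sum_mul]
    refine Finset.sum_congr rfl fun x _ => ?_
    rw [← map_pow, coeff_C_mul]
    ring
  have hi : ∀ k (x : (ℕ+ →₀ ℕ) × (ℕ+ →₀ ℕ)), IntegrableOn (fun u =>
      coeff x.1 (p.coeff k) * (u ^ k * (coeff x.2 (fexp u) * ρ u))) E :=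
    fun k x => (hρ.integrableOn_pow_mul_fexp k x.2).const_mul _
  change ∫ u in E, coeff α (p.eval (C u) * fexp u) * ρ u = _
  simp only [h]
  rw [integral_finsetSum _ fun k _ => integrable_finsetSum _ fun x _ => hi k x, map_sum]
  refine Finset.sum_congr rfl fun k _ => ?_
  rw [integral_finsetSum _ fun x _ => hi k x, smul_eq_mul, coeff_mul]
  refine Finset.sum_congr rfl fun x _ => ?_
  rw [integral_const_mul, coeff_fmu]
  simp only [mul_assoc]

theorem IsWeight.fq_eq (hρ : IsWeight E ρ) (S : Matrix ℕ ℕ FSeries) (n : ℕ) :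
    fq E ρ S n = momFun (stieltjesSeq (fmu E ρ)) (pPoly S n) := by
  ext1 j
  rw [momFun_stieltjesSeq_coeff, ← hρ.fint_eval, fq, PowerSeries.coeff_mk]
  congr 1
  ext1 u
  rw [Polynomial.eval_mul, Polynomial.eval_pow, Polynomial.eval_X, map_pow, mul_comm (_ ^ j)]

instance : IsDomain FSeries := NoZeroDivisors.to_isDomain _

/-- The algebra structure of Laurent series over their ring of coefficients. -/
abbrev laurentAlgebra : Algebra FSeries FLaurent := HahnSeries.instAlgebra

attribute [local instance] laurentAlgebra

theorem fz_mul_fw : fz * fw = 1 := by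
  rw [fz, fw, HahnSeries.single_mul_single]
  simp

theorem fz_pow_mul_fw_pow {j n : ℕ} (h : j ≤ n) : fz ^ n * fw ^ (n - j) = fz ^ j := by
  obtain ⟨k, rfl⟩ := Nat.exists_eq_add_of_le h
  rw [Nat.add_sub_cancel_left, pow_add, mul_assoc, ← mul_pow, fz_mul_fw, one_pow, mul_one]

theorem ofW_X : ofW PowerSeries.X = fw := HahnSeries.ofPowerSeries_X

theorem ofW_C (a : FSeries) : ofW (PowerSeries.C a) = algebraMap FSeries FLaurent a :=
  HahnSeries.ofPowerSeries_C a

theorem fp_eq (S : Matrix ℕ ℕ FSeries) (n : ℕ) : fp S n = Polynomial.aeval fz (pPoly S n) := rfl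

/-- The moments of `ρ_t(u) / (1 - u w)`. -/
def flaurentSeq (E : Set ℝ) (ρ : ℝ → ℝ) (j : ℕ) : FLaurent := ofW (stieltjesSeq (fmu E ρ) j)

theorem flaurentSeq_sub (j : ℕ) : flaurentSeq E ρ j - fw * flaurentSeq E ρ (j + 1) =
    algebraMap FSeries FLaurent (fmu E ρ j) := by
  have := congrArg ofW (stieltjesSeq_sub (fmu E ρ) j)
  rwa [map_sub, map_mul, ofW_X, PowerSeries.algebraMap_apply, Algebra.algebraMap_self_apply, ofW_C]
    at this

theorem IsWeight.ofW_fq (hρ : IsWeight E ρ) (S : Matrix ℕ ℕ FSeries) (n : ℕ) :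
    ofW (fq E ρ S n) = momFun (flaurentSeq E ρ) (pPoly S n) := by
  rw [hρ.fq_eq, momFun_eq_sum_range _ _ (Nat.lt_succ_self _),
    momFun_eq_sum_range _ _ (Nat.lt_succ_self _), map_sum]
  refine Finset.sum_congr rfl fun k _ => ?_
  rw [Algebra.smul_def, map_mul, PowerSeries.algebraMap_apply,
    Algebra.algebraMap_self_apply, ofW_C]
  exact (Algebra.smul_def _ _).symm

theorem IsWeight.constantCoeff_ftau_pos (hρ : IsWeight E ρ) (n : ℕ) :
    0 < constantCoeff (ftau E ρ n) := by
  rw [ftau_eq_hankel]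
  exact hρ.constantCoeff_hankel_fmu_pos n

theorem IsWeight.inv_mul_ftau (hρ : IsWeight E ρ) (n : ℕ) : (ftau E ρ n)⁻¹ * ftau E ρ n = 1 :=
  MvPowerSeries.inv_mul_cancel _ (hρ.constantCoeff_ftau_pos n).ne'

theorem constantCoeff_pos_of_sq_mul {σ : Type*} {f g h : MvPowerSeries σ ℝ}
    (hf : 0 < constantCoeff f) (hg : 0 < constantCoeff g) (h0 : h = f * g⁻¹) :
    0 < constantCoeff h := by
  rw [h0, map_mul, constantCoeff_inv]
  positivity

theorem IsWeight.exists_formal_factorization (hρ : IsWeight E ρ) :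
    ∃ S T, IsLowerFactorization (fmom E ρ) S T ∧ ∀ n, 0 < constantCoeff (S n n) := by
  have h : ∀ n, ∃ s : FSeries, 0 < constantCoeff s ∧
      s ^ 2 = ftau E ρ n * (ftau E ρ (n + 1))⁻¹ := fun n =>
    exists_sq_eq _ (constantCoeff_pos_of_sq_mul (hρ.constantCoeff_ftau_pos n)
      (hρ.constantCoeff_ftau_pos (n + 1)) rfl)
  choose s hs0 hs using h
  obtain ⟨h1, h2⟩ := isLowerFactorization_fact (m := fmom E ρ) (μ := fmu E ρ) fmom_eq s
    (fun n => (ftau E ρ n)⁻¹) (fun n => by rw [← ftau_eq_hankel, hρ.inv_mul_ftau])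
    (fun n => by
      rw [← ftau_eq_hankel, ← ftau_eq_hankel, hs, mul_assoc, hρ.inv_mul_ftau, mul_one])
  exact ⟨_, _, h1, fun n => by rw [h2]; exact hs0 n⟩

theorem fpd_flog (k : ℕ+) {f : FSeries} (hf : 0 < constantCoeff f) :
    fpd k (flog f) = fpd k f * f⁻¹ := by
  set c := constantCoeff f with hc
  set a : FSeries := C c⁻¹ * f - 1 with ha
  have ha0 : constantCoeff a = 0 := by simp [ha, ← hc, hf.ne']
  have hs : PowerSeries.HasSubst a := PowerSeries.HasSubst.of_constantCoeff_zero ha0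
  -- Substituting f/c - 1 for X in this identity shows that the derivative of the logarithm is c/f
  -- there.
  have hd : (1 + PowerSeries.X : PowerSeries ℝ) * PowerSeries.derivative ℝ (PowerSeries.log ℝ) = 1 := by
    rw [PowerSeries.deriv_log]
    ext n
    cases n with
    | zero => simp
    | succ n =>
      rw [add_mul, map_add, one_mul, PowerSeries.coeff_succ_X_mul, PowerSeries.coeff_mk,
        PowerSeries.coeff_mk, PowerSeries.coeff_one, if_neg (Nat.succ_ne_zero n)]
      simp [pow_succ]
  have h2 := congrArg (PowerSeries.substAlgHom hs) hd
  rw [map_mul, map_add, map_one, PowerSeries.substAlgHom_X, PowerSeries.coe_substAlgHom, ha,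
    add_sub_cancel] at h2
  have hC : (C c : FSeries) * C c⁻¹ = 1 := by rw [← map_mul, mul_inv_cancel₀ hf.ne', map_one]
  have hfi : f * f⁻¹ = 1 := MvPowerSeries.mul_inv_cancel _ hf.ne'
  rw [fpd, flog, map_add, pderiv_C, zero_add, pderiv_powerSeries_subst hs, map_sub,
    Derivation.map_one_eq_zero, sub_zero, Derivation.leibniz, pderiv_C, smul_zero, add_zero,
    smul_eq_mul]
  change C c⁻¹ * fpd k f * _ = fpd k f * f⁻¹
  linear_combination (f⁻¹ * fpd k f) * h2 - C c⁻¹ * fpd k f * PowerSeries.subst (C c⁻¹ * f - 1) (PowerSeries.derivative ℝ (PowerSeries.log ℝ)) * hfi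

theorem fpd_fmom (k : ℕ+) (i j : ℕ) : pderiv ℝ k (fmom E ρ i j) = fmom E ρ (i + k) j := by
  rw [fmom_eq, fmom_eq, fpd_fmu, add_right_comm]

variable {S T : Matrix ℕ ℕ FSeries} (hρ : IsWeight E ρ) (hf : IsLowerFactorization (fmom E ρ) S T)
include hρ hf

theorem formal_pPoly_eq (n : ℕ) : pPoly S n =
    Polynomial.C (S n n * (ftau E ρ n)⁻¹) * hankelPoly (fmu E ρ) n := by
  have h := hf.hankel_mul_pPoly fmom_eq n
  rw [← ftau_eq_hankel] at h
  rw [mul_comm (S n n), Polynomial.C_mul, mul_assoc, ← h, ← mul_assoc, ← Polynomial.C_mul,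
    hρ.inv_mul_ftau, Polynomial.C_1, one_mul]

theorem fp_eq_fshift (n : ℕ) : fp S n = fz ^ n *
    ofW (PowerSeries.C (S n n * (ftau E ρ n)⁻¹) * fshift (-1) (ftau E ρ n)) := by
  rw [fp_eq, formal_pPoly_eq hρ hf, map_mul (Polynomial.aeval fz), Polynomial.aeval_C,
    map_mul ofW, ofW_C, mul_left_comm]
  congr 1
  rw [fshift_neg_one_ftau, hankel_shiftDiffSeq, map_sum, Finset.mul_sum,
    Polynomial.aeval_eq_sum_range' (Nat.lt_succ_of_le (natDegree_hankelPoly_le (fmu E ρ) n)),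
    Finset.sum_range]
  refine Finset.sum_congr rfl fun j _ => ?_
  rw [map_mul, map_pow, ofW_C, ofW_X, Algebra.smul_def, mul_left_comm]
  congr 1
  rw [fz_pow_mul_fw_pow (Nat.lt_succ_iff.mp j.2)]

theorem ofW_fq_eq_fshift (n : ℕ) : ofW (fq E ρ S n) = fw ^ n *
    ofW (PowerSeries.C (S n n * (ftau E ρ n)⁻¹) * fshift 1 (ftau E ρ (n + 1))) := by
  rw [hρ.fq_eq, formal_pPoly_eq hρ hf, Polynomial.C_mul', map_smul,
    ← X_pow_mul_hankel_stieltjesSeq, fshift_one_ftau, ← ofW_X, ← map_pow, ← map_mul,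
    PowerSeries.smul_eq_C_mul, mul_left_comm]

/-- L_nn is a difference of subleading coefficients of consecutive monic orthogonal polynomials, and
these are -∂_1 log τ. -/
theorem formal_lax_diag (n : ℕ) :
    lax S T n n = fpd 1 (flog (ftau E ρ (n + 1) * (ftau E ρ n)⁻¹)) := by
  have hd : ∀ j, pderiv ℝ (1 : ℕ+) (fmu E ρ j) = fmu E ρ (j + 1) := fpd_fmu 1
  have h := hf.lax_diag_mul_hankel fmom_eq n
  rw [coeff_X_mul_hankelPoly hd, coeff_hankelPoly_succ hd, ← ftau_eq_hankel, ← ftau_eq_hankel] at h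
  have hτ := hρ.inv_mul_ftau n
  have hτ1 := hρ.inv_mul_ftau (n + 1)
  have hpos := constantCoeff_pos_of_sq_mul (hρ.constantCoeff_ftau_pos (n + 1))
    (hρ.constantCoeff_ftau_pos n) rfl
  have hi := MvPowerSeries.inv_mul_cancel _ hpos.ne'
  have hinv : (ftau E ρ (n + 1) * (ftau E ρ n)⁻¹)⁻¹ = ftau E ρ n * (ftau E ρ (n + 1))⁻¹ := by
    linear_combination ftau E ρ n * (ftau E ρ (n + 1))⁻¹ * hi -
      (ftau E ρ (n + 1) * (ftau E ρ n)⁻¹)⁻¹ * (ftau E ρ n * (ftau E ρ n)⁻¹) * hτ1 -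
      (ftau E ρ (n + 1) * (ftau E ρ n)⁻¹)⁻¹ * hτ
  rw [fpd_flog 1 hpos, hinv, fpd, Derivation.leibniz, pderiv_inv', smul_eq_mul, smul_eq_mul]
  set a := ftau E ρ n
  set b := ftau E ρ (n + 1)
  linear_combination a⁻¹ * b⁻¹ * h - (lax S T n n * b * b⁻¹) * hτ - lax S T n n * hτ1 +
    (a⁻¹ * b⁻¹ * pderiv ℝ 1 a * b) * hτ

theorem formal_linearIndependent :
    LinearIndependent FLaurent ![fp S, fun n => ofW (fq E ρ S n)] := by
  have h := linearIndependent_pPoly_stieltjes hf fmom_eq (flaurentSeq E ρ) fz fw fz_mul_fw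
    flaurentSeq_sub (HahnSeries.C_injective)
  simp only [hρ.ofW_fq]
  exact h

omit hf in
theorem formal_kp (n : ℕ) (hn : 1 ≤ n) :
    fpd 1 (fpd 1 (fpd 1 (fpd 1 (flog (ftau E ρ n))))) + 3 * fpd 2 (fpd 2 (flog (ftau E ρ n)))
      - 4 * fpd 1 (fpd 3 (flog (ftau E ρ n)))
      + 6 * (fpd 1 (fpd 1 (flog (ftau E ρ n)))) ^ 2 = 0 := by
  set v := (ftau E ρ n)⁻¹ with hv
  have hT : MvPolynomial.aeval (fmu E ρ) (uTau ℝ n) = ftau E ρ n := by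
    rw [aeval_hankel, ftau_eq_hankel]
  have hv1 : v * MvPolynomial.aeval (fmu E ρ) (uTau ℝ n) = 1 := by rw [hT, hρ.inv_mul_ftau]
  have h0 : ∀ k : ℕ+, fpd k (flog (ftau E ρ n)) =
      MvPolynomial.aeval (fmu E ρ) (umD ℝ k (uTau ℝ n)) * v ^ 1 := fun k => by
    rw [fpd_flog k (hρ.constantCoeff_ftau_pos n), ← derivation_aeval (fpd_fmu k), hT, pow_one, fpd]
  have h1 : ∀ (k : ℕ+) p a, fpd k (MvPolynomial.aeval (fmu E ρ) a * v ^ p) =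
      MvPolynomial.aeval (fmu E ρ) (quotD ℝ (uTau ℝ n) k p a) * v ^ (p + 1) :=
    fun k p a => derivation_mul_pow (fpd_fmu k) hv1 p a
  have h := congrArg (MvPolynomial.aeval (fmu E ρ)) (kp_numerator ℝ n hn)
  simp only [map_add, map_sub, map_mul, map_pow, map_zero, map_ofNat] at h
  simp only [h0, h1, Nat.reduceAdd, PNat.val_ofNat]
  generalize MvPolynomial.aeval (fmu E ρ) (uTau ℝ n) = t at h hv1
  linear_combination v ^ 4 * h - (3 * MvPolynomial.aeval (fmu E ρ) (quotD ℝ (uTau ℝ n) 2 1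
    (umD ℝ 2 (uTau ℝ n))) - 4 * MvPolynomial.aeval (fmu E ρ) (quotD ℝ (uTau ℝ n) 1 1
    (umD ℝ 3 (uTau ℝ n)))) * v ^ 2 * (v * t + 1) * hv1

end FormalFactorization

/-! ### The multiple integral and the eigenvector equations, formally. -/

section FormalIntegral

open MvPowerSeries Equiv

variable {E : Set ℝ} {ρ : ℝ → ℝ}

theorem vandermondeSq_mul_coeff_prod_fexp {n : ℕ} (α : ℕ+ →₀ ℕ) (x : Fin n → ℝ) :
    vandermondeSq x * coeff α (∏ k, fexp (x k)) * ∏ k, ρ (x k) =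
      ∑ l ∈ Finset.finsuppAntidiag Finset.univ α,
        vandermondeSq x * ∏ k, coeff (l k) (fexp (x k)) * ρ (x k) := by
  classical
  rw [coeff_prod, mul_assoc, Finset.sum_mul, Finset.mul_sum]
  refine Finset.sum_congr rfl fun l _ => ?_
  rw [Finset.prod_mul_distrib]

theorem IsWeight.integrableOn_coeff_prod_fexp (hρ : IsWeight E ρ) (n : ℕ) (α : ℕ+ →₀ ℕ) :
    IntegrableOn (fun x : Fin n → ℝ => vandermondeSq x * coeff α (∏ k, fexp (x k)) *
      ∏ k, ρ (x k)) (Set.univ.pi fun _ => E) := by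
  simp only [vandermondeSq_mul_coeff_prod_fexp]
  exact integrable_finsetSum _ fun l _ => integrableOn_vandermondeSq_mul_prod (𝕜 := ℝ)
    (g := fun k u => coeff (l k) (fexp u) * ρ u)
    fun k j => hρ.integrableOn_pow_mul_fexp j (l k)

/-- The exponent α is distributed over the n variables in all ways; Andréief's identity applies to
each distribution, and the product of the moments collects them again. -/
theorem IsWeight.coeff_ftau (hρ : IsWeight E ρ) (n : ℕ) (α : ℕ+ →₀ ℕ) :
    coeff α (ftau E ρ n) = (1 / (n.factorial : ℝ)) *
      ∫ x in Set.univ.pi fun _ : Fin n => E, vandermondeSq x *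
        coeff α (∏ k, fexp (x k)) * ∏ k, ρ (x k) := by
  classical
  have hi : ∀ l : Fin n →₀ ℕ+ →₀ ℕ, ∀ (k : Fin n) (j : ℕ),
      IntegrableOn (fun u : ℝ => (u : ℝ) ^ j * (coeff (l k) (fexp u) * ρ u)) E :=
    fun l k j => hρ.integrableOn_pow_mul_fexp j (l k)
  simp only [vandermondeSq_mul_coeff_prod_fexp]
  have hint : ∫ x in Set.univ.pi fun _ : Fin n => E, ∑ l ∈ Finset.finsuppAntidiag Finset.univ α,
      vandermondeSq x * ∏ k, coeff (l k) (fexp (x k)) * ρ (x k) =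
      ∑ l ∈ Finset.finsuppAntidiag Finset.univ α, ∑ σ : Perm (Fin n), ∑ π : Perm (Fin n),
        ((Perm.sign σ : ℤ) : ℝ) * ((Perm.sign π : ℤ) : ℝ) *
          ∏ k, ∫ u in E, u ^ ((σ k : ℕ) + π k) * (coeff (l k) (fexp u) * ρ u) :=
    (integral_finsetSum _ fun l _ => integrableOn_vandermondeSq_mul_prod (𝕜 := ℝ) (hi l)).trans
      (Finset.sum_congr rfl fun l _ => integral_vandermondeSq_mul_prod (𝕜 := ℝ) (hi l))
  have h := congrArg (coeff α) (sum_perm_prod_eq_hankel (fmu E ρ) n)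
  rw [← ftau_eq_hankel, ← map_natCast (C : ℝ →+* FSeries), coeff_C_mul] at h
  rw [one_div, eq_inv_mul_iff_mul_eq₀ (by exact_mod_cast n.factorial_ne_zero), ← h, map_sum,
    hint, Finset.sum_comm]
  refine Finset.sum_congr rfl fun σ _ => ?_
  rw [map_sum, Finset.sum_comm]
  refine Finset.sum_congr rfl fun π _ => ?_
  rw [← Finset.mul_sum, ← map_intCast (C : ℝ →+* FSeries), ← map_intCast (C : ℝ →+* FSeries),
    ← map_mul, coeff_C_mul, coeff_prod]
  refine congrArg _ (Finset.sum_congr rfl fun l _ => Finset.prod_congr rfl fun k _ => ?_)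
  rw [coeff_fmu]
  simp only [mul_assoc]

theorem IsWeight.fint_eval_mul (hρ : IsWeight E ρ) (p q : Polynomial FSeries) :
    (fint E ρ fun u => p.eval (C u) * q.eval (C u) * fexp u) = momFun (fmu E ρ) (p * q) := by
  simp only [← hρ.fint_eval, Polynomial.eval_mul]

attribute [local instance] laurentAlgebra

variable {S T : Matrix ℕ ℕ FSeries}

theorem formal_iact_lax_fp (hf : IsLowerFactorization (fmom E ρ) S T) (n : ℕ) :
    iact (lax S T) (fp S) n = fz * fp S n := by
  have h := hf.iact_lax_momFun (Polynomial.aeval (R := FSeries) fz).toLinearMap n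
  rw [AlgHom.toLinearMap_apply, map_mul, Polynomial.aeval_X] at h
  exact h

theorem formal_iact_lax_fq (hρ : IsWeight E ρ) (hf : IsLowerFactorization (fmom E ρ) S T) {n : ℕ}
    (hn : 1 ≤ n) : iact (lax S T) (fun k => ofW (fq E ρ S k)) n = fz * ofW (fq E ρ S n) := by
  simp only [hρ.ofW_fq]
  exact iact_lax_stieltjes hf fmom_eq (flaurentSeq E ρ) fz fw fz_mul_fw flaurentSeq_sub hn

end FormalIntegral

/-! ### Sequences of complex times -/

section TimeSums

variable {R : ℝ} {t t' : Times}

theorem ConvergesOn.norm_bound {z : ℂ} (hz : ‖z‖ ≤ R) (i : ℕ+) :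
    ‖t i * z ^ (i : ℕ)‖ ≤ ‖t i‖ * R ^ (i : ℕ) := by
  rw [norm_mul, norm_pow]
  gcongr

theorem ConvergesOn.summable (ht : ConvergesOn R t) {z : ℂ} (hz : ‖z‖ ≤ R) :
    Summable fun i : ℕ+ => t i * z ^ (i : ℕ) :=
  Summable.of_norm_bounded ht (ConvergesOn.norm_bound hz)

theorem ConvergesOn.add (hR : 0 ≤ R) (ht : ConvergesOn R t) (ht' : ConvergesOn R t') :
    ConvergesOn R (t + t') := by
  refine Summable.of_nonneg_of_le (fun i => by positivity) (fun i => ?_) (Summable.add ht ht')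
  rw [← add_mul]
  gcongr
  exact norm_add_le _ _

theorem ConvergesOn.neg (ht : ConvergesOn R t) : ConvergesOn R (-t) := by
  refine Summable.congr ht fun i => ?_
  rw [Pi.neg_apply, norm_neg]

theorem ConvergesOn.sub (hR : 0 ≤ R) (ht : ConvergesOn R t) (ht' : ConvergesOn R t') :
    ConvergesOn R (t - t') := by
  rw [sub_eq_add_neg]
  exact ht.add hR ht'.neg

theorem convergesOn_single (R : ℝ) (k : ℕ+) (s : ℂ) : ConvergesOn R (Pi.single k s) := by
  refine summable_of_ne_finset_zero (s := {k}) fun i hi => ?_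
  rw [Pi.single_eq_of_ne (by simpa using hi), norm_zero, zero_mul]

theorem convergesOn_zero (R : ℝ) : ConvergesOn R 0 := by
  refine summable_zero.congr fun i => ?_
  simp

theorem convergesOn_sum_single (hR : 0 ≤ R) {N : ℕ} (s : Fin N → ℂ) :
    ConvergesOn R (∑ i : Fin N, Pi.single (Nat.succPNat i) (s i)) := by
  refine Finset.sum_induction _ (ConvergesOn R) (fun _ _ => ConvergesOn.add hR) (convergesOn_zero R)
    fun i _ => convergesOn_single R _ _

theorem ConvergesOn.addAt (hR : 0 ≤ R) (ht : ConvergesOn R t) (k : ℕ+) (s : ℂ) :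
    ConvergesOn R (addAt t k s) := ht.add hR (convergesOn_single R k s)

theorem hasSum_bracketPt {z : ℂ} {w : ℂ} (h : ‖w * z‖ < 1) :
    HasSum (fun i : ℕ+ => bracketPt w i * z ^ (i : ℕ)) (-Complex.log (1 - w * z)) := by
  have h2 := Complex.hasSum_taylorSeries_neg_log h
  rw [← Function.Injective.hasSum_iff PNat.coe_injective] at h2
  · refine h2.congr_fun ?_ |> fun h => h
    intro i
    simp [bracketPt, mul_pow]
    ring
  · intro n hn
    have : n = 0 := by
      by_contra h0
      exact hn ⟨⟨n, Nat.pos_of_ne_zero h0⟩, rfl⟩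
    simp [this]

theorem convergesOn_bracketPt (hR : 0 ≤ R) {w : ℂ} (h : ‖w‖ * R < 1) :
    ConvergesOn R (bracketPt w) := by
  have h1 : Summable fun i : ℕ+ => (‖w‖ * R) ^ (i : ℕ) :=
    (summable_geometric_of_lt_one (by positivity) h).comp_injective PNat.coe_injective
  refine Summable.of_nonneg_of_le (fun i => by positivity) (fun i => ?_) h1
  rw [bracketPt, norm_div, norm_pow, mul_pow, Complex.norm_natCast]
  gcongr
  exact div_le_self (by positivity) (by exact_mod_cast i.pos)

theorem timeSum_add (ht : ConvergesOn R t) (ht' : ConvergesOn R t') {z : ℂ} (hz : ‖z‖ ≤ R) :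
    timeSum (t + t') z = timeSum t z + timeSum t' z := by
  rw [timeSum, timeSum, timeSum, ← (ht.summable hz).tsum_add (ht'.summable hz)]
  simp only [Pi.add_apply, add_mul]

theorem timeSum_single (k : ℕ+) (s z : ℂ) : timeSum (Pi.single k s) z = s * z ^ (k : ℕ) := by
  rw [timeSum, tsum_eq_single k fun i hi => by rw [Pi.single_eq_of_ne hi, zero_mul],
    Pi.single_eq_same]

theorem timeSum_sum_single (hR : 0 ≤ R) {z : ℂ} (hz : ‖z‖ ≤ R) {N : ℕ} (s : Fin N → ℂ) :
    timeSum (∑ i : Fin N, Pi.single (Nat.succPNat i) (s i)) z =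
      ∑ i : Fin N, s i * z ^ ((i : ℕ) + 1) := by
  have h : ∀ I : Finset (Fin N), ConvergesOn R (∑ i ∈ I, Pi.single (Nat.succPNat i) (s i)) ∧
      timeSum (∑ i ∈ I, Pi.single (Nat.succPNat i) (s i)) z =
        ∑ i ∈ I, s i * z ^ ((i : ℕ) + 1) := by
    classical
    intro I
    induction I using Finset.induction_on with
    | empty => exact ⟨convergesOn_zero R, by simp [timeSum]⟩
    | insert a I ha ih =>
      rw [Finset.sum_insert ha, Finset.sum_insert ha]
      refine ⟨(convergesOn_single R _ _).add hR ih.1, ?_⟩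
      rw [timeSum_add (convergesOn_single R _ _) ih.1 hz, ih.2, timeSum_single]
      rfl
  exact (h Finset.univ).2

/-- Σ w^i z^i / i is -log(1 - wz). Thus shifting t by [w] divides the weight by 1 - wu. -/
theorem exp_timeSum_bracketPt {z w : ℂ} (h : ‖w * z‖ < 1) :
    Complex.exp (timeSum (bracketPt w) z) * (1 - w * z) = 1 := by
  have h0 : 1 - w * z ≠ 0 := fun h0 => by
    rw [← sub_eq_zero.mp h0] at h
    simp at h
  rw [timeSum, (hasSum_bracketPt h).tsum_eq, Complex.exp_neg, Complex.exp_log h0, inv_mul_cancel₀ h0]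

theorem ConvergesOn.continuousOn_timeSum (ht : ConvergesOn R t) :
    ContinuousOn (timeSum t) (Metric.closedBall 0 R) :=
  continuousOn_tsum (fun i => by fun_prop) ht
    fun i z hz => ConvergesOn.norm_bound (by simpa using hz) i

theorem ConvergesOn.diffContOnCl_timeSum (hR : 0 < R) (ht : ConvergesOn R t) :
    DiffContOnCl ℂ (timeSum t) (Metric.ball 0 R) := by
  refine ⟨Complex.differentiableOn_tsum_of_summable_norm ht (fun i => by fun_prop) Metric.isOpen_ball
    fun i z hz => ConvergesOn.norm_bound (mem_ball_zero_iff.mp hz).le i, ?_⟩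
  rw [closure_ball _ hR.ne']
  exact ht.continuousOn_timeSum

theorem norm_ofReal_le_of_mem_Icc {u : ℝ} (hu : u ∈ Set.Icc (-R) R) : ‖(u : ℂ)‖ ≤ R := by
  rw [Complex.norm_real, Real.norm_eq_abs]
  exact abs_le.mpr hu

theorem ConvergesOn.continuousOn_timeSum_ofReal (ht : ConvergesOn R t) :
    ContinuousOn (fun u : ℝ => timeSum t u) (Set.Icc (-R) R) :=
  (ht.continuousOn_timeSum).comp Complex.continuous_ofReal.continuousOn fun u hu => by
    simpa using norm_ofReal_le_of_mem_Icc hu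

end TimeSums

/-! ### Moments as functions of complex times -/

section Moments

variable {E : Set ℝ} {ρ : ℝ → ℝ} {R : ℝ}

/-- The moments `∫ u^j ρ_t(u) du`. -/
def amu (E : Set ℝ) (ρ : ℝ → ℝ) (t : Times) (j : ℕ) : ℂ := ∫ u in E, (u : ℂ) ^ j * weightT ρ t u

theorem amom_eq (t : Times) (i j : ℕ) : amom E ρ t i j = amu E ρ t (i + j) := by
  simp only [amom, amu, pow_add]

theorem atau_eq_hankel (t : Times) (n : ℕ) : atau E ρ n t = hankel (amu E ρ t) n :=
  minorDet_eq_hankel (amom_eq t) n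

theorem weightT_add (hE : E ⊆ Set.Icc (-R) R) {t t' : Times} (ht : ConvergesOn R t) (ht' : ConvergesOn R t') {u : ℝ}
    (hu : u ∈ E) :
    weightT ρ (t + t') u = weightT ρ t u * Complex.exp (timeSum t' u) := by
  rw [weightT, timeSum_add ht ht' (norm_ofReal_le_of_mem_Icc (hE hu)), Complex.exp_add, weightT,
    mul_assoc]

theorem norm_mul_ofReal_lt (hE : E ⊆ Set.Icc (-R) R) {w : ℂ} (hw : ‖w‖ * R < 1) {u : ℝ} (hu : u ∈ E) : ‖w * u‖ < 1 := by
  rw [norm_mul]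
  exact (mul_le_mul_of_nonneg_left (norm_ofReal_le_of_mem_Icc (hE hu)) (norm_nonneg w)).trans_lt hw

variable (hρ : IsWeight E ρ) (hE : E ⊆ Set.Icc (-R) R)
include hρ hE

/-- Otherwise E would lie in a null interval, while ρ has positive integral over E. -/
theorem IsWeight.radius_pos : 0 < R := by
  by_contra! h
  have h0 : volume E = 0 := by
    refine measure_mono_null hE ?_
    rw [Real.volume_Icc, ENNReal.ofReal_eq_zero]
    linarith
  have := hρ.pos
  rw [Measure.restrict_eq_zero.mpr h0, integral_zero_measure] at this
  exact lt_irrefl 0 this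

theorem IsWeight.integrableOn_smul {H : Type*} [NormedAddCommGroup H] [NormedSpace ℂ H]
    {c : ℝ → H} (hc : ContinuousOn c (Set.Icc (-R) R)) :
    IntegrableOn (fun u => (ρ u : ℂ) • c u) E := by
  have hi : IntegrableOn (fun u => (ρ u : ℂ)) E := by
    have h := hρ.moments 0
    simp only [pow_zero, one_mul] at h
    exact h.ofReal
  obtain ⟨M, hM⟩ := isCompact_Icc.exists_bound_of_continuousOn hc
  refine hi.smul_bdd M ?_ ?_
  · exact (hc.aestronglyMeasurable_of_isCompact isCompact_Icc measurableSet_Icc).mono_measure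
      (Measure.restrict_mono hE le_rfl)
  · filter_upwards [ae_restrict_mem hρ.meas] with u hu
    exact hM u (hE hu)

theorem IsWeight.integrableOn_mul_weightT {t : Times} (ht : ConvergesOn R t) {c : ℝ → ℂ}
    (hc : ContinuousOn c (Set.Icc (-R) R)) : IntegrableOn (fun u => c u * weightT ρ t u) E := by
  have h := hρ.integrableOn_smul hE (hc.mul
    (ht.continuousOn_timeSum_ofReal).cexp)
  refine h.congr (Filter.Eventually.of_forall fun u => ?_)
  simp only [weightT, smul_eq_mul, Pi.mul_apply]
  ring

theorem IsWeight.integral_eval_mul_weightT {t : Times} (ht : ConvergesOn R t) (p : Polynomial ℂ) :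
    ∫ u in E, p.eval (u : ℂ) * weightT ρ t u = momFun (amu E ρ t) p := by
  rw [momFun_eq_sum_range _ _ (Nat.lt_succ_self _)]
  simp only [Polynomial.eval_eq_sum_range, Finset.sum_mul, mul_assoc]
  rw [integral_finsetSum]
  · simp only [integral_const_mul, smul_eq_mul]
    rfl
  · intro k _
    exact (hρ.integrableOn_mul_weightT hE ht (c := fun u => (u : ℂ) ^ k)
      (by fun_prop)).const_mul _

theorem IsWeight.exists_norm_amu_le {t : Times} (ht : ConvergesOn R t) :
    ∃ M, ∀ j, ‖amu E ρ t j‖ ≤ M * R ^ j := by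
  have hi : IntegrableOn (fun u => weightT ρ t u) E := by
    simpa using hρ.integrableOn_mul_weightT hE ht (c := fun _ => 1) (by fun_prop)
  refine ⟨∫ u in E, ‖weightT ρ t u‖, fun j => ?_⟩
  rw [mul_comm, ← integral_const_mul]
  refine norm_integral_le_of_norm_le (hi.norm.const_mul _) ?_
  filter_upwards [ae_restrict_mem hρ.meas] with u hu
  rw [norm_mul, norm_pow]
  gcongr
  exact norm_ofReal_le_of_mem_Icc (hE hu)

theorem IsWeight.weightT_add_bracketPt {t : Times} (ht : ConvergesOn R t) {w : ℂ}
    (hw : ‖w‖ * R < 1) {u : ℝ} (hu : u ∈ E) :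
    weightT ρ (t + bracketPt w) u * (1 - w * u) = weightT ρ t u := by
  rw [weightT_add hE ht (convergesOn_bracketPt (hρ.radius_pos hE).le hw) hu, mul_assoc,
    exp_timeSum_bracketPt (norm_mul_ofReal_lt hE hw hu), mul_one]

/-- (1 - wu) ρ_{t+[w]}(u) = ρ_t(u), integrated against u^j: the hypothesis of the abstract Stieltjes
lemmas. -/
theorem IsWeight.amu_add_bracketPt {t : Times} (ht : ConvergesOn R t) {w : ℂ}
    (hw : ‖w‖ * R < 1) (j : ℕ) :
    amu E ρ (t + bracketPt w) j - w * amu E ρ (t + bracketPt w) (j + 1) = amu E ρ t j := by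
  have ht' := ht.add (hρ.radius_pos hE).le (convergesOn_bracketPt (hρ.radius_pos hE).le hw)
  rw [amu, amu, ← integral_const_mul, ← integral_sub]
  · refine setIntegral_congr_fun hρ.meas fun u hu => ?_
    simp only [← hρ.weightT_add_bracketPt hE ht hw hu]
    ring
  · exact hρ.integrableOn_mul_weightT hE ht' (by fun_prop)
  · exact (hρ.integrableOn_mul_weightT hE ht' (c := fun u => (u : ℂ) ^ (j + 1))
      (by fun_prop)).const_mul _

theorem IsWeight.amu_sub_bracketPt {t : Times} (ht : ConvergesOn R t) {w : ℂ}
    (hw : ‖w‖ * R < 1) (j : ℕ) :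
    amu E ρ (t - bracketPt w) j = amu E ρ t j - w * amu E ρ t (j + 1) := by
  have h := hρ.amu_add_bracketPt hE
    (ht.sub (hρ.radius_pos hE).le (convergesOn_bracketPt (hρ.radius_pos hE).le hw)) hw j
  rw [sub_add_cancel] at h
  exact h.symm

/-- z/(z - u) = 1/(1 - u/z) is the factor by which the shift [z⁻¹] changes the weight. -/
theorem IsWeight.aq_eq {t : Times} (ht : ConvergesOn R t) (S : Matrix ℕ ℕ ℂ) (n : ℕ) {z : ℂ}
    (hz : R < ‖z‖) :
    aq E ρ t S n z = momFun (amu E ρ (t + bracketPt z⁻¹)) (pPoly S n) := by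
  have hR := hρ.radius_pos hE
  have hz0 : z ≠ 0 := norm_pos_iff.mp (hR.trans hz)
  have hw : ‖z⁻¹‖ * R < 1 := by
    rw [norm_inv, inv_mul_lt_iff₀ (hR.trans hz), mul_one]
    exact hz
  rw [← hρ.integral_eval_mul_weightT hE (ht.add hR.le (convergesOn_bracketPt hR.le hw)), aq,
    ← integral_const_mul]
  refine setIntegral_congr_fun hρ.meas fun u hu => ?_
  simp only [← hρ.weightT_add_bracketPt hE ht hw hu]
  have hzu : z - u ≠ 0 := fun h => by
    have h1 := norm_ofReal_le_of_mem_Icc (hE hu)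
    rw [← sub_eq_zero.mp h] at h1
    exact absurd h1 (not_le.mpr hz)
  field_simp

end Moments

/-! ### The multiple integral and existence of factorizations at complex times. -/

section AnalyticFactorization

variable {E : Set ℝ} {ρ : ℝ → ℝ} {R : ℝ} {t : Times}

theorem map_factS {A B : Type*} [CommRing A] [CommRing B] (f : A →+* B) (μ s v : ℕ → A) :
    (factS μ s v).map f = factS (fun j => f (μ j)) (fun j => f (s j)) fun j => f (v j) := by
  ext i j
  simp only [factS, Matrix.map_apply, map_mul, ← map_hankelPoly, Polynomial.coeff_map]

theorem map_factT {A B : Type*} [CommRing A] [CommRing B] (f : A →+* B) (μ s v : ℕ → A) :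
    (factT μ s v).map f = factT (fun j => f (μ j)) (fun j => f (s j)) fun j => f (v j) := by
  ext i j
  simp only [factT, Matrix.map_apply, map_mul, ← map_hankelPoly, map_momFun, Polynomial.map_mul,
    Polynomial.map_pow, Polynomial.map_X]

theorem exists_factorization (h : ∀ n, atau E ρ n t ≠ 0) :
    ∃ S T, IsLowerFactorization (amom E ρ t) S T := by
  have hs : ∀ n, ∃ s : ℂ, s ^ 2 * atau E ρ (n + 1) t = atau E ρ n t := fun n => by
    obtain ⟨s, hs⟩ := IsAlgClosed.exists_pow_nat_eq (atau E ρ n t / atau E ρ (n + 1) t)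
      (two_pos : 0 < 2)
    exact ⟨s, by rw [hs, div_mul_cancel₀ _ (h (n + 1))]⟩
  choose s hs using hs
  simp only [atau_eq_hankel] at h hs
  exact ⟨_, _, (isLowerFactorization_fact (amom_eq t) s (fun n => (hankel (amu E ρ t) n)⁻¹)
    (fun n => inv_mul_cancel₀ (h n)) hs).1⟩

variable (hρ : IsWeight E ρ) (hE : E ⊆ Set.Icc (-R) R) (ht : ConvergesOn R t)

include hρ hE ht

theorem IsWeight.integral_atau (n : ℕ) :
    IntegrableOn (fun x : Fin n → ℝ => (vandermondeSq x : ℂ) * ∏ k, weightT ρ t (x k))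
      (Set.univ.pi fun _ => E) ∧
    atau E ρ n t = (1 / (n.factorial : ℂ)) * ∫ x in Set.univ.pi fun _ : Fin n => E,
      (vandermondeSq x : ℂ) * ∏ k, weightT ρ t (x k) := by
  have hg : ∀ (k : Fin n) (j : ℕ), IntegrableOn (fun u : ℝ => (u : ℂ) ^ j * weightT ρ t u) E :=
    fun _ j => hρ.integrableOn_mul_weightT hE ht (by fun_prop)
  refine ⟨integrableOn_vandermondeSq_mul_prod hg, ?_⟩
  have h : ∫ x in Set.univ.pi fun _ : Fin n => E, (vandermondeSq x : ℂ) * ∏ k, weightT ρ t (x k) =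
      n.factorial * hankel (amu E ρ t) n :=
    (integral_vandermondeSq_mul_prod hg).trans (sum_perm_prod_eq_hankel (amu E ρ t) n)
  rw [h, atau_eq_hankel, one_div, inv_mul_cancel_left₀ (Nat.cast_ne_zero.mpr n.factorial_ne_zero)]

omit hρ hE ht in
theorem weightT_of_real (hr : ∀ i, (t i).im = 0) (u : ℝ) :
    weightT ρ t u = ((ρ u * Real.exp (timeSum t u).re : ℝ) : ℂ) := by
  have h : timeSum t u = ((timeSum t u).re : ℂ) := by
    have h1 : ∀ i : ℕ+, t i * (u : ℂ) ^ (i : ℕ) = (((t i).re * u ^ (i : ℕ) : ℝ) : ℂ) := fun i => by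
      rw [Complex.ofReal_mul, Complex.ofReal_pow]
      congr 1
      exact Complex.ext (by simp) (by simp [hr])
    rw [timeSum, tsum_congr h1, ← Complex.ofReal_tsum, Complex.ofReal_re]
  rw [weightT, h, Complex.ofReal_mul, Complex.ofReal_exp, Complex.ofReal_re]

/-- The exponential is positive and leaves the support of ρ unchanged; positivity at t = 0 then
applies at every real t. -/
theorem IsWeight.mul_exp (hr : ∀ i, (t i).im = 0) :
    IsWeight E fun u => ρ u * Real.exp (timeSum t u).re := by
  have hm : ∀ k : ℕ, IntegrableOn (fun u => u ^ k * (ρ u * Real.exp (timeSum t u).re)) E :=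
    fun k => by
      have h := (hρ.integrableOn_mul_weightT hE ht (c := fun u => (u : ℂ) ^ k) (by fun_prop)).re
      refine h.congr (Filter.Eventually.of_forall fun u => ?_)
      simp only [weightT_of_real hr, ← Complex.ofReal_pow, ← Complex.ofReal_mul]
      exact Complex.ofReal_re _
  have h0 : ∀ u ∈ E, 0 ≤ ρ u * Real.exp (timeSum t u).re := fun u hu =>
    mul_nonneg (hρ.nonneg u hu) (Real.exp_pos _).le
  refine ⟨hρ.meas, h0, hm, ?_⟩
  have hae : ∀ {f : ℝ → ℝ}, (∀ u ∈ E, 0 ≤ f u) → 0 ≤ᵐ[volume.restrict E] f := fun h => by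
    filter_upwards [ae_restrict_mem hρ.meas] with u hu using h u hu
  have h1 := hρ.pos
  rw [setIntegral_pos_iff_support_of_nonneg_ae (hae hρ.nonneg)
    (by simpa using hρ.moments 0)] at h1
  rw [setIntegral_pos_iff_support_of_nonneg_ae (hae h0) (by simpa using hm 0)]
  refine h1.trans_eq (congrArg (fun s => volume (s ∩ E)) ?_)
  ext u
  simp [(Real.exp_pos _).ne']

theorem IsWeight.exists_real_factorization (hr : ∀ i, (t i).im = 0) :
    (∀ n, 0 < (atau E ρ n t).re ∧ (atau E ρ n t).im = 0) ∧
    ∃ S T : Matrix ℕ ℕ ℝ, (∀ n, 0 < S n n) ∧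
      IsLowerFactorization (amom E ρ t) (S.map Complex.ofReal) (T.map Complex.ofReal) := by
  set μ : ℕ → ℝ := fun j => ∫ u in E, u ^ j * (ρ u * Real.exp (timeSum t u).re) with hμ
  have hpos : ∀ n, 0 < hankel μ n := (hρ.mul_exp hE ht hr).hankel_pos
  have hc : amu E ρ t = fun j => Complex.ofRealHom (μ j) := by
    ext1 j
    simp only [amu, weightT_of_real hr, ← Complex.ofReal_pow, ← Complex.ofReal_mul]
    exact integral_ofReal
  have hτ : ∀ n, hankel (amu E ρ t) n = ((hankel μ n : ℝ) : ℂ) := fun n => by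
    rw [hc]
    exact (map_hankel Complex.ofRealHom μ n).symm
  refine ⟨fun n => ?_, ?_⟩
  · rw [atau_eq_hankel, hτ, Complex.ofReal_re, Complex.ofReal_im]
    exact ⟨hpos n, rfl⟩
  · set s : ℕ → ℝ := fun n => √(hankel μ n / hankel μ (n + 1))
    have hs : ∀ n, 0 < s n := fun n => Real.sqrt_pos.mpr (div_pos (hpos n) (hpos (n + 1)))
    have hs2 : ∀ n, s n ^ 2 * hankel μ (n + 1) = hankel μ n := fun n => by
      rw [Real.sq_sqrt (div_pos (hpos n) (hpos (n + 1))).le, div_mul_cancel₀ _ (hpos (n + 1)).ne']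
    have hv : ∀ n, (hankel μ n)⁻¹ * hankel μ n = 1 := fun n => inv_mul_cancel₀ (hpos n).ne'
    refine ⟨factS μ s fun n => (hankel μ n)⁻¹, factT μ s fun n => (hankel μ n)⁻¹, fun n => ?_, ?_⟩
    · rw [(isLowerFactorization_fact (m := fun i j => μ (i + j)) (fun _ _ => rfl) s _ hv hs2).2]
      exact hs n
    -- The construction is repeated over ℂ with the same roots; it commutes with the inclusion of ℝ,
    -- so its matrices are the complexified real ones.
    · have h := (isLowerFactorization_fact (amom_eq t) (fun n => (s n : ℂ))
        (fun n => (((hankel μ n)⁻¹ : ℝ) : ℂ))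
        (fun n => by rw [hτ]; exact_mod_cast hv n)
        (fun n => by rw [hτ, hτ]; exact_mod_cast hs2 n)).1
      have h1 := map_factS Complex.ofRealHom μ s fun n => (hankel μ n)⁻¹
      have h2 := map_factT Complex.ofRealHom μ s fun n => (hankel μ n)⁻¹
      rw [← hc] at h1 h2
      change (factS μ s _).map Complex.ofReal = _ at h1
      change (factT μ s _).map Complex.ofReal = _ at h2
      rw [h1, h2]
      exact h

end AnalyticFactorization

/-! ### Orthogonal polynomials and Stieltjes transforms at complex times. -/

section AnalyticIdentities

variable {E : Set ℝ} {ρ : ℝ → ℝ} {R : ℝ} {t : Times} {S T : Matrix ℕ ℕ ℂ}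

theorem norm_inv_mul_lt {R : ℝ} (hR : 0 < R) {z : ℂ} (hz : R < ‖z‖) : ‖z⁻¹‖ * R < 1 := by
  rw [norm_inv, inv_mul_lt_iff₀ (hR.trans hz), mul_one]
  exact hz

variable (hρ : IsWeight E ρ) (hE : E ⊆ Set.Icc (-R) R) (ht : ConvergesOn R t)
include hρ hE ht

theorem IsWeight.eval_hankelPoly_eq (n : ℕ) {z : ℂ} (hz : R < ‖z‖) :
    (hankelPoly (amu E ρ t) n).eval z = z ^ n * atau E ρ n (t - bracketPt z⁻¹) := by
  have hR := hρ.radius_pos hE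
  have hz0 : z ≠ 0 := norm_pos_iff.mp (hR.trans hz)
  have h : amu E ρ (t - bracketPt z⁻¹) = fun j => amu E ρ t j - z⁻¹ * amu E ρ t (j + 1) :=
    funext (hρ.amu_sub_bracketPt hE ht (norm_inv_mul_lt hR hz))
  rw [atau_eq_hankel, h, hankel_sub_shift, Finset.mul_sum,
    Polynomial.eval_eq_sum_range' (Nat.lt_succ_of_le (natDegree_hankelPoly_le _ n)),
    Finset.sum_range]
  refine Finset.sum_congr rfl fun j _ => ?_
  rw [mul_left_comm]
  congr 1
  rw [inv_pow, ← div_eq_mul_inv, eq_div_iff (pow_ne_zero _ hz0), ← pow_add]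
  congr 1
  lia

theorem IsWeight.momFun_hankelPoly_eq (n : ℕ) {z : ℂ} (hz : R < ‖z‖) :
    momFun (amu E ρ (t + bracketPt z⁻¹)) (hankelPoly (amu E ρ t) n) =
      z⁻¹ ^ n * atau E ρ (n + 1) (t + bracketPt z⁻¹) := by
  rw [atau_eq_hankel, pow_mul_hankel_of_sub_shift_eq _ _ _
    (hρ.amu_add_bracketPt hE ht (norm_inv_mul_lt (hρ.radius_pos hE) hz))]

variable (hf : IsLowerFactorization (amom E ρ t) S T)
include hf

omit hρ hE ht in
theorem atau_ne_zero (n : ℕ) : atau E ρ n t ≠ 0 := by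
  rw [atau_eq_hankel]
  exact (hf.isUnit_hankel (amom_eq t) n).ne_zero

omit hρ hE ht in
theorem analytic_S_sq (n : ℕ) : S n n ^ 2 = atau E ρ n t / atau E ρ (n + 1) t := by
  rw [eq_div_iff (atau_ne_zero hf _), atau_eq_hankel, atau_eq_hankel, hf.S_sq_mul (amom_eq t)]

omit hρ hE ht in
theorem analytic_pPoly_eq (n : ℕ) :
    pPoly S n = Polynomial.C (S n n / atau E ρ n t) * hankelPoly (amu E ρ t) n := by
  have h := hf.hankel_mul_pPoly (amom_eq t) n
  rw [← atau_eq_hankel] at h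
  rw [div_eq_inv_mul, Polynomial.C_mul, mul_assoc, ← h, ← mul_assoc, ← Polynomial.C_mul,
    inv_mul_cancel₀ (atau_ne_zero hf n), Polynomial.C_1, one_mul]

theorem IsWeight.eval_pPoly (n : ℕ) {z : ℂ} (hz : R < ‖z‖) : (pPoly S n).eval z =
    z ^ n * S n n * (atau E ρ n (t - bracketPt z⁻¹) / atau E ρ n t) := by
  rw [analytic_pPoly_eq hf, Polynomial.eval_mul, Polynomial.eval_C,
    hρ.eval_hankelPoly_eq hE ht n hz]
  ring

theorem IsWeight.aq_eq_atau (n : ℕ) {z : ℂ} (hz : R < ‖z‖) : aq E ρ t S n z =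
    z⁻¹ ^ n * S n n * (atau E ρ (n + 1) (t + bracketPt z⁻¹) / atau E ρ n t) := by
  rw [hρ.aq_eq hE ht S n hz, analytic_pPoly_eq hf, Polynomial.C_mul', map_smul,
    hρ.momFun_hankelPoly_eq hE ht n hz, smul_eq_mul]
  ring

omit hρ hE ht in
theorem iact_lax_eval (n : ℕ) (z : ℂ) :
    iact (lax S T) (fun k => (pPoly S k).eval z) n = z * (pPoly S n).eval z := by
  have h := hf.iact_lax_momFun (Polynomial.leval z) n
  simpa using h

theorem IsWeight.iact_lax_aq {n : ℕ} {z : ℂ} (hz : R < ‖z‖) (hn : 1 ≤ n) :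
    iact (lax S T) (fun k => aq E ρ t S k z) n = z * aq E ρ t S n z := by
  have hR := hρ.radius_pos hE
  simp only [hρ.aq_eq hE ht S _ hz]
  exact iact_lax_stieltjes hf (amom_eq t) _ z z⁻¹
    (mul_inv_cancel₀ (norm_pos_iff.mp (hR.trans hz)))
    (hρ.amu_add_bracketPt hE ht (norm_inv_mul_lt hR hz)) hn

theorem IsWeight.linearIndependent_aq {z : ℂ} (hz : R < ‖z‖) :
    LinearIndependent ℂ ![fun n => (pPoly S n).eval z, fun n => aq E ρ t S n z] := by
  have hR := hρ.radius_pos hE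
  simp only [hρ.aq_eq hE ht S _ hz]
  exact linearIndependent_pPoly_stieltjes hf (amom_eq t) _ z z⁻¹
    (mul_inv_cancel₀ (norm_pos_iff.mp (hR.trans hz)))
    (hρ.amu_add_bracketPt hE ht (norm_inv_mul_lt hR hz)) Function.injective_id

theorem IsWeight.integral_pPoly_mul_pPoly (m n : ℕ) :
    (∫ u in E, (pPoly S m).eval (u : ℂ) * (pPoly S n).eval (u : ℂ) * weightT ρ t u) =
      if m = n then 1 else 0 := by
  rw [← hf.momFun_pPoly_mul_pPoly (amom_eq t) m n, ← hρ.integral_eval_mul_weightT hE ht]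
  simp only [Polynomial.eval_mul]

omit hf in
/-- The moments of `t + [w]` as power series in `w`. -/
theorem IsWeight.hasSum_amu_mul_pow {w : ℂ} (hw : ‖w‖ * R < 1) (k : ℕ) :
    HasSum (fun j => amu E ρ t (k + j) * w ^ j) (amu E ρ (t + bracketPt w) k) := by
  have hR := hρ.radius_pos hE
  have hb := ht.add hR.le (convergesOn_bracketPt hR.le hw)
  set ν := amu E ρ (t + bracketPt w)
  -- The partial sums telescope, and the remainder decays geometrically because the moments grow at
  -- most like R^j and ‖w‖ R < 1.
  have hr : ∀ N, ∑ j ∈ Finset.range N, amu E ρ t (k + j) * w ^ j = ν k - w ^ N * ν (k + N) := by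
    intro N
    induction N with
    | zero => simp
    | succ N ih =>
      rw [Finset.sum_range_succ, ih, ← hρ.amu_add_bracketPt hE ht hw, ← add_assoc]
      change _ - _ + (ν _ - w * ν _) * _ = _
      ring
  have hgeo : ∀ {s : Times} {M : ℝ}, (∀ j, ‖amu E ρ s j‖ ≤ M * R ^ j) →
      ∀ j, ‖amu E ρ s (k + j) * w ^ j‖ ≤ M * R ^ k * (‖w‖ * R) ^ j := fun {s M} hM j => by
    rw [norm_mul, norm_pow]
    refine (mul_le_mul_of_nonneg_right (hM _) (by positivity)).trans_eq ?_
    ring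
  obtain ⟨M, hM⟩ := hρ.exists_norm_amu_le hE ht
  obtain ⟨M', hM'⟩ := hρ.exists_norm_amu_le hE hb
  have hs := (summable_geometric_of_lt_one (mul_nonneg (norm_nonneg w) hR.le) hw)
  rw [hasSum_iff_tendsto_nat_of_summable_norm
    (Summable.of_nonneg_of_le (fun _ => norm_nonneg _) (hgeo hM) (hs.mul_left _))]
  simp only [hr]
  have h0 : Filter.Tendsto (fun N => w ^ N * ν (k + N)) Filter.atTop (nhds 0) := by
    refine squeeze_zero_norm (fun N => ?_) ((hs.mul_left (M' * R ^ k)).tendsto_atTop_zero)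
    rw [mul_comm]
    exact hgeo hM' N
  simpa using tendsto_const_nhds.sub h0

/-- The coefficient of z^{-j} is the pairing of p_n with u^j, an entry of S m = Tᵀ. -/
theorem IsWeight.hasSum_aq (n : ℕ) {z : ℂ} (hz : R < ‖z‖) :
    HasSum (fun j => T.transpose n j * z⁻¹ ^ j) (aq E ρ t S n z) := by
  have hw := norm_inv_mul_lt (hρ.radius_pos hE) hz
  rw [hρ.aq_eq hE ht S n hz, momFun_eq_sum_range _ _ (Nat.lt_succ_self _)]
  refine (hasSum_sum fun k (_ : k ∈ Finset.range ((pPoly S n).natDegree + 1)) =>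
    (hρ.hasSum_amu_mul_pow hE ht hw k).const_smul ((pPoly S n).coeff k)).congr_fun fun j => ?_
  rw [Matrix.transpose_apply, ← hf.momFun_pPoly_mul_X_pow (amom_eq t), momFun_mul_X_pow,
    momFun_eq_sum_range _ _ (Nat.lt_succ_self _), Finset.sum_mul]
  simp only [smul_eq_mul, mul_assoc]

end AnalyticIdentities

/-! ### Differentiation of the moments with respect to complex times. -/

section Derivatives

/-- If a derivation computes the derivative on generators, it does so on all polynomials; this links
the algebraic flows with analytic ones. -/
theorem hasDerivAt_aeval {ι : Type*} {ν : ℂ → ι → ℂ} {s₀ : ℂ}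
    (D : Derivation ℂ (MvPolynomial ι ℂ) (MvPolynomial ι ℂ))
    (h : ∀ i, HasDerivAt (fun s => ν s i) (MvPolynomial.aeval (ν s₀) (D (MvPolynomial.X i))) s₀)
    (f : MvPolynomial ι ℂ) :
    HasDerivAt (fun s => MvPolynomial.aeval (ν s) f) (MvPolynomial.aeval (ν s₀) (D f)) s₀ := by
  induction f using MvPolynomial.induction_on with
  | C a =>
    simp only [← MvPolynomial.algebraMap_eq, Derivation.map_algebraMap,
      map_zero]
    simpa using hasDerivAt_const s₀ a
  | add p q hp hq =>
    simp only [map_add]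
    exact hp.add hq
  | mul_X p i hp =>
    simp only [map_mul, MvPolynomial.aeval_X, Derivation.leibniz, smul_eq_mul, map_add]
    refine (hp.mul (h i)).congr_deriv ?_
    ring

theorem differentiable_aeval {H ι : Type*} [NormedAddCommGroup H] [NormedSpace ℂ H] {ν : H → ι → ℂ}
    (h : ∀ i, Differentiable ℂ fun s => ν s i) (f : MvPolynomial ι ℂ) :
    Differentiable ℂ fun s => MvPolynomial.aeval (ν s) f := by
  induction f using MvPolynomial.induction_on with
  | C a => simp
  | add p q hp hq =>
    simp only [map_add]
    exact hp.add hq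
  | mul_X p i hp =>
    simp only [map_mul, MvPolynomial.aeval_X]
    exact hp.mul (h i)

variable {E : Set ℝ} {ρ : ℝ → ℝ} {R : ℝ} (hρ : IsWeight E ρ) (hE : E ⊆ Set.Icc (-R) R)
include hρ hE

/-- Differentiation under the integral with an exponent linear in s. The parameter space H is ℂ for
one time and ℂ^N for joint differentiability in N times. -/
theorem IsWeight.hasFDerivAt_integral_exp {H : Type*} [NormedAddCommGroup H] [NormedSpace ℂ H]
    {c : ℝ → ℂ} (hc : ContinuousOn c (Set.Icc (-R) R)) {p : ℝ → H →L[ℂ] ℂ}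
    (hp : ContinuousOn p (Set.Icc (-R) R)) (s₀ : H) :
    HasFDerivAt (fun s => ∫ u in E, (ρ u : ℂ) • (c u * Complex.exp (p u s)))
      (∫ u in E, (ρ u : ℂ) • ((c u * Complex.exp (p u s₀)) • p u)) s₀ := by
  have hce : ∀ s, ContinuousOn (fun u => c u * Complex.exp (p u s)) (Set.Icc (-R) R) := fun s =>
    hc.mul (hp.clm_apply continuousOn_const).cexp
  obtain ⟨M, hM⟩ := isCompact_Icc.exists_bound_of_continuousOn hc
  obtain ⟨N, hN⟩ := isCompact_Icc.exists_bound_of_continuousOn hp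
  have hi := (hρ.integrableOn_smul hE (c := fun _ => (1 : ℂ)) continuousOn_const).norm
  simp only [smul_eq_mul, mul_one] at hi
  refine hasFDerivAt_integral_of_dominated_of_fderiv_le
    -- On the unit ball about s₀ the exponent is at most N (‖s₀‖ + 1), with M and N bounding c and p
    -- on the compact interval.
    (bound := fun u => ‖(ρ u : ℂ)‖ * (M * Real.exp (N * (‖s₀‖ + 1)) * N))
    (F' := fun s u => (ρ u : ℂ) • ((c u * Complex.exp (p u s)) • p u))
    (Metric.ball_mem_nhds s₀ one_pos) ?_ ?_ ?_ ?_ (hi.mul_const _) ?_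
  · exact Filter.Eventually.of_forall fun s =>
      (hρ.integrableOn_smul hE (hce s)).aestronglyMeasurable
  · exact hρ.integrableOn_smul hE (hce s₀)
  · exact (hρ.integrableOn_smul hE ((hce s₀).smul hp)).aestronglyMeasurable
  · filter_upwards [ae_restrict_mem hρ.meas] with u hu s hs
    have h1 := hM u (hE hu)
    have h2 := hN u (hE hu)
    have h3 : ‖s‖ ≤ ‖s₀‖ + 1 := by
      have := norm_sub_norm_le s s₀
      rw [mem_ball_iff_norm] at hs
      linarith
    have h4 : (p u s).re ≤ N * (‖s₀‖ + 1) :=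
      ((Complex.re_le_norm _).trans ((p u).le_opNorm s)).trans
        (mul_le_mul h2 h3 (norm_nonneg _) ((norm_nonneg _).trans h2))
    rw [norm_smul, norm_smul, norm_mul, Complex.norm_exp]
    have h5 := (norm_nonneg _).trans h1
    gcongr
  · filter_upwards with u s _
    have h1 := ((p u).hasFDerivAt (x := s)).cexp.const_mul (c u)
    have h2 := h1.const_smul (ρ u : ℂ)
    rw [mul_smul]
    exact h2

theorem IsWeight.amu_add_eq {t t' : Times} (ht : ConvergesOn R t) (ht' : ConvergesOn R t') (j : ℕ) :
    amu E ρ (t + t') j = ∫ u in E, (ρ u : ℂ) •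
      ((u : ℂ) ^ j * Complex.exp (timeSum t u) * Complex.exp (timeSum t' u)) := by
  refine setIntegral_congr_fun hρ.meas fun u hu => ?_
  simp only [weightT_add hE ht ht' hu]
  simp only [weightT, smul_eq_mul]
  ring

theorem IsWeight.differentiable_amu {t : Times} (ht : ConvergesOn R t) (N j : ℕ) :
    Differentiable ℂ fun s : Fin N → ℂ =>
      amu E ρ (t + ∑ i : Fin N, Pi.single (Nat.succPNat i) (s i)) j := by
  have hR := (hρ.radius_pos hE).le
  set p : ℝ → (Fin N → ℂ) →L[ℂ] ℂ := fun u =>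
    ∑ i : Fin N, (u : ℂ) ^ ((i : ℕ) + 1) • ContinuousLinearMap.proj i with hp
  have hpc : ContinuousOn p (Set.Icc (-R) R) := by
    rw [hp]
    fun_prop
  have hc : ContinuousOn (fun u : ℝ => (u : ℂ) ^ j * Complex.exp (timeSum t u)) (Set.Icc (-R) R) :=
    (by fun_prop : ContinuousOn (fun u : ℝ => (u : ℂ) ^ j) _).mul ht.continuousOn_timeSum_ofReal.cexp
  intro s₀
  refine (hρ.hasFDerivAt_integral_exp hE hc hpc s₀).differentiableAt.congr_of_eventuallyEq
    (Filter.Eventually.of_forall fun s => ?_)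
  simp only []
  rw [hρ.amu_add_eq hE ht (convergesOn_sum_single hR s)]
  refine setIntegral_congr_fun hρ.meas fun u hu => ?_
  simp only [timeSum_sum_single hR (norm_ofReal_le_of_mem_Icc (hE hu)), hp,
    sum_apply, smul_apply, ContinuousLinearMap.proj_apply,
    smul_eq_mul]
  simp only [mul_comm]

theorem IsWeight.differentiable_atau {t : Times} (ht : ConvergesOn R t) (n N : ℕ) :
    Differentiable ℂ fun s : Fin N → ℂ =>
      atau E ρ n (t + ∑ i : Fin N, Pi.single (Nat.succPNat i) (s i)) := by
  have h : ∀ t', atau E ρ n t' = MvPolynomial.aeval (amu E ρ t') (uTau ℂ n) := fun t' => by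
    rw [aeval_hankel, atau_eq_hankel]
  simp only [h]
  exact differentiable_aeval (hρ.differentiable_amu hE ht N) _

theorem IsWeight.hasDerivAt_amu {t : Times} (ht : ConvergesOn R t) (k : ℕ+) (j : ℕ) :
    HasDerivAt (fun s => amu E ρ (addAt t k s) j) (amu E ρ t (j + k)) 0 := by
  set p : ℝ → ℂ →L[ℂ] ℂ := fun u => (u : ℂ) ^ (k : ℕ) • ContinuousLinearMap.id ℂ ℂ with hp
  have hpc : ContinuousOn p (Set.Icc (-R) R) := by
    rw [hp]
    fun_prop
  have hc : ContinuousOn (fun u : ℝ => (u : ℂ) ^ j * Complex.exp (timeSum t u)) (Set.Icc (-R) R) :=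
    (by fun_prop : ContinuousOn (fun u : ℝ => (u : ℂ) ^ j) _).mul ht.continuousOn_timeSum_ofReal.cexp
  have h := (hρ.hasFDerivAt_integral_exp hE hc hpc 0).hasDerivAt
  have hi : IntegrableOn (fun u => (ρ u : ℂ) • (((u : ℂ) ^ j * Complex.exp (timeSum t u) *
      Complex.exp (p u 0)) • p u)) E := by
    refine hρ.integrableOn_smul hE (ContinuousOn.smul (hc.mul ?_) hpc)
    exact (hpc.clm_apply continuousOn_const).cexp
  rw [ContinuousLinearMap.integral_apply hi] at h
  refine (h.congr_of_eventuallyEq (Filter.Eventually.of_forall fun s => ?_)).congr_deriv ?_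
  · simp only [addAt]
    rw [hρ.amu_add_eq hE ht (convergesOn_single R k s)]
    simp only [timeSum_single, hp, smul_apply, ContinuousLinearMap.id_apply,
      smul_eq_mul, mul_comm s]
  · rw [amu]
    congr 1
    ext1 u
    simp only [hp, weightT, map_zero, Complex.exp_zero, smul_apply,
      ContinuousLinearMap.id_apply, smul_eq_mul]
    ring

theorem IsWeight.hasDerivAt_aeval_amu {t : Times} (ht : ConvergesOn R t) (k : ℕ+)
    (f : MvPolynomial ℕ ℂ) :
    HasDerivAt (fun s => MvPolynomial.aeval (amu E ρ (addAt t k s)) f)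
      (MvPolynomial.aeval (amu E ρ t) (umD ℂ k f)) 0 := by
  have h0 : addAt t k 0 = t := by simp [addAt]
  have h := hasDerivAt_aeval (ν := fun s => amu E ρ (addAt t k s)) (s₀ := 0) (umD ℂ k)
    (fun j => by
      rw [h0, umD_X, MvPolynomial.aeval_X]
      exact hρ.hasDerivAt_amu hE ht k j) f
  rwa [h0] at h

end Derivatives

/-! ### The KP hierarchy at complex times. -/

section AnalyticHirota

variable {E : Set ℝ} {ρ : ℝ → ℝ} {R : ℝ} (hρ : IsWeight E ρ) (hE : E ⊆ Set.Icc (-R) R)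
include hρ hE

/-- The moments of `t + y` and of `t - y`. -/
def amuPair (E : Set ℝ) (ρ : ℝ → ℝ) (t y : Times) : ℕ ⊕ ℕ → ℂ :=
  Sum.elim (amu E ρ (t + y)) (amu E ρ (t - y))

omit hρ hE in
theorem aeval_hirotaPair (t y : Times) (n : ℕ) :
    MvPolynomial.aeval (amuPair E ρ t y) (hirotaPair ℂ n) =
      hankel (amu E ρ (t + y)) n * hankel (amu E ρ (t - y)) n := by
  have h1 : (MvPolynomial.aeval (amuPair E ρ t y)).comp (hirotaInl ℂ) =
      MvPolynomial.aeval (amu E ρ (t + y)) :=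
    MvPolynomial.algHom_ext fun j => by simp [amuPair, hirotaInl]
  have h2 : (MvPolynomial.aeval (amuPair E ρ t y)).comp (hirotaInr ℂ) =
      MvPolynomial.aeval (amu E ρ (t - y)) :=
    MvPolynomial.algHom_ext fun j => by simp [amuPair, hirotaInr]
  rw [hirotaPair, map_mul, ← aeval_hankel ℂ, ← aeval_hankel ℂ, ← h1, ← h2]
  rfl

theorem IsWeight.hasDerivAt_aeval_amuPair {t y : Times} (ht : ConvergesOn R t)
    (hy : ConvergesOn R y) (k : ℕ+) (f : MvPolynomial (ℕ ⊕ ℕ) ℂ) :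
    HasDerivAt (fun s => MvPolynomial.aeval (amuPair E ρ t (addAt y k s)) f)
      (MvPolynomial.aeval (amuPair E ρ t y) (hirotaD ℂ k f)) 0 := by
  have hR := (hρ.radius_pos hE).le
  have h0 : addAt y k 0 = y := by simp [addAt]
  have h := hasDerivAt_aeval (ν := fun s => amuPair E ρ t (addAt y k s)) (s₀ := 0) (hirotaD ℂ k)
    (fun j => by
      rw [h0]
      rcases j with j | j
      · rw [hirotaD_inl, MvPolynomial.aeval_X]
        have h1 : ∀ s, t + addAt y k s = addAt (t + y) k s := fun s => (add_assoc t y _).symm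
        simp only [amuPair, Sum.elim_inl, h1]
        exact hρ.hasDerivAt_amu hE (ht.add hR hy) k j
      · rw [hirotaD_inr, map_neg, MvPolynomial.aeval_X]
        have h1 : ∀ s, t - addAt y k s = addAt (t - y) k (-s) := fun s => by
          rw [addAt, addAt, Pi.single_neg]
          abel
        simp only [amuPair, Sum.elim_inr, h1]
        have h2 := hρ.hasDerivAt_amu hE (ht.sub hR hy) k j
        rw [← neg_zero] at h2
        refine (h2.scomp 0 (hasDerivAt_neg 0)).congr_deriv ?_
        rw [neg_one_smul]) f
  rwa [h0] at h

theorem IsWeight.ahirota_kpPoly {t : Times} (ht : ConvergesOn R t) (n k : ℕ) (hn : 1 ≤ n) :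
    ahirota (kpPoly ℂ k) (atau E ρ n) (atau E ρ n) t = 0 := by
  have hR := (hρ.radius_pos hE).le
  -- F is required to agree with the polynomial only at convergent y, a set stable under changing
  -- one time; that suffices for every `apd`.
  set r : (Times → ℂ) → MvPolynomial (ℕ ⊕ ℕ) ℂ → Prop := fun F f =>
    ∀ y, ConvergesOn R y → F y = MvPolynomial.aeval (amuPair E ρ t y) f with hr
  have hrel := polyOp_rel (D := apd) (D' := fun i : ℕ+ => hirotaD ℂ i) r
    (fun y _ => by simp) (fun F G f g hF hG y hy => by simp [hF y hy, hG y hy])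
    (fun c F f hF y hy => by simp [hF y hy])
    (fun i F f hF y hy => by
      rw [apd]
      simp only [hF _ (hy.addAt hR i _)]
      exact (hρ.hasDerivAt_aeval_amuPair hE ht hy i f).deriv)
    (kpPoly ℂ k) (v := fun y => atau E ρ n (t + y) * atau E ρ n (t - y)) (w := hirotaPair ℂ n)
    (fun y _ => by simp only [aeval_hirotaPair, atau_eq_hankel])
  have h := hrel 0 (convergesOn_zero R)
  have h1 : MvPolynomial.aeval (amuPair E ρ t 0) =
      (MvPolynomial.aeval (amu E ρ t)).comp (hirotaEval ℂ) := by
    refine MvPolynomial.algHom_ext fun j => ?_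
    rcases j with j | j <;> simp [amuPair, hirotaEval]
  rw [ahirota, h, h1, AlgHom.comp_apply, hirotaEval_polyOp_kpPoly ℂ n k hn, map_zero]

end AnalyticHirota

/-! ### Logarithmic derivatives of τ_n and the KP equation at complex times. -/

section AnalyticLog

variable {E : Set ℝ} {ρ : ℝ → ℝ} {R : ℝ} {t : Times}

theorem atau_eq_aeval (t : Times) (n : ℕ) :
    atau E ρ n t = MvPolynomial.aeval (amu E ρ t) (uTau ℂ n) := by
  rw [aeval_hankel, atau_eq_hankel]

@[simp] theorem addAt_zero (t : Times) (k : ℕ+) : addAt t k 0 = t := by simp [addAt]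

theorem coeff_X_mul_hankelPoly_amu (t : Times) (n : ℕ) :
    (Polynomial.X * hankelPoly (amu E ρ t) n).coeff n =
      -MvPolynomial.aeval (amu E ρ t) (umD ℂ 1 (uTau ℂ n)) := by
  have h := congrArg (MvPolynomial.aeval (amu E ρ t)) (umD_one_hankel ℂ n)
  rw [map_neg] at h
  rw [← h, ← map_aeval_hankelPoly ℂ]
  have h2 := Polynomial.coeff_map (p := Polynomial.X * uPoly ℂ n)
    (MvPolynomial.aeval (amu E ρ t) : MvPolynomial ℕ ℂ →ₐ[ℂ] ℂ).toRingHom n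
  rw [Polynomial.map_mul, Polynomial.map_X] at h2
  exact h2

theorem coeff_hankelPoly_succ_amu (t : Times) (n : ℕ) :
    (hankelPoly (amu E ρ t) (n + 1)).coeff n =
      -MvPolynomial.aeval (amu E ρ t) (umD ℂ 1 (uTau ℂ (n + 1))) := by
  rw [← coeff_X_mul_hankelPoly_amu, Polynomial.coeff_X_mul]

variable (hρ : IsWeight E ρ) (hE : E ⊆ Set.Icc (-R) R)
include hρ hE

theorem IsWeight.hasDerivAt_atau (ht : ConvergesOn R t) (k : ℕ+) (n : ℕ) :
    HasDerivAt (fun s => atau E ρ n (addAt t k s))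
      (MvPolynomial.aeval (amu E ρ t) (umD ℂ k (uTau ℂ n))) 0 := by
  simp only [atau_eq_aeval]
  exact hρ.hasDerivAt_aeval_amu hE ht k _

theorem IsWeight.lax_diag_eq {S T : Matrix ℕ ℕ ℂ} (ht : ConvergesOn R t)
    (hf : IsLowerFactorization (amom E ρ t) S T) (n : ℕ) : lax S T n n =
      apd 1 (logNear (fun t' => atau E ρ (n + 1) t' / atau E ρ n t') t) t := by
  have h0 := atau_ne_zero hf n
  have h1 := atau_ne_zero hf (n + 1)
  have hd0 := hρ.hasDerivAt_atau hE ht 1 n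
  have hd1 := hρ.hasDerivAt_atau hE ht 1 (n + 1)
  have hL := hf.lax_diag_mul_hankel (amom_eq t) n
  rw [coeff_X_mul_hankelPoly_amu, coeff_hankelPoly_succ_amu, ← atau_eq_hankel,
    ← atau_eq_hankel] at hL
  have hq := (hd1.div hd0 (by rwa [addAt_zero])).div_const (atau E ρ (n + 1) t / atau E ρ n t)
  have hl := hq.clog (by
    simp only [Pi.div_apply, addAt_zero, div_self (div_ne_zero h1 h0)]
    exact Complex.one_mem_slitPlane)
  rw [apd]
  refine Eq.trans ?_ hl.deriv.symm
  simp only [Pi.div_apply, addAt_zero, PNat.val_ofNat]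
  set d0 := MvPolynomial.aeval (amu E ρ t) (umD ℂ 1 (uTau ℂ n))
  set d1 := MvPolynomial.aeval (amu E ρ t) (umD ℂ 1 (uTau ℂ (n + 1)))
  field_simp
  linear_combination hL

/-- The functions `f / τ_n^p`, with `f` a polynomial in the moments, near a zero-free region. -/
def RepOn (E : Set ℝ) (ρ : ℝ → ℝ) (n : ℕ) (Ω : Set Times) (F : Times → ℂ) (a : MvPolynomial ℕ ℂ)
    (p : ℕ) : Prop :=
  ∀ t ∈ Ω, F t = MvPolynomial.aeval (amu E ρ t) a / atau E ρ n t ^ p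

theorem RepOn.apd {n : ℕ} {Ω : Set Times} (hΩ : ∀ t ∈ Ω, ConvergesOn R t ∧ atau E ρ n t ≠ 0)
    {k : ℕ+} (hopen : ∀ t ∈ Ω, ∀ᶠ s in nhds (0 : ℂ), addAt t k s ∈ Ω) {F : Times → ℂ}
    {a : MvPolynomial ℕ ℂ} {p : ℕ} (h : RepOn E ρ n Ω F a p) :
    RepOn E ρ n Ω (apd k F) (quotD ℂ (uTau ℂ n) k p a) (p + 1) := by
  intro t ht
  obtain ⟨hc, h0⟩ := hΩ t ht
  have hd := (hρ.hasDerivAt_aeval_amu hE hc k a).div ((hρ.hasDerivAt_atau hE hc k n).pow p)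
    (by simpa using fun h' => absurd h' h0)
  have hd2 := hd.congr_of_eventuallyEq (f₁ := fun s => F (addAt t k s))
    ((hopen t ht).mono fun s hs => h _ hs)
  rw [TodaKP.apd]
  refine hd2.deriv.trans ?_
  simp only [Pi.pow_apply, addAt_zero, quotD, map_sub, map_mul, map_natCast, ← atau_eq_aeval]
  cases p with
  | zero => field_simp; simp
  | succ p =>
    rw [Nat.add_sub_cancel]
    field_simp
    ring

theorem IsWeight.analytic_kp (ht : ConvergesOn R t) {n : ℕ} (hn : 1 ≤ n) (h0 : atau E ρ n t ≠ 0) :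
    apd 1 (apd 1 (apd 1 (apd 1 (logNear (atau E ρ n) t)))) t
      + 3 * apd 2 (apd 2 (logNear (atau E ρ n) t)) t
      - 4 * apd 1 (apd 3 (logNear (atau E ρ n) t)) t
      + 6 * (apd 1 (apd 1 (logNear (atau E ρ n) t)) t) ^ 2 = 0 := by
  have hR := (hρ.radius_pos hE).le
  -- Here the principal logarithm is differentiable, and small changes of any single time stay
  -- inside, so iterated derivatives can be computed on Ω.
  set Ω : Set Times := {s | ConvergesOn R s ∧ atau E ρ n s / atau E ρ n t ∈ Complex.slitPlane}
  have hΩ : ∀ s ∈ Ω, ConvergesOn R s ∧ atau E ρ n s ≠ 0 := fun s hs =>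
    ⟨hs.1, fun h => Complex.slitPlane_ne_zero hs.2 (by rw [h, zero_div])⟩
  have hopen : ∀ k : ℕ+, ∀ s ∈ Ω, ∀ᶠ x in nhds (0 : ℂ), addAt s k x ∈ Ω := fun k s hs => by
    have hc := ((hρ.hasDerivAt_atau hE hs.1 k n).div_const (atau E ρ n t)).continuousAt
    have := hc.preimage_mem_nhds (Complex.isOpen_slitPlane.mem_nhds (by simpa using hs.2))
    filter_upwards [this] with x hx
    exact ⟨hs.1.addAt hR k x, hx⟩
  have htΩ : t ∈ Ω := ⟨ht, by rw [div_self h0]; exact Complex.one_mem_slitPlane⟩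
  have hlog : ∀ k : ℕ+, RepOn E ρ n Ω (apd k (logNear (atau E ρ n) t)) (umD ℂ k (uTau ℂ n)) 1 :=
    fun k s hs => by
      have hd := ((hρ.hasDerivAt_atau hE hs.1 k n).div_const (atau E ρ n t)).clog
        (by simpa using hs.2)
      refine hd.deriv.trans ?_
      rw [addAt_zero, pow_one, div_div_div_cancel_right₀ h0]
  have h := congrArg (MvPolynomial.aeval (amu E ρ t)) (kp_numerator ℂ n hn)
  simp only [map_add, map_sub, map_mul, map_pow, map_zero, map_ofNat, ← atau_eq_aeval] at h
  have hst : ∀ (k : ℕ+) {F a p}, RepOn E ρ n Ω F a p →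
      RepOn E ρ n Ω (apd k F) (quotD ℂ (uTau ℂ n) k p a) (p + 1) := fun k _ _ _ h =>
    RepOn.apd hρ hE hΩ (hopen k) h
  rw [hst 1 (hst 1 (hst 1 (hlog 1))) t htΩ, hst 2 (hlog 2) t htΩ, hst 1 (hlog 3) t htΩ,
    hst 1 (hlog 1) t htΩ]
  simp only [PNat.val_ofNat, Nat.reduceAdd]
  field_simp
  linear_combination h

end AnalyticLog

/-! ### Entrywise derivatives of semi-infinite matrices along a subset of ℂ. -/

section MatrixDerivatives

variable {V : Set ℂ} {M N : ℂ → Matrix ℕ ℕ ℂ} {M' N' : Matrix ℕ ℕ ℂ}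

/-- `M'` is the entrywise derivative of `M` at `0` along `V`. -/
def HasMatDeriv (V : Set ℂ) (M : ℂ → Matrix ℕ ℕ ℂ) (M' : Matrix ℕ ℕ ℂ) : Prop :=
  ∀ i j, HasDerivWithinAt (fun s => M s i j) (M' i j) V 0

/-- The rows of `M'` and of all `M s`, `s ∈ V`, end at the same place. -/
def RowBounded (V : Set ℂ) (M : ℂ → Matrix ℕ ℕ ℂ) (M' : Matrix ℕ ℕ ℂ) : Prop :=
  ∃ b : ℕ → ℕ, ∀ i j, b i ≤ j → M' i j = 0 ∧ ∀ s ∈ V, M s i j = 0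

theorem imul_zero {A : Type*} [CommRing A] (M : Matrix ℕ ℕ A) : imul M 0 = 0 := by
  ext i j
  simp [imul]

theorem hasMatDeriv_const (V : Set ℂ) (P : Matrix ℕ ℕ ℂ) : HasMatDeriv V (fun _ => P) 0 :=
  fun _ _ => hasDerivWithinAt_const _ _ _

theorem HasMatDeriv.sub (hM : HasMatDeriv V M M') (hN : HasMatDeriv V N N') :
    HasMatDeriv V (fun s => M s - N s) (M' - N') := fun i j => (hM i j).sub (hN i j)

theorem HasMatDeriv.smul (c : ℂ) (hM : HasMatDeriv V M M') :
    HasMatDeriv V (fun s => c • M s) (c • M') := fun i j => (hM i j).const_mul c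

theorem HasMatDeriv.skewPart (hM : HasMatDeriv V M M') :
    HasMatDeriv V (fun s => skewPart (M s)) (skewPart M') := fun i j => by
  simp only [TodaKP.skewPart]
  split_ifs
  · exact hM i j
  · exact (hM j i).neg
  · exact hasDerivWithinAt_const _ _ _

/-- Row bounds uniform in s turn each entry into one fixed finite sum, to which the product rule
applies. -/
theorem HasMatDeriv.imul (h0 : (0 : ℂ) ∈ V) (hb : RowBounded V M M') (hM : HasMatDeriv V M M')
    (hN : HasMatDeriv V N N') :
    HasMatDeriv V (fun s => imul (M s) (N s)) (imul M' (N 0) + imul (M 0) N') := fun i j => by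
  obtain ⟨b, hb⟩ := hb
  have hM' : ∀ k ∉ Finset.range (b i), M' i k = 0 := fun k hk => (hb i k (by simpa using hk)).1
  have hMs : ∀ s ∈ V, ∀ k ∉ Finset.range (b i), M s i k = 0 := fun s hs k hk =>
    (hb i k (by simpa using hk)).2 s hs
  have h := HasDerivWithinAt.fun_sum (u := Finset.range (b i)) fun k _ => (hM i k).mul (hN k j)
  rw [Matrix.add_apply, imul_eq_sum hM', imul_eq_sum (hMs 0 h0), ← Finset.sum_add_distrib]
  exact h.congr (fun s hs => imul_eq_sum (hMs s hs) _ _) (imul_eq_sum (hMs 0 h0) _ _)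

theorem RowBounded.imul (h0 : (0 : ℂ) ∈ V) (hM : RowBounded V M M') (hN : RowBounded V N N') :
    RowBounded V (fun s => imul (M s) (N s)) (imul M' (N 0) + imul (M 0) N') := by
  obtain ⟨b, hb⟩ := hM
  obtain ⟨c, hc⟩ := hN
  have hM' : ∀ i, ∀ k ∉ Finset.range (b i), M' i k = 0 := fun i k hk =>
    (hb i k (by simpa using hk)).1
  have hMs : ∀ s ∈ V, ∀ i, ∀ k ∉ Finset.range (b i), M s i k = 0 := fun s hs i k hk =>
    (hb i k (by simpa using hk)).2 s hs
  refine ⟨fun i => (Finset.range (b i)).sup c, fun i j hij => ?_⟩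
  have hcj : ∀ k ∈ Finset.range (b i), c k ≤ j := fun k hk => (Finset.le_sup hk).trans hij
  refine ⟨?_, fun s hs => ?_⟩
  · rw [Matrix.add_apply, imul_eq_sum (hM' i), imul_eq_sum (hMs 0 h0 i), ← Finset.sum_add_distrib]
    refine Finset.sum_eq_zero fun k hk => ?_
    have h := hc k j (hcj k hk)
    rw [h.1, h.2 0 h0, mul_zero, mul_zero, add_zero]
  · refine (imul_eq_sum (hMs s hs i) _ _).trans ?_
    exact Finset.sum_eq_zero fun k hk => by rw [(hc k j (hcj k hk)).2 s hs, mul_zero]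

theorem rowBounded_of_lower (hM' : ∀ i j, i < j → M' i j = 0)
    (hM : ∀ s ∈ V, ∀ i j, i < j → M s i j = 0) : RowBounded V M M' :=
  ⟨fun i => i + 1, fun i j hij => ⟨hM' i j hij, fun s hs => hM s hs i j hij⟩⟩

theorem rowBounded_const (V : Set ℂ) {P : Matrix ℕ ℕ ℂ} (hP : RowFinite P) :
    RowBounded V (fun _ => P) 0 := by
  refine ⟨fun i => (hP i).toFinset.sup fun j => j + 1, fun i j hij => ⟨rfl, fun _ _ => ?_⟩⟩
  by_contra h
  have := Finset.le_sup (f := fun j => j + 1) ((hP i).mem_toFinset.mpr h)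
  lia

theorem RowBounded.smul (c : ℂ) (hM : RowBounded V M M') :
    RowBounded V (fun s => c • M s) (c • M') := by
  obtain ⟨b, hb⟩ := hM
  exact ⟨b, fun i j hij => ⟨by simp [(hb i j hij).1], fun s hs => by simp [(hb i j hij).2 s hs]⟩⟩

theorem RowBounded.skewPart (hM : RowBounded V M M') :
    RowBounded V (fun s => skewPart (M s)) (skewPart M') := by
  obtain ⟨b, hb⟩ := hM
  refine ⟨fun i => max (b i) (i + 1), fun i j hij => ?_⟩
  have h1 : i < j := (le_max_right _ _).trans hij
  have h2 := hb i j ((le_max_left _ _).trans hij)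
  simpa only [TodaKP.skewPart, if_pos h1] using h2

theorem HasMatDeriv.unique (h : AccPt (0 : ℂ) (Filter.principal V)) (hM : HasMatDeriv V M M')
    (hN : HasMatDeriv V N N') (h0 : (0 : ℂ) ∈ V) (he : ∀ s ∈ V, M s = N s) : M' = N' := by
  ext i j
  have hu := uniqueDiffWithinAt_iff_accPt.mpr h
  rw [← (hM i j).derivWithin hu, ← (hN i j).derivWithin hu]
  exact derivWithin_congr (fun s hs => by rw [he s hs]) (by rw [he 0 h0])

/-- The derivatives of the powers of `L` along a Lax flow. -/
theorem hasMatDeriv_ipow {L : ℂ → Matrix ℕ ℕ ℂ} {P : Matrix ℕ ℕ ℂ} (h0 : (0 : ℂ) ∈ V)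
    (hP : RowFinite P) (hL : RowFinite (L 0)) (hb : RowBounded V L (ibracket P (L 0)))
    (hd : HasMatDeriv V L (ibracket P (L 0))) (k : ℕ) :
    RowBounded V (fun s => ipow (L s) k) (ibracket P (ipow (L 0) k)) ∧
      HasMatDeriv V (fun s => ipow (L s) k) (ibracket P (ipow (L 0) k)) := by
  induction k with
  | zero =>
    simp only [ipow, ibracket, imul_one, one_imul, sub_self]
    exact ⟨rowBounded_const V rowFinite_one, hasMatDeriv_const V 1⟩
  | succ k ih =>
    rw [← ibracket_ipow_succ hP hL]
    exact ⟨ih.1.imul h0 hb, HasMatDeriv.imul h0 ih.1 ih.2 hd⟩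

/-- The Leibniz rule for the bracket, the powers of L obeying the same Lax equation as L. -/
theorem hasMatDeriv_todaSkew {L : ℂ → Matrix ℕ ℕ ℂ} (h0 : (0 : ℂ) ∈ V) (l : ℕ)
    (hL : RowFinite (L 0)) (hb : RowBounded V L (todaSkew ℂ (L 0) l))
    (hd : HasMatDeriv V L (todaSkew ℂ (L 0) l)) (k : ℕ) :
    HasMatDeriv V (fun s => todaSkew ℂ (L s) k) (todaSkewDeriv ℂ (L 0) k l) := by
  obtain ⟨h1, h2⟩ := hasMatDeriv_ipow h0 (((rowFinite_ipow hL l).skewPart).smul (2⁻¹ : ℂ)) hL hb hd k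
  have h3 := h1.skewPart.smul (2⁻¹ : ℂ)
  have h4 := h2.skewPart.smul (2⁻¹ : ℂ)
  have h5 := (HasMatDeriv.imul h0 h3 h4 hd).sub (HasMatDeriv.imul h0 hb hd h4)
  refine fun i j => (h5 i j).congr_deriv ?_
  simp only [todaSkewDeriv, ibracket, Matrix.add_apply, Matrix.sub_apply]
  ring

/-- The slope of f is that of g divided by f(s) + f(a), which tends to 2 f(a) ≠ 0. Continuity thus
fixes the branch of the square root and yields its derivative. -/
theorem hasDerivWithinAt_of_sq {f g : ℂ → ℂ} {g' a : ℂ} (hf : ContinuousWithinAt f V a)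
    (h : ∀ s ∈ V, f s ^ 2 = g s) (ha : a ∈ V) (hg : HasDerivWithinAt g g' V a) (h0 : f a ≠ 0) :
    HasDerivWithinAt f (g' / (f a + f a)) V a := by
  rw [hasDerivWithinAt_iff_tendsto_slope] at hg ⊢
  have hf' : Filter.Tendsto (fun s => f s + f a) (nhdsWithin a (V \ {a})) (nhds (f a + f a)) :=
    (hf.mono_left (nhdsWithin_mono a Set.sdiff_subset)).add_const (f a)
  have h2 : f a + f a ≠ 0 := by simpa [← two_mul] using h0
  refine (hg.div hf' h2).congr' ?_
  filter_upwards [hf'.eventually_ne h2, self_mem_nhdsWithin] with s hs hsV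
  simp only [Pi.div_apply, slope, vsub_eq_sub, smul_eq_mul]
  rw [← h s hsV.1, ← h a ha]
  field_simp
  ring

end MatrixDerivatives

/-! ### The Toda equations along a set of complex times. -/

section AnalyticToda

variable {E : Set ℝ} {ρ : ℝ → ℝ} {R : ℝ} (hρ : IsWeight E ρ) (hE : E ⊆ Set.Icc (-R) R)
  {t : Times} (ht : ConvergesOn R t) {k : ℕ+} {V : Set ℂ} {S T : ℂ → Matrix ℕ ℕ ℂ}
  (h0 : (0 : ℂ) ∈ V) (hf : ∀ s ∈ V, IsLowerFactorization (amom E ρ (addAt t k s)) (S s) (T s))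
include hρ hE ht h0 hf

/-- The entries of T are finite combinations of moments with coefficients from S, by S m = Tᵀ. -/
theorem IsWeight.exists_hasMatDeriv_T {S' : Matrix ℕ ℕ ℂ} (hS' : HasMatDeriv V S S') :
    ∃ T', (∀ i j, i < j → T' i j = 0) ∧ HasMatDeriv V T T' := by
  have h : ∀ j n, ∃ d, (j < n → d = 0) ∧ HasDerivWithinAt (fun s => T s j n) d V 0 := by
    intro j n
    rcases lt_or_ge j n with hnj | hnj
    · exact ⟨0, fun _ => rfl, (hasDerivWithinAt_const 0 V (0 : ℂ)).congr
        (fun s hs => (hf s hs).lower_inv j n hnj) ((hf 0 h0).lower_inv j n hnj)⟩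
    · have hT : ∀ s ∈ V, T s j n =
          ∑ i ∈ Finset.range (n + 1), S s n i * amu E ρ (addAt t k s) (i + j) := fun s hs => by
        rw [← (hf s hs).momFun_pPoly_mul_X_pow (amom_eq _), momFun_mul_X_pow, momFun_eq_sum_range _ _
          (Nat.lt_succ_of_le ((hf s hs).natDegree_pPoly_le n))]
        simp only [coeff_pPoly (hf s hs).lower, smul_eq_mul]
      exact ⟨_, fun h => absurd h hnj.not_gt, (HasDerivWithinAt.fun_sum fun i _ => (hS' n i).mul
        (hρ.hasDerivAt_amu hE ht k (i + j)).hasDerivWithinAt).congr hT (hT 0 h0)⟩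
  choose T' hT' using h
  exact ⟨T', fun i j => (hT' i j).1, fun i j => (hT' i j).2⟩

variable (hc : ∀ n, ContinuousWithinAt (fun s => S s n n) V 0)
include hc

theorem IsWeight.hasDerivWithinAt_S_diag (n : ℕ) :
    ∃ d, HasDerivWithinAt (fun s => S s n n) d V 0 := by
  have hg := (hρ.hasDerivAt_atau hE ht k n).div (hρ.hasDerivAt_atau hE ht k (n + 1))
    (atau_ne_zero (hf 0 h0) (n + 1))
  exact ⟨_, hasDerivWithinAt_of_sq (hc n) (fun s hs => analytic_S_sq (hf s hs) n) h0
    hg.hasDerivWithinAt ((hf 0 h0).diag n)⟩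

/-- Row n of S is S_nn / τ_n times polynomials in the moments, so continuity of the diagonal alone
makes S differentiable. -/
theorem IsWeight.exists_hasMatDeriv_S :
    ∃ S', (∀ i j, i < j → S' i j = 0) ∧ HasMatDeriv V S S' := by
  have h : ∀ n j, ∃ d, (n < j → d = 0) ∧ HasDerivWithinAt (fun s => S s n j) d V 0 := by
    intro n j
    rcases lt_or_ge n j with hnj | hnj
    · exact ⟨0, fun _ => rfl, (hasDerivWithinAt_const 0 V (0 : ℂ)).congr
        (fun s hs => (hf s hs).lower n j hnj) ((hf 0 h0).lower n j hnj)⟩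
    · obtain ⟨d, hd⟩ := hρ.hasDerivWithinAt_S_diag hE ht h0 hf hc n
      have hp := hρ.hasDerivAt_aeval_amu hE ht k ((uPoly ℂ n).coeff j)
      have hS : ∀ s ∈ V, S s n j = S s n n / atau E ρ n (addAt t k s) *
          MvPolynomial.aeval (amu E ρ (addAt t k s)) ((uPoly ℂ n).coeff j) := fun s hs => by
        rw [← coeff_pPoly (hf s hs).lower, analytic_pPoly_eq (hf s hs), Polynomial.coeff_C_mul,
          ← map_aeval_hankelPoly ℂ, Polynomial.coeff_map]
        rfl
      exact ⟨_, fun h => absurd h hnj.not_gt, ((hd.div (hρ.hasDerivAt_atau hE ht k n).hasDerivWithinAt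
        (atau_ne_zero (hf 0 h0) n)).mul hp.hasDerivWithinAt).congr hS (hS 0 h0)⟩
  choose S' hS' using h
  exact ⟨S', fun i j => (hS' i j).1, fun i j => (hS' i j).2⟩

/-- The Toda equations. -/
theorem IsWeight.hasMatDeriv_lax (hV : AccPt (0 : ℂ) (Filter.principal V)) :
    RowBounded V (fun s => lax (S s) (T s)) (todaSkew ℂ (lax (S 0) (T 0)) k) ∧
      HasMatDeriv V (fun s => lax (S s) (T s)) (todaSkew ℂ (lax (S 0) (T 0)) k) := by
  obtain ⟨S', hSl, hS'⟩ := hρ.exists_hasMatDeriv_S hE ht h0 hf hc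
  obtain ⟨T', hTl, hT'⟩ := hρ.exists_hasMatDeriv_T hE ht h0 hf hS'
  have bS : RowBounded V S S' := rowBounded_of_lower hSl fun s hs => (hf s hs).lower
  have bT : RowBounded V T T' := rowBounded_of_lower hTl fun s hs => (hf s hs).lower_inv
  have bΛ : RowBounded V (fun _ => shiftMat) 0 := rowBounded_const V rowFinite_shiftMat
  have hTt : HasMatDeriv V (fun s => (T s).transpose) T'.transpose := fun i j => hT' j i
  have hm : HasMatDeriv V (fun s => amom E ρ (addAt t k s))
      (fun i j => amom E ρ t (i + k) j) := fun i j => by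
    simp only [amom_eq]
    rw [add_right_comm]
    exact (hρ.hasDerivAt_amu hE ht k (i + j)).hasDerivWithinAt
  -- m = T Tᵀ and S T = 1 hold along V only. Their derivatives may be equated because 0 is an
  -- accumulation point of V.
  have h1 := hm.unique hV (HasMatDeriv.imul h0 bT hT' hTt) h0 fun s hs => (hf s hs).factor
  have h2 := (HasMatDeriv.imul h0 bS hS' hT').unique hV (hasMatDeriv_const V 1) h0
    fun s hs => (hf s hs).mul_inv
  have hf0 := hf 0 h0
  rw [addAt_zero] at hf0
  rw [← deriv_lax_eq_todaSkew hf0 k hSl hTl (fun _ _ => rfl) h1 h2]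
  have b1 := bS.imul h0 bΛ
  have d1 := HasMatDeriv.imul h0 bS hS' (hasMatDeriv_const V shiftMat)
  rw [imul_zero, add_zero] at b1 d1
  exact ⟨b1.imul h0 bT, HasMatDeriv.imul h0 b1 d1 hT'⟩

theorem IsWeight.hasMatDeriv_toda (l : ℕ) :
    HasMatDeriv V (fun s => lax (S s) (T s)) (todaSkew ℂ (lax (S 0) (T 0)) k) ∧
      HasMatDeriv V (fun s => todaSkew ℂ (lax (S s) (T s)) l)
        (todaSkewDeriv ℂ (lax (S 0) (T 0)) l k) := by
  by_cases hV : AccPt (0 : ℂ) (Filter.principal V)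
  · obtain ⟨hb, hd⟩ := hρ.hasMatDeriv_lax hE ht h0 hf hc hV
    exact ⟨hd, hasMatDeriv_todaSkew h0 k (hf 0 h0).rowFinite_L hb hd l⟩
  -- At an isolated point every number is a derivative within V.
  · exact ⟨fun i j => HasFDerivWithinAt.of_not_accPt hV, fun i j => HasFDerivWithinAt.of_not_accPt hV⟩

end AnalyticToda

/-! ### The bilinear identity as a contour integral. -/

section ContourIntegral

variable {E : Set ℝ} {ρ : ℝ → ℝ} {R : ℝ} (hρ : IsWeight E ρ) (hE : E ⊆ Set.Icc (-R) R)
include hρ hE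

theorem IsWeight.intervalIntegral_integral_swap {a b : ℝ} {K : ℝ → ℝ → ℂ}
    (hK : ContinuousOn (Function.uncurry K) (Set.uIcc a b ×ˢ Set.Icc (-R) R)) :
    ∫ θ in a..b, ∫ u in E, (ρ u : ℂ) * K θ u = ∫ u in E, ∫ θ in a..b, (ρ u : ℂ) * K θ u := by
  refine MeasureTheory.intervalIntegral_integral_swap ?_
  have hi : IntegrableOn (fun u => (ρ u : ℂ)) E := by
    simpa using hρ.integrableOn_smul hE (c := fun _ => (1 : ℂ)) continuousOn_const
  have hfin : IsFiniteMeasure (volume.restrict (Set.uIoc a b)) :=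
    ⟨by rw [Measure.restrict_apply_univ, Real.volume_uIoc]; exact ENNReal.ofReal_lt_top⟩
  have hi2 := Integrable.comp_snd hi (volume.restrict (Set.uIoc a b))
  have hcpt : IsCompact (Set.uIcc a b ×ˢ Set.Icc (-R) R) := isCompact_uIcc.prod isCompact_Icc
  obtain ⟨M, hM⟩ := hcpt.exists_bound_of_continuousOn hK
  have hsub : Set.uIoc a b ×ˢ E ⊆ Set.uIcc a b ×ˢ Set.Icc (-R) R :=
    Set.prod_mono Set.uIoc_subset_uIcc hE
  refine hi2.mul_bdd (c := M) ?_ ?_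
  · rw [Measure.prod_restrict]
    exact (hK.aestronglyMeasurable_of_isCompact hcpt hcpt.measurableSet).mono_measure
      (Measure.restrict_mono hsub le_rfl)
  · rw [Measure.prod_restrict]
    filter_upwards [ae_restrict_mem (measurableSet_uIoc.prod hρ.meas)] with p hp
    exact hM p (hsub hp)

/-- Cauchy's formula, integrated against the weight. -/
theorem IsWeight.circleIntegral_integral {r : ℝ} (hr : R < r) {G : ℂ → ℂ}
    (hG : DiffContOnCl ℂ G (Metric.ball 0 r)) {c : ℝ → ℂ} (hc : ContinuousOn c (Set.Icc (-R) R)) :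
    (∮ z in C(0, r), G z * ∫ u in E, (ρ u : ℂ) * (c u * (z - u)⁻¹)) =
      2 * Real.pi * Complex.I * ∫ u in E, (ρ u : ℂ) * (c u * G u) := by
  have hr0 : 0 < r := (hρ.radius_pos hE).trans hr
  have hGc : ContinuousOn G (Metric.closedBall 0 r) := by
    rw [← closure_ball _ hr0.ne']
    exact hG.continuousOn
  have hne : ∀ θ : ℝ, ∀ u ∈ Set.Icc (-R) R, circleMap 0 r θ - u ≠ 0 := fun θ u hu h => by
    have h1 := norm_ofReal_le_of_mem_Icc hu
    rw [← sub_eq_zero.mp h, norm_circleMap_zero, abs_of_pos hr0] at h1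
    exact absurd h1 hr.not_ge
  have hK : ContinuousOn (Function.uncurry fun θ u : ℝ => c u *
      (deriv (circleMap 0 r) θ * ((circleMap 0 r θ - u)⁻¹ * G (circleMap 0 r θ))))
      (Set.uIcc 0 (2 * Real.pi) ×ˢ Set.Icc (-R) R) := by
    refine (hc.comp continuousOn_snd fun p hp => hp.2).mul (ContinuousOn.mul ?_ (.mul ?_ ?_))
    · simp only [deriv_circleMap]
      fun_prop
    · refine ContinuousOn.inv₀ (by fun_prop) fun p hp => hne p.1 p.2 hp.2
    · refine hGc.comp (by fun_prop) fun p _ => ?_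
      exact circleMap_mem_closedBall 0 hr0.le p.1
  have h := hρ.intervalIntegral_integral_swap hE hK
  have h1 : (∮ z in C(0, r), G z * ∫ u in E, (ρ u : ℂ) * (c u * (z - u)⁻¹)) =
      ∫ θ in (0 : ℝ)..(2 * Real.pi), ∫ u in E, (ρ u : ℂ) * (c u *
        (deriv (circleMap 0 r) θ * ((circleMap 0 r θ - u)⁻¹ * G (circleMap 0 r θ)))) := by
    refine intervalIntegral.integral_congr fun θ _ => ?_
    simp only [smul_eq_mul, ← integral_const_mul]
    congr 1
    ext1 u
    ring
  rw [h1, h, ← integral_const_mul]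
  refine setIntegral_congr_fun hρ.meas fun u hu => ?_
  have hu' : (u : ℂ) ∈ Metric.ball 0 r := by
    rw [mem_ball_zero_iff]
    exact (norm_ofReal_le_of_mem_Icc (hE hu)).trans_lt hr
  have hcau := hG.circleIntegral_sub_inv_smul hu'
  simp only [intervalIntegral.integral_const_mul]
  simp only [circleIntegral, smul_eq_mul] at hcau
  rw [hcau]
  ring

/-- On the circle the integrand is P_n(t;z) exp(Σ(t_i - t'_i) z^i) times the Cauchy transform of
P_m(t';u) ρ_{t'}(u). Cauchy's formula evaluates the first two factors at u, where ρ_{t'} becomes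
ρ_t, and orthogonality gives 0. -/
theorem IsWeight.circleIntegral_bilinear {n m : ℕ} {t t' : Times} {r : ℝ} (hmn : m + 1 ≤ n)
    (hr : R < r) (ht : ConvergesOn R t) (ht' : ConvergesOn R t') (hs : ConvergesOn r (t - t')) :
    (∮ z in C(0, r), atau E ρ n (t - bracketPt z⁻¹) * atau E ρ (m + 1) (t' + bracketPt z⁻¹) *
      Complex.exp (timeSum (t - t') z) * z ^ (n - m - 1)) = 0 := by
  have hR := hρ.radius_pos hE
  have hr0 : 0 < r := hR.trans hr
  set P := hankelPoly (amu E ρ t) n with hP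
  set Q := hankelPoly (amu E ρ t') m with hQ
  have hPd : DiffContOnCl ℂ (fun z => P.eval z) (Metric.ball 0 r) :=
    (Polynomial.differentiable P).diffContOnCl
  have hed : DiffContOnCl ℂ (fun z => Complex.exp (timeSum (t - t') z)) (Metric.ball 0 r) :=
    (Complex.differentiable_exp (𝕜 := ℂ)).comp_diffContOnCl (hs.diffContOnCl_timeSum hr0)
  have hG := hPd.smul hed
  have hc : ContinuousOn (fun u : ℝ => Q.eval (u : ℂ) * Complex.exp (timeSum t' u))
      (Set.Icc (-R) R) :=
    ((Polynomial.continuous Q).comp Complex.continuous_ofReal).continuousOn.mul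
      ht'.continuousOn_timeSum_ofReal.cexp
  have h := hρ.circleIntegral_integral hE hr hG hc
  have h1 : ∫ u in E, (ρ u : ℂ) * (Q.eval (u : ℂ) * Complex.exp (timeSum t' u) *
      (P.eval (u : ℂ) * Complex.exp (timeSum (t - t') u))) = 0 := by
    rw [← momFun_hankelPoly_mul_eq_zero (amu E ρ t) Q
      ((natDegree_hankelPoly_le _ m).trans_lt hmn), ← hρ.integral_eval_mul_weightT hE ht]
    refine setIntegral_congr_fun hρ.meas fun u hu => ?_
    have h2 := weightT_add (ρ := ρ) hE ht' (ht.sub hR.le ht') hu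
    rw [add_sub_cancel] at h2
    simp only [h2, Polynomial.eval_mul]
    simp only [weightT]
    ring
  simp only [smul_eq_mul] at h
  rw [h1, mul_zero] at h
  refine Eq.trans (circleIntegral.integral_congr hr0.le fun z hz => ?_) h
  have hz' : ‖z‖ = r := mem_sphere_zero_iff_norm.mp hz
  have hzR : R < ‖z‖ := hr.trans_eq hz'.symm
  have hz0 : z ≠ 0 := norm_pos_iff.mp (hR.trans hzR)
  have hw := norm_inv_mul_lt hR hzR
  have h2 := hρ.momFun_hankelPoly_eq hE ht' m hzR
  rw [← hρ.integral_eval_mul_weightT hE (ht'.add hR.le (convergesOn_bracketPt hR.le hw))] at h2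
  have h3 : ∫ u in E, Q.eval (u : ℂ) * weightT ρ (t' + bracketPt z⁻¹) u =
      z * ∫ u in E, (ρ u : ℂ) * (Q.eval (u : ℂ) * Complex.exp (timeSum t' u) * (z - u)⁻¹) := by
    rw [← integral_const_mul]
    refine setIntegral_congr_fun hρ.meas fun u hu => ?_
    have h4 := hρ.weightT_add_bracketPt hE ht' hw hu
    have hzu : z - u ≠ 0 := fun h => by
      have h5 := norm_ofReal_le_of_mem_Icc (hE hu)
      rw [← sub_eq_zero.mp h] at h5
      exact absurd h5 (not_le.mpr hzR)
    have h5 : weightT ρ t' u * z * (z - u)⁻¹ = weightT ρ (t' + bracketPt z⁻¹) u := by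
      rw [← h4]
      field_simp
    simp only [← h5]
    simp only [weightT]
    ring
  rw [h3] at h2
  rw [hP, hρ.eval_hankelPoly_eq hE ht n hzR]
  -- The exponent is m + 1 rather than m because the kernel is 1/(z - u) and not z/(z - u).
  have h6 : ∫ u in E, (ρ u : ℂ) * (Q.eval (u : ℂ) * Complex.exp (timeSum t' u) * (z - u)⁻¹) =
      z⁻¹ ^ (m + 1) * atau E ρ (m + 1) (t' + bracketPt z⁻¹) := by
    rw [pow_succ', mul_assoc, ← h2, inv_mul_cancel_left₀ hz0]
  rw [h6]
  have h7 : z ^ n * z⁻¹ ^ (m + 1) = z ^ (n - m - 1) := by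
    rw [inv_pow, ← div_eq_mul_inv, div_eq_iff (pow_ne_zero _ hz0), ← pow_add]
    congr 1
    lia
  rw [← h7]
  ring

end ContourIntegral

end

end TodaKP

/-! ### Assembly of the formal and the analytic statements. -/

open TodaKP in
theorem theorem5p2 (E : Set ℝ) (ρ : ℝ → ℝ) (hρ : IsWeight E ρ) :
    -- PART A: arbitrary weights, identities between formal power series in `t`
    (
      -- the multiple integral, coefficient by coefficient
      (∀ (n : ℕ) (α : ℕ+ →₀ ℕ),
        IntegrableOn (fun x : Fin n → ℝ => vandermondeSq x *
          MvPowerSeries.coeff α (∏ k, fexp (x k)) * ∏ k, ρ (x k)) (Set.univ.pi fun _ => E) ∧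
        MvPowerSeries.coeff α (ftau E ρ n) = (1 / (n.factorial : ℝ)) *
          ∫ x in Set.univ.pi fun _ : Fin n => E, vandermondeSq x *
            MvPowerSeries.coeff α (∏ k, fexp (x k)) * ∏ k, ρ (x k)) ∧
      -- positivity, existence of the factorization
      (∀ n, 0 < MvPowerSeries.constantCoeff (ftau E ρ n)) ∧
      (∃ S T, IsLowerFactorization (fmom E ρ) S T ∧
        ∀ n, 0 < MvPowerSeries.constantCoeff (S n n)) ∧
      (∀ S T, IsLowerFactorization (fmom E ρ) S T →
        -- (i) `S n n` is the square root `h_n^{-1/2}`, `h_n = τ_{n+1} / τ_n`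
        (∀ n, S n n ^ 2 = ftau E ρ n * (ftau E ρ (n + 1))⁻¹) ∧
        -- eigenvectors of `L`
        (∀ n, iact (lax S T) (fp S) n = fz * fp S n) ∧
        (∀ n, 1 ≤ n →
          iact (lax S T) (fun k => ofW (fq E ρ S k)) n = fz * ofW (fq E ρ S n)) ∧
        LinearIndependent FLaurent ![fp S, fun n => ofW (fq E ρ S n)] ∧
        -- orthonormal polynomials
        (∀ n, (pPoly S n).natDegree = n) ∧
        (∀ m n, (fint E ρ fun u => (pPoly S m).eval (MvPowerSeries.C u) *
            (pPoly S n).eval (MvPowerSeries.C u) * fexp u) = if m = n then 1 else 0) ∧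
        (∀ n, fp S n = fz ^ n * ofW (PowerSeries.C (S n n * (ftau E ρ n)⁻¹) *
            fshift (-1) (ftau E ρ n))) ∧
        -- Stieltjes transforms
        (∀ n, fq E ρ S n = PowerSeries.mk fun j => T.transpose n j) ∧
        (∀ n, ofW (fq E ρ S n) = fw ^ n * ofW (PowerSeries.C (S n n * (ftau E ρ n)⁻¹) *
            fshift 1 (ftau E ρ (n + 1)))) ∧
        -- (ii) the entries of `L`
        (∀ n, lax S T n n = fpd 1 (flog (ftau E ρ (n + 1) * (ftau E ρ n)⁻¹))) ∧
        (∀ n, lax S T (n + 1) n = lax S T n (n + 1) ∧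
          lax S T n (n + 1) * S (n + 1) (n + 1) = S n n ∧
          lax S T n (n + 1) ^ 2 =
            ftau E ρ n * ftau E ρ (n + 2) * ((ftau E ρ (n + 1)) ^ 2)⁻¹) ∧
        (∀ i j, i + 1 < j → lax S T i j = 0 ∧ lax S T j i = 0) ∧
        -- the Toda lattice
        (∀ (k : ℕ+) (i j : ℕ), fpd k (lax S T i j) = todaSkew ℝ (lax S T) k i j) ∧
        (∀ k : ℕ+, todaSkew ℝ (lax S T) k = todaBorel ℝ (lax S T) k) ∧
        (∀ (k l : ℕ+) (i j : ℕ),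
          fpd l (todaSkew ℝ (lax S T) k i j) = fpd k (todaSkew ℝ (lax S T) l i j))) ∧
      -- (iii) the bilinear identity
      (∀ n m : ℕ, m + 1 ≤ n → ∀ α : (ℕ+ ⊕ ℕ+) →₀ ℕ,
        (Function.support fun j => MvPowerSeries.coeff α
          (residueTerm (ftau E ρ n) (ftau E ρ (m + 1)) (n - m - 1) j)).Finite ∧
        ∑ᶠ j, MvPowerSeries.coeff α
          (residueTerm (ftau E ρ n) (ftau E ρ (m + 1)) (n - m - 1) j) = 0) ∧
      -- (iv) the KP hierarchy and the KP equation
      (∀ n k : ℕ, 1 ≤ n → fhirota (kpPoly ℝ k) (ftau E ρ n) (ftau E ρ n) = 0) ∧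
      (∀ n : ℕ, 1 ≤ n →
        fpd 1 (fpd 1 (fpd 1 (fpd 1 (flog (ftau E ρ n))))) + 3 * fpd 2 (fpd 2 (flog (ftau E ρ n)))
          - 4 * fpd 1 (fpd 3 (flog (ftau E ρ n)))
          + 6 * (fpd 1 (fpd 1 (flog (ftau E ρ n)))) ^ 2 = 0)
    ) ∧
    -- PART B: weights on a bounded set, identities between functions of `t`
    (∀ R : ℝ, E ⊆ Set.Icc (-R) R →
      -- the multiple integral; smoothness
      (∀ (n : ℕ) (t : Times), ConvergesOn R t →
        IntegrableOn (fun x : Fin n → ℝ => (vandermondeSq x : ℂ) * ∏ k, weightT ρ t (x k))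
          (Set.univ.pi fun _ => E) ∧
        atau E ρ n t = (1 / (n.factorial : ℂ)) *
          ∫ x in Set.univ.pi fun _ : Fin n => E,
            (vandermondeSq x : ℂ) * ∏ k, weightT ρ t (x k)) ∧
      (∀ (n N : ℕ) (t : Times), ConvergesOn R t → Differentiable ℂ fun s : Fin N → ℂ =>
        atau E ρ n (t + ∑ i : Fin N, Pi.single (Nat.succPNat i) (s i))) ∧
      -- existence of the factorization
      (∀ t : Times, ConvergesOn R t → (∀ n, atau E ρ n t ≠ 0) →
        ∃ S T, IsLowerFactorization (amom E ρ t) S T) ∧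
      (∀ t : Times, ConvergesOn R t → (∀ i, (t i).im = 0) →
        (∀ n, 0 < (atau E ρ n t).re ∧ (atau E ρ n t).im = 0) ∧
        ∃ S T : Matrix ℕ ℕ ℝ, (∀ n, 0 < S n n) ∧
          IsLowerFactorization (amom E ρ t) (S.map Complex.ofReal) (T.map Complex.ofReal)) ∧
      (∀ (t : Times) (S T : Matrix ℕ ℕ ℂ), ConvergesOn R t →
        IsLowerFactorization (amom E ρ t) S T →
        -- (i) `S n n` is the square root `h_n^{-1/2}`, `h_n = τ_{n+1} / τ_n`
        (∀ n, atau E ρ n t ≠ 0) ∧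
        (∀ n, S n n ^ 2 = atau E ρ n t / atau E ρ (n + 1) t) ∧
        -- eigenvectors of `L`
        (∀ n z, iact (lax S T) (fun k => (pPoly S k).eval z) n = z * (pPoly S n).eval z) ∧
        (∀ n z, R < ‖z‖ → 1 ≤ n →
          iact (lax S T) (fun k => aq E ρ t S k z) n = z * aq E ρ t S n z) ∧
        (∀ z, R < ‖z‖ →
          LinearIndependent ℂ ![fun n => (pPoly S n).eval z, fun n => aq E ρ t S n z]) ∧
        -- orthonormal polynomials
        (∀ n, (pPoly S n).natDegree = n) ∧
        (∀ m n, (∫ u in E, (pPoly S m).eval (u : ℂ) * (pPoly S n).eval (u : ℂ) * weightT ρ t u) =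
          if m = n then 1 else 0) ∧
        (∀ n z, R < ‖z‖ → (pPoly S n).eval z =
          z ^ n * S n n * (atau E ρ n (t - bracketPt z⁻¹) / atau E ρ n t)) ∧
        -- Stieltjes transforms
        (∀ n z, R < ‖z‖ → HasSum (fun j => T.transpose n j * z⁻¹ ^ j) (aq E ρ t S n z)) ∧
        (∀ n z, R < ‖z‖ → aq E ρ t S n z =
          z⁻¹ ^ n * S n n * (atau E ρ (n + 1) (t + bracketPt z⁻¹) / atau E ρ n t)) ∧
        -- (ii) the entries of `L`
        (∀ n, lax S T n n =
          apd 1 (logNear (fun t' => atau E ρ (n + 1) t' / atau E ρ n t') t) t) ∧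
        (∀ n, lax S T (n + 1) n = lax S T n (n + 1) ∧
          lax S T n (n + 1) * S (n + 1) (n + 1) = S n n ∧
          lax S T n (n + 1) ^ 2 = atau E ρ n t * atau E ρ (n + 2) t / atau E ρ (n + 1) t ^ 2) ∧
        (∀ i j, i + 1 < j → lax S T i j = 0 ∧ lax S T j i = 0)) ∧
      -- the Toda lattice, for factorizations on a set `U` of times (for instance all real ones),
      -- the choice of signs of the square roots `S n n` being continuous along each `t_k`
      (∀ (U : Set Times) (S T : Times → Matrix ℕ ℕ ℂ),
        (∀ t ∈ U, ConvergesOn R t ∧ IsLowerFactorization (amom E ρ t) (S t) (T t)) →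
        (∀ t ∈ U, ∀ (k : ℕ+) (n : ℕ),
          ContinuousWithinAt (fun s : ℂ => S (addAt t k s) n n) {s | addAt t k s ∈ U} 0) →
        ∀ t ∈ U,
          (∀ (k : ℕ+) (i j : ℕ),
            HasDerivWithinAt (fun s : ℂ => lax (S (addAt t k s)) (T (addAt t k s)) i j)
              (todaSkew ℂ (lax (S t) (T t)) k i j) {s | addAt t k s ∈ U} 0) ∧
          (∀ k : ℕ+, todaSkew ℂ (lax (S t) (T t)) k = todaBorel ℂ (lax (S t) (T t)) k) ∧
          (∀ (k l : ℕ+) (i j : ℕ), ∃ D : ℂ,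
            HasDerivWithinAt
              (fun s : ℂ => todaSkew ℂ (lax (S (addAt t l s)) (T (addAt t l s))) k i j)
              D {s | addAt t l s ∈ U} 0 ∧
            HasDerivWithinAt
              (fun s : ℂ => todaSkew ℂ (lax (S (addAt t k s)) (T (addAt t k s))) l i j)
              D {s | addAt t k s ∈ U} 0)) ∧
      -- (iii) the bilinear identity
      (∀ (n m : ℕ) (t t' : Times) (r : ℝ), m + 1 ≤ n → R < r →
        ConvergesOn R t → ConvergesOn R t' → ConvergesOn r (t - t') →
        (∮ z in C(0, r), atau E ρ n (t - bracketPt z⁻¹) * atau E ρ (m + 1) (t' + bracketPt z⁻¹) *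
          Complex.exp (timeSum (t - t') z) * z ^ (n - m - 1)) = 0) ∧
      -- (iv) the KP hierarchy and the KP equation
      (∀ (n k : ℕ) (t : Times), 1 ≤ n → ConvergesOn R t →
        ahirota (kpPoly ℂ k) (atau E ρ n) (atau E ρ n) t = 0) ∧
      (∀ (n : ℕ) (t : Times), 1 ≤ n → ConvergesOn R t → atau E ρ n t ≠ 0 →
        apd 1 (apd 1 (apd 1 (apd 1 (logNear (atau E ρ n) t)))) t
          + 3 * apd 2 (apd 2 (logNear (atau E ρ n) t)) t
          - 4 * apd 1 (apd 3 (logNear (atau E ρ n) t)) t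
          + 6 * (apd 1 (apd 1 (logNear (atau E ρ n) t)) t) ^ 2 = 0)) := by
  refine ⟨?_, fun R hR => ?_⟩
  · refine ⟨fun n α => ⟨hρ.integrableOn_coeff_prod_fexp n α, hρ.coeff_ftau n α⟩,
      hρ.constantCoeff_ftau_pos, hρ.exists_formal_factorization, fun S T hf => ?_,
      fun n m hmn α => formal_bilinear hmn α, fun n k hn => fhirota_kpPoly_ftau E ρ n k hn,
      fun n hn => formal_kp hρ n hn⟩
    refine ⟨fun n => ?_, fun n => ?_, fun n hn => ?_, formal_linearIndependent hρ hf,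
      hf.natDegree_pPoly, fun m n => ?_, fp_eq_fshift hρ hf, fun n => ?_, ofW_fq_eq_fshift hρ hf,
      formal_lax_diag hρ hf, fun n => ⟨hf.lax_symm fmom_eq _ _, hf.lax_succ_mul n, ?_⟩,
      hf.lax_eq_zero fmom_eq, fun k i j => ?_, fun k => todaSkew_eq_todaBorel hf.rowFinite_L k,
      fun k l i j => ?_⟩
    · have h := hf.S_sq_mul fmom_eq n
      rw [← ftau_eq_hankel, ← ftau_eq_hankel] at h
      linear_combination (ftau E ρ (n + 1))⁻¹ * h - S n n ^ 2 * hρ.inv_mul_ftau (n + 1)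
    · exact formal_iact_lax_fp hf n
    · exact formal_iact_lax_fq hρ hf hn
    · exact (hρ.fint_eval_mul _ _).trans (hf.momFun_pPoly_mul_pPoly fmom_eq m n)
    · rw [hρ.fq_eq]
      ext1 j
      rw [momFun_stieltjesSeq_coeff, hf.momFun_pPoly_mul_X_pow fmom_eq, PowerSeries.coeff_mk,
        Matrix.transpose_apply]
    · have h := hf.lax_succ_sq_mul fmom_eq n
      rw [← ftau_eq_hankel, ← ftau_eq_hankel, ← ftau_eq_hankel] at h
      have hi := MvPowerSeries.inv_mul_cancel (ftau E ρ (n + 1) ^ 2)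
        (by rw [map_pow]; exact pow_ne_zero 2 (hρ.constantCoeff_ftau_pos (n + 1)).ne')
      linear_combination (ftau E ρ (n + 1) ^ 2)⁻¹ * h - lax S T n (n + 1) ^ 2 * hi
    · exact congrFun (congrFun (hf.map_lax (MvPowerSeries.pderiv ℝ k) k (fpd_fmom k)) i) j
    -- Both sides are second derivatives of L, so commutation is the equality of mixed partial
    -- derivatives.
    · have h : ∀ (k : ℕ+), todaSkew ℝ (lax S T) k i j = fpd k (lax S T i j) := fun k =>
        (congrFun (congrFun (hf.map_lax (MvPowerSeries.pderiv ℝ k) k (fpd_fmom k)) i) j).symm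
      rw [h, h]
      exact pderiv_comm _ _ _
  · refine ⟨fun n t ht => hρ.integral_atau hR ht n, fun n N t ht => hρ.differentiable_atau hR ht n N,
      fun t _ h => exists_factorization h, fun t ht hr => hρ.exists_real_factorization hR ht hr,
      fun t S T ht hf => ?_, fun U S T hU hc t ht => ?_,
      fun n m t t' r hmn hr ht ht' hs => hρ.circleIntegral_bilinear hR hmn hr ht ht' hs,
      fun n k t hn ht => hρ.ahirota_kpPoly hR ht n k hn,
      fun n t hn ht h0 => hρ.analytic_kp hR ht hn h0⟩
    · refine ⟨atau_ne_zero hf, analytic_S_sq hf, iact_lax_eval hf,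
        fun n z hz hn => hρ.iact_lax_aq hR ht hf hz hn,
        fun z hz => hρ.linearIndependent_aq hR ht hf hz, hf.natDegree_pPoly,
        hρ.integral_pPoly_mul_pPoly hR ht hf, fun n z hz => hρ.eval_pPoly hR ht hf n hz,
        fun n z hz => hρ.hasSum_aq hR ht hf n hz, fun n z hz => hρ.aq_eq_atau hR ht hf n hz,
        hρ.lax_diag_eq hR ht hf,
        fun n => ⟨hf.lax_symm (amom_eq t) _ _, hf.lax_succ_mul n, ?_⟩, hf.lax_eq_zero (amom_eq t)⟩
      have h := hf.lax_succ_sq_mul (amom_eq t) n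
      rw [← atau_eq_hankel, ← atau_eq_hankel, ← atau_eq_hankel] at h
      rw [eq_div_iff (pow_ne_zero 2 (atau_ne_zero hf _)), h]
    · have hmem : ∀ k : ℕ+, (0 : ℂ) ∈ {s | addAt t k s ∈ U} := fun k => by simpa using ht
      have h := fun k : ℕ+ => hρ.hasMatDeriv_toda hR (hU t ht).1 (hmem k)
        (S := fun s => S (addAt t k s)) (T := fun s => T (addAt t k s))
        (fun s hs => (hU _ hs).2) (hc t ht k)
      simp only [addAt_zero] at h
      have hL := (hU t ht).2.rowFinite_L
      -- The first component of `h k l` does not involve l, so 0 is an arbitrary choice. The common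
      -- derivative D is an entry of `todaSkewDeriv`, which is symmetric in the two flows.
      refine ⟨fun k => (h k 0).1, fun k => todaSkew_eq_todaBorel hL k, fun k l i j => ⟨_, (h l k).2 i j, ?_⟩⟩
      rw [todaSkewDeriv_comm hL]
      exact (h k l).2 i j
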